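/- All vector spaces are over $\mathbb{C}$, $\odot$ is the algebraic tensor product, $\iota$ the identity, $V'$ the algebraic dual of $V$, and $M(B)$ the multiplier algebra of a non-degenerate algebra $B$. A homomorphism $\pi:B\to M(C)$ is non-degenerate if $\pi(B)C=C=C\pi(B)$ (linear spans); it then extends uniquely to $M(B)$, and the extension is again denoted $\pi$. Let $(A,\Delta)$ be an algebraic quantum group, that is: $A$ is a non-degenerate algebra, $\Delta:A\to M(A\odot A)$ is a non-degenerate homomorphism with $(\Delta\odot\iota)\Delta=(\iota\odot\Delta)\Delta$, the four maps $a\otimes b\mapsto\Delta(a)(b\otimes1)$, $\Delta(a)(1\otimes b)$, $(b\otimes1)\Delta(a)$, $(1\otimes b)\Delta(a)$ are bijections of $A\odot A$ onto $A\odot A$, and there is a non-zero functional $\varphi\in A'$ with $(\iota\odot\varphi)\Delta(a)=\varphi(a)1$ for all $a\in A$; fix such a $\varphi$. Here, for $\omega\in A'$, the element $(\iota\odot\omega)\Delta(a)\in M(A)$ is defined by $[(\iota\odot\omega)\Delta(a)]\,b=(\iota\odot\omega)(\Delta(a)(b\otimes1))$ and $b\,[(\iota\odot\omega)\Delta(a)]=(\iota\odot\omega)((b\otimes1)\Delta(a))$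 for $b\in A$, and $(\omega\odot\iota)\Delta(a)$ similarly. Let $\hat A=\{\varphi(a\,\cdot\,)\mid a\in A\}\subseteq A'$, a non-degenerate algebra with the product $(\omega_1\omega_2)(x)=\omega_1((\iota\odot\omega_2)\Delta(x))=\omega_2((\omega_1\odot\iota)\Delta(x))$, and regard $\hat A\odot\hat A$ as a subspace of $(A\odot A)'$. On $A\odot A$ use the comultiplication $\Delta(a\otimes b)=(\iota\odot\chi\odot\iota)(\Delta(a)\otimes\Delta(b))$, where $\chi$ is the flip. Then: 1. For every $T\in M(\hat A)$ there is exactly one $\theta\in A'$ such that $T\omega=\theta((\iota\odot\omega)\Delta(\,\cdot\,))$ and $\omega T=\theta((\omega\odot\iota)\Delta(\,\cdot\,))$ for all $\omega\in\hat A$. The map $T\mapsto\theta$ is linear and injective, and its image is the set of all $\theta\in A'$ such that $(\theta\odot\iota)\Delta(a)$ and $(\iota\odot\theta)\Delta(a)$ belong to $A$ for every $a\in A$. In the same way (with $\hat A\odot\hat A$ and $A\odot A$ in the place of $\hat A$ and $A$), every $T\in M(\hat A\odot\hat A)$ is given by exactly one functional in $(A\odot A)'$, and this is a linear injection $M(\hat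 A\odot\hat A)\to(A\odot A)'$. Below, multipliers are identified with these functionals. 2. There is exactly one non-degenerate homomorphism $\hat\Delta:\hat A\to M(\hat A\odot\hat A)$ such that for all $\omega_1,\omega_2\in\hat A$ the elements $\hat\Delta(\omega_1)(1\otimes\omega_2)$ and $(\omega_1\otimes1)\hat\Delta(\omega_2)$ belong to $\hat A\odot\hat A$ and, for all $x,y\in A$, $$[\hat\Delta(\omega_1)(1\otimes\omega_2)](x\otimes y)=(\omega_1\odot\omega_2)((x\otimes1)\Delta(y)),\qquad [(\omega_1\otimes1)\hat\Delta(\omega_2)](x\otimes y)=(\omega_1\odot\omega_2)(\Delta(x)(1\otimes y)).$$ 3. For every $\omega\in M(\hat A)$ and all $a,b\in A$, $$\hat\Delta(\omega)(a\otimes b)=\omega(ab).$$ 4. For all $\omega,\omega_1,\omega_2\in M(\hat A)$ and all $x,y\in A$, $$[\hat\Delta(\omega)(\omega_1\otimes\omega_2)](x\otimes y)=\omega\bigl((\iota\odot\omega_1)\Delta(x)\cdot(\iota\odot\omega_2)\Delta(y)\bigr).$$ -/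

import Mathlib

open scoped TensorProduct

set_option linter.unusedSectionVars false

noncomputable section

namespace AQG

section Multipliers

variable {A : Type*} [NonUnitalRing A] [Module ℂ A] [IsScalarTower ℂ A A] [SMulCommClass ℂ A A]

/-- A non-degenerate algebra: `a b = 0` for all `b` forces `a = 0`, and likewise on the other side. -/
def NondegAlg (A : Type*) [NonUnitalRing A] : Prop :=
  ∀ a : A, ((∀ b, a * b = 0) → a = 0) ∧ ((∀ b, b * a = 0) → a = 0)

variable (A) in
/-- The multiplier algebra `M(A)`: pairs `(L, R)` of linear maps on `A` (left and right
multiplication by the multiplier) with `L(ab) = L(a)b`, `R(ab) = aR(b)` and `R(a)b = aL(b)`.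
The product is `(L₁, R₁)(L₂, R₂) = (L₁ ∘ L₂, R₂ ∘ R₁)`. -/
def multiplierAlgebra : Subalgebra ℂ (Module.End ℂ A × (Module.End ℂ A)ᵐᵒᵖ) where
  carrier := {T | (∀ a b, T.1 (a * b) = T.1 a * b) ∧
    (∀ a b, T.2.unop (a * b) = a * T.2.unop b) ∧ ∀ a b, T.2.unop a * b = a * T.1 b}
  mul_mem' := by
    rintro S T ⟨h1, h2, h3⟩ ⟨k1, k2, k3⟩
    refine ⟨?_, ?_, ?_⟩ <;> intro a b <;> simp [h1, h2, h3, k1, k2, k3]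
  add_mem' := by
    rintro S T ⟨h1, h2, h3⟩ ⟨k1, k2, k3⟩
    refine ⟨?_, ?_, ?_⟩ <;> intro a b <;> simp [h1, h2, h3, k1, k2, k3, add_mul, mul_add]
  algebraMap_mem' := by
    intro r
    refine ⟨?_, ?_, ?_⟩ <;> intro a b <;>
      simp [Prod.algebraMap_apply, Module.algebraMap_end_apply, MulOpposite.algebraMap_apply,
        smul_mul_assoc, mul_smul_comm]

variable (A) in
/-- The multiplier algebra as a type. -/
def Mult : Type _ := ↥(multiplierAlgebra A)

instance : Ring (Mult A) := inferInstanceAs (Ring ↥(multiplierAlgebra A))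
instance : Algebra ℂ (Mult A) := inferInstanceAs (Algebra ℂ ↥(multiplierAlgebra A))
instance : AddCommGroup (Mult A) := inferInstance
instance : Module ℂ (Mult A) := Algebra.toModule

/-- The pair of left and right multiplication maps of a multiplier. -/
def Mult.pair : Mult A →ₗ[ℂ] Module.End ℂ A × (Module.End ℂ A)ᵐᵒᵖ :=
  (multiplierAlgebra A).val.toLinearMap

/-- `T · a` for a multiplier `T`, as an element of `A`. -/
def Mult.lact (T : Mult A) : A →ₗ[ℂ] A := T.1.1

/-- `a · T` for a multiplier `T`, as an element of `A`. -/
def Mult.ract (T : Mult A) : A →ₗ[ℂ] A := T.1.2.unop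

theorem Mult.lact_mul' (T : Mult A) (a b : A) : T.lact (a * b) = T.lact a * b := T.2.1 a b
theorem Mult.ract_mul' (T : Mult A) (a b : A) : T.ract (a * b) = a * T.ract b := T.2.2.1 a b
theorem Mult.compat (T : Mult A) (a b : A) : T.ract a * b = a * T.lact b := T.2.2.2 a b

/-- A multiplier from its left and right multiplication maps. -/
def Mult.mk' (L R : A →ₗ[ℂ] A) (h1 : ∀ a b, L (a * b) = L a * b)
    (h2 : ∀ a b, R (a * b) = a * R b) (h3 : ∀ a b, R a * b = a * L b) : Mult A :=
  ⟨(L, MulOpposite.op R), h1, h2, h3⟩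

@[simp] theorem Mult.lact_mk' (L R : A →ₗ[ℂ] A) (h1 h2 h3) :
    (Mult.mk' L R h1 h2 h3).lact = L := rfl
@[simp] theorem Mult.ract_mk' (L R : A →ₗ[ℂ] A) (h1 h2 h3) :
    (Mult.mk' L R h1 h2 h3).ract = R := rfl

theorem Mult.ext' {S T : Mult A} (h1 : ∀ a, S.lact a = T.lact a)
    (h2 : ∀ a, S.ract a = T.ract a) : S = T := by
  apply Subtype.ext
  apply Prod.ext
  · exact LinearMap.ext h1
  · exact MulOpposite.unop_injective (LinearMap.ext h2)

@[simp] theorem Mult.lact_mul (S T : Mult A) (a : A) : (S * T).lact a = S.lact (T.lact a) := rfl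
@[simp] theorem Mult.ract_mul (S T : Mult A) (a : A) : (S * T).ract a = T.ract (S.ract a) := rfl
@[simp] theorem Mult.lact_add (S T : Mult A) (a : A) : (S + T).lact a = S.lact a + T.lact a := rfl
@[simp] theorem Mult.ract_add (S T : Mult A) (a : A) : (S + T).ract a = S.ract a + T.ract a := rfl
@[simp] theorem Mult.lact_smul (r : ℂ) (T : Mult A) (a : A) : (r • T).lact a = r • T.lact a := rfl
@[simp] theorem Mult.ract_smul (r : ℂ) (T : Mult A) (a : A) : (r • T).ract a = r • T.ract a := rfl
@[simp] theorem Mult.lact_zero (a : A) : (0 : Mult A).lact a = 0 := rfl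
@[simp] theorem Mult.ract_zero (a : A) : (0 : Mult A).ract a = 0 := rfl
@[simp] theorem Mult.lact_one (a : A) : (1 : Mult A).lact a = a := rfl
@[simp] theorem Mult.ract_one (a : A) : (1 : Mult A).ract a = a := rfl

/-- Left and right multiplication by an element of `A`, as a multiplier. -/
def embFun (a : A) : Mult A :=
  Mult.mk' (LinearMap.mulLeft ℂ a) (LinearMap.mulRight ℂ a)
    (fun x y => by simp [mul_assoc]) (fun x y => by simp [mul_assoc])
    (fun x y => by simp [mul_assoc])

theorem lact_embFun (a x : A) : (embFun a).lact x = a * x := rfl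
theorem ract_embFun (a x : A) : (embFun a).ract x = x * a := rfl

variable (A) in
/-- The canonical homomorphism `A → M(A)`; injective when `A` is non-degenerate. -/
def emb : A →ₙₐ[ℂ] Mult A where
  toFun := embFun
  map_smul' r a := Mult.ext' (fun x => by simp [lact_embFun, smul_mul_assoc])
    (fun x => by simp [ract_embFun, mul_smul_comm])
  map_zero' := Mult.ext' (fun x => by simp [lact_embFun]) (fun x => by simp [ract_embFun])
  map_add' a b := Mult.ext' (fun x => by simp [lact_embFun, add_mul])
    (fun x => by simp [ract_embFun, mul_add])
  map_mul' a b := Mult.ext' (fun x => by simp [lact_embFun, mul_assoc])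
    (fun x => by simp [ract_embFun, mul_assoc])

@[simp] theorem lact_emb (a x : A) : (emb A a).lact x = a * x := rfl
@[simp] theorem ract_emb (a x : A) : (emb A a).ract x = x * a := rfl

theorem emb_injective (h : NondegAlg A) : Function.Injective (emb A) := by
  rw [injective_iff_map_eq_zero]
  intro a ha
  refine (h a).1 fun b => ?_
  rw [← lact_emb, ha, Mult.lact_zero]

theorem mul_emb (T : Mult A) (a : A) : T * emb A a = emb A (T.lact a) :=
  Mult.ext' (fun x => by simp [Mult.lact_mul']) (fun x => by simp [Mult.compat])

theorem emb_mul (T : Mult A) (a : A) : emb A a * T = emb A (T.ract a) :=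
  Mult.ext' (fun x => by simp [Mult.compat]) (fun x => by simp [Mult.ract_mul'])

variable (A) in
/-- A linear left inverse of the embedding of `A` into pairs of linear maps on `A`. It is only
ever meant to be evaluated on the image of `A`, where it recovers the element of `A`. -/
def unPair : (Module.End ℂ A × (Module.End ℂ A)ᵐᵒᵖ) →ₗ[ℂ] A :=
  LinearMap.leftInverse (Mult.pair ∘ₗ (emb A : A →ₗ[ℂ] Mult A))

/-- The element of `A` underlying a multiplier that belongs to `A`. -/
def toAlg : Mult A →ₗ[ℂ] A := unPair A ∘ₗ Mult.pair

theorem unPair_emb (h : NondegAlg A) (a : A) : unPair A (Mult.pair (emb A a)) = a := by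
  refine LinearMap.leftInverse_apply_of_inj (LinearMap.ker_eq_bot.2 ?_) a
  intro x y hxy
  exact emb_injective h (Subtype.ext hxy)

theorem toAlg_emb (h : NondegAlg A) (a : A) : toAlg (emb A a) = a := unPair_emb h a

variable {B : Type*} [NonUnitalRing B] [Module ℂ B] [IsScalarTower ℂ B B] [SMulCommClass ℂ B B]

/-- The multiplier `S ⊗ T` of `A ⊙ B`. -/
def tensFun (S : Mult A) (T : Mult B) : Mult (A ⊗[ℂ] B) :=
  Mult.mk' (TensorProduct.map S.lact T.lact) (TensorProduct.map S.ract T.ract)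
    (fun x y => by
      induction x with
      | zero => simp
      | add x₁ x₂ h₁ h₂ => simp only [add_mul, map_add, h₁, h₂]
      | tmul a b =>
        induction y with
        | zero => simp
        | add x₁ x₂ h₁ h₂ => simp only [mul_add, map_add, h₁, h₂]
        | tmul c d => simp [Mult.lact_mul'])
    (fun x y => by
      induction x with
      | zero => simp
      | add x₁ x₂ h₁ h₂ => simp only [add_mul, map_add, h₁, h₂]
      | tmul a b =>
        induction y with
        | zero => simp
        | add x₁ x₂ h₁ h₂ => simp only [mul_add, map_add, h₁, h₂]
        | tmul c d => simp [Mult.ract_mul'])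
    (fun x y => by
      induction x with
      | zero => simp
      | add x₁ x₂ h₁ h₂ => simp only [add_mul, map_add, h₁, h₂]
      | tmul a b =>
        induction y with
        | zero => simp
        | add x₁ x₂ h₁ h₂ => simp only [mul_add, map_add, h₁, h₂]
        | tmul c d => simp [Mult.compat])

theorem lact_tensFun_tmul (S : Mult A) (T : Mult B) (a : A) (b : B) :
    (tensFun S T).lact (a ⊗ₜ b) = S.lact a ⊗ₜ T.lact b := rfl
theorem ract_tensFun_tmul (S : Mult A) (T : Mult B) (a : A) (b : B) :
    (tensFun S T).ract (a ⊗ₜ b) = S.ract a ⊗ₜ T.ract b := rfl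

/-- Two multipliers of `A ⊙ B` agree if they agree on elementary tensors. -/
theorem Mult.ext_tmul {S T : Mult (A ⊗[ℂ] B)} (h1 : ∀ a b, S.lact (a ⊗ₜ b) = T.lact (a ⊗ₜ b))
    (h2 : ∀ a b, S.ract (a ⊗ₜ b) = T.ract (a ⊗ₜ b)) : S = T :=
  Mult.ext' (fun x => DFunLike.congr_fun (TensorProduct.ext' h1 : S.lact = T.lact) x)
    (fun x => DFunLike.congr_fun (TensorProduct.ext' h2 : S.ract = T.ract) x)

/-- The canonical bilinear map `M(A) × M(B) → M(A ⊙ B)`, `(S, T) ↦ S ⊗ T`. -/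
def tens : Mult A →ₗ[ℂ] Mult B →ₗ[ℂ] Mult (A ⊗[ℂ] B) :=
  LinearMap.mk₂ ℂ tensFun
    (fun S S' T => Mult.ext_tmul
      (fun a b => by simp only [lact_tensFun_tmul, Mult.lact_add, TensorProduct.add_tmul])
      (fun a b => by simp only [ract_tensFun_tmul, Mult.ract_add, TensorProduct.add_tmul]))
    (fun r S T => Mult.ext_tmul
      (fun a b => by simp only [lact_tensFun_tmul, Mult.lact_smul, TensorProduct.smul_tmul'])
      (fun a b => by simp only [ract_tensFun_tmul, Mult.ract_smul, TensorProduct.smul_tmul']))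
    (fun S T T' => Mult.ext_tmul
      (fun a b => by simp only [lact_tensFun_tmul, Mult.lact_add, TensorProduct.tmul_add])
      (fun a b => by simp only [ract_tensFun_tmul, Mult.ract_add, TensorProduct.tmul_add]))
    (fun r S T => Mult.ext_tmul
      (fun a b => by simp only [lact_tensFun_tmul, Mult.lact_smul, TensorProduct.tmul_smul])
      (fun a b => by simp only [ract_tensFun_tmul, Mult.ract_smul, TensorProduct.tmul_smul]))

@[simp] theorem lact_tens_tmul (S : Mult A) (T : Mult B) (a : A) (b : B) :
    (tens S T).lact (a ⊗ₜ b) = S.lact a ⊗ₜ T.lact b := rfl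
@[simp] theorem ract_tens_tmul (S : Mult A) (T : Mult B) (a : A) (b : B) :
    (tens S T).ract (a ⊗ₜ b) = S.ract a ⊗ₜ T.ract b := rfl

theorem tens_mul_tens (S S' : Mult A) (T T' : Mult B) :
    tens S T * tens S' T' = tens (S * S') (T * T') :=
  Mult.ext_tmul (fun a b => by simp) (fun a b => by simp)

theorem tens_emb_emb (a : A) (b : B) : tens (emb A a) (emb B b) = emb (A ⊗[ℂ] B) (a ⊗ₜ b) :=
  Mult.ext_tmul (fun a b => by simp) (fun a b => by simp)

/-- A linear map `π : A → M(B)` is non-degenerate if the spaces `π(A) B` and `B π(A)` equal `B`. -/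
def NondegHom (π : A →ₗ[ℂ] Mult B) : Prop :=
  Submodule.span ℂ {z | ∃ a b, z = (π a).lact b} = ⊤ ∧
    Submodule.span ℂ {z | ∃ a b, z = (π a).ract b} = ⊤

/-- `T ∈ M(B)` is the image of `m ∈ M(A)` under the extension of `π : A → M(B)` to `M(A)`. -/
def IsExtensionAt (π : A →ₗ[ℂ] Mult B) (m : Mult A) (T : Mult B) : Prop :=
  ∀ a, T * π a = π (m.lact a) ∧ π a * T = π (m.ract a)

open Classical in
/-- The extension of a non-degenerate homomorphism `π : A → M(B)` to `M(A)`. -/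
def extend (π : A →ₗ[ℂ] Mult B) (m : Mult A) : Mult B :=
  if h : ∃ T, IsExtensionAt π m T then h.choose else 0

theorem IsExtensionAt.unique {π : A →ₗ[ℂ] Mult B} (hπ : NondegHom π) {m : Mult A}
    {S T : Mult B} (hS : IsExtensionAt π m S) (hT : IsExtensionAt π m T) : S = T := by
  refine Mult.ext' (fun b => ?_) (fun b => ?_)
  · have hb : b ∈ Submodule.span ℂ {z | ∃ a b, z = (π a).lact b} := hπ.1 ▸ Submodule.mem_top
    refine LinearMap.eqOn_span (f := S.lact) (g := T.lact) ?_ hb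
    rintro _ ⟨a, b, rfl⟩
    rw [← Mult.lact_mul, ← Mult.lact_mul, (hS a).1, (hT a).1]
  · have hb : b ∈ Submodule.span ℂ {z | ∃ a b, z = (π a).ract b} := hπ.2 ▸ Submodule.mem_top
    refine LinearMap.eqOn_span (f := S.ract) (g := T.ract) ?_ hb
    rintro _ ⟨a, b, rfl⟩
    rw [← Mult.ract_mul, ← Mult.ract_mul, (hS a).2, (hT a).2]

/-- Descent of a linear map along a surjective linear map. -/
theorem exists_descend {U V W : Type*} [AddCommGroup U] [Module ℂ U] [AddCommGroup V] [Module ℂ V]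
    [AddCommGroup W] [Module ℂ W] (f : U →ₗ[ℂ] V) (g : U →ₗ[ℂ] W) (hf : Function.Surjective f)
    (hfg : ∀ u, f u = 0 → g u = 0) : ∃ k : V →ₗ[ℂ] W, ∀ u, k (f u) = g u := by
  obtain ⟨s, hs⟩ := f.exists_rightInverse_of_surjective (LinearMap.range_eq_top.2 hf)
  refine ⟨g ∘ₗ s, fun u => ?_⟩
  have : f (s (f u) - u) = 0 := by
    rw [map_sub, ← LinearMap.comp_apply, hs]; simp
  have := hfg _ this
  rw [map_sub, sub_eq_zero] at this
  simpa using this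

theorem exists_isExtensionAt {π : A →ₙₐ[ℂ] Mult B} (hB : NondegAlg B)
    (hπ : NondegHom (π : A →ₗ[ℂ] Mult B)) (m : Mult A) :
    ∃ T, IsExtensionAt (π : A →ₗ[ℂ] Mult B) m T := by
  -- `l (a ⊗ b) = π(a) b`, `r (a ⊗ b) = b π(a)`
  let l : A ⊗[ℂ] B →ₗ[ℂ] B := TensorProduct.lift
    (LinearMap.mk₂ ℂ (fun a b => (π a).lact b) (by simp) (by simp) (by simp) (by simp))
  let r : A ⊗[ℂ] B →ₗ[ℂ] B := TensorProduct.lift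
    (LinearMap.mk₂ ℂ (fun a b => (π a).ract b) (by simp) (by simp) (by simp) (by simp))
  have hl : ∀ a b, l (a ⊗ₜ b) = (π a).lact b := fun a b => rfl
  have hr : ∀ a b, r (a ⊗ₜ b) = (π a).ract b := fun a b => rfl
  have ls : Function.Surjective l := by
    rw [← LinearMap.range_eq_top, eq_top_iff, ← hπ.1, Submodule.span_le]
    rintro _ ⟨a, b, rfl⟩
    exact ⟨a ⊗ₜ b, rfl⟩
  have rs : Function.Surjective r := by
    rw [← LinearMap.range_eq_top, eq_top_iff, ← hπ.2, Submodule.span_le]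
    rintro _ ⟨a, b, rfl⟩
    exact ⟨a ⊗ₜ b, rfl⟩
  have lm : ∀ c u, (π c).lact (l (m.lact.rTensor B u)) = (π (m.ract c)).lact (l u) := by
    intro c u
    induction u with
    | zero => simp
    | add x y hx hy => simp only [map_add, hx, hy]
    | tmul a b =>
      simp only [LinearMap.rTensor_tmul, hl, ← Mult.lact_mul, ← map_mul, Mult.compat]
  have rm : ∀ c u, (π c).ract (r (m.ract.rTensor B u)) = (π (m.lact c)).ract (r u) := by
    intro c u
    induction u with
    | zero => simp
    | add x y hx hy => simp only [map_add, hx, hy]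
    | tmul a b =>
      simp only [LinearMap.rTensor_tmul, hr, ← Mult.ract_mul, ← map_mul, Mult.compat]
  have zl : ∀ b, (∀ c, (π c).lact b = 0) → b = 0 := by
    intro b hb
    refine (hB b).2 fun x => ?_
    obtain ⟨u, rfl⟩ := rs x
    induction u with
    | zero => simp
    | add x y hx hy => simp only [map_add, add_mul, hx, hy, add_zero]
    | tmul a b' => rw [hr, Mult.compat, hb, mul_zero]
  have zr : ∀ b, (∀ c, (π c).ract b = 0) → b = 0 := by
    intro b hb
    refine (hB b).1 fun x => ?_
    obtain ⟨u, rfl⟩ := ls x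
    induction u with
    | zero => simp
    | add x y hx hy => simp only [map_add, mul_add, hx, hy, add_zero]
    | tmul a b' => rw [hl, ← Mult.compat, hb, zero_mul]
  obtain ⟨L, hL⟩ := exists_descend l (l ∘ₗ m.lact.rTensor B) ls (fun u hu => zl _ fun c => by
    rw [LinearMap.comp_apply, lm, hu, map_zero])
  obtain ⟨R, hR⟩ := exists_descend r (r ∘ₗ m.ract.rTensor B) rs (fun u hu => zr _ fun c => by
    rw [LinearMap.comp_apply, rm, hu, map_zero])
  have hL' : ∀ a b, L ((π a).lact b) = (π (m.lact a)).lact b := fun a b => hL (a ⊗ₜ b)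
  have hR' : ∀ a b, R ((π a).ract b) = (π (m.ract a)).ract b := fun a b => hR (a ⊗ₜ b)
  have kL : ∀ c b, (π c).lact (L b) = (π (m.ract c)).lact b := by
    intro c b
    obtain ⟨u, rfl⟩ := ls b
    rw [hL, LinearMap.comp_apply, lm]
  have kR : ∀ c b, (π c).ract (R b) = (π (m.lact c)).ract b := by
    intro c b
    obtain ⟨u, rfl⟩ := rs b
    rw [hR, LinearMap.comp_apply, rm]
  have h1 : ∀ a b, L (a * b) = L a * b := by
    intro a b
    rw [← sub_eq_zero]
    refine zl _ fun c => ?_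
    rw [map_sub, kL, Mult.lact_mul', Mult.lact_mul', kL, sub_self]
  have h2 : ∀ a b, R (a * b) = a * R b := by
    intro a b
    rw [← sub_eq_zero]
    refine zr _ fun c => ?_
    rw [map_sub, kR, Mult.ract_mul', Mult.ract_mul', kR, sub_self]
  have h3 : ∀ a b, R a * b = a * L b := by
    intro a b
    obtain ⟨u, rfl⟩ := rs a
    induction u with
    | zero => simp
    | add x y hx hy => simp only [map_add, add_mul, hx, hy]
    | tmul c d => rw [hr, hR', Mult.compat, Mult.compat, kL]
  refine ⟨Mult.mk' L R h1 h2 h3, fun a => ⟨Mult.ext' (fun b => ?_) (fun b => ?_),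
    Mult.ext' (fun b => ?_) (fun b => ?_)⟩⟩
  · exact hL' a b
  · exact kR a b
  · exact kL a b
  · exact hR' a b

/-- For a non-degenerate homomorphism the extension has its defining property. -/
theorem extend_spec {π : A →ₙₐ[ℂ] Mult B} (hB : NondegAlg B)
    (hπ : NondegHom (π : A →ₗ[ℂ] Mult B)) (m : Mult A) :
    IsExtensionAt (π : A →ₗ[ℂ] Mult B) m (extend π m) := by
  have h := exists_isExtensionAt hB hπ m
  rw [extend, dif_pos h]
  exact h.choose_spec

/-- Transport of multipliers along an isomorphism of algebras. -/
def Mult.congr (e : A ≃ₗ[ℂ] B) (he : ∀ x y, e (x * y) = e x * e y) : Mult A →ₗ[ℂ] Mult B where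
  toFun T := Mult.mk' (e.conj T.lact) (e.conj T.ract)
    (fun a b => by
      obtain ⟨a, rfl⟩ := e.surjective a
      obtain ⟨b, rfl⟩ := e.surjective b
      simp [← he, LinearEquiv.conj_apply, Mult.lact_mul'])
    (fun a b => by
      obtain ⟨a, rfl⟩ := e.surjective a
      obtain ⟨b, rfl⟩ := e.surjective b
      simp [← he, LinearEquiv.conj_apply, Mult.ract_mul'])
    (fun a b => by
      obtain ⟨a, rfl⟩ := e.surjective a
      obtain ⟨b, rfl⟩ := e.surjective b
      simp [← he, LinearEquiv.conj_apply, Mult.compat])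
  map_add' S T := Mult.ext' (fun x => by simp [LinearEquiv.conj_apply])
    (fun x => by simp [LinearEquiv.conj_apply])
  map_smul' r T := Mult.ext' (fun x => by simp [LinearEquiv.conj_apply])
    (fun x => by simp [LinearEquiv.conj_apply])

variable {C E : Type*}
  [NonUnitalRing C] [Module ℂ C] [IsScalarTower ℂ C C] [SMulCommClass ℂ C C]
  [NonUnitalRing E] [Module ℂ E] [IsScalarTower ℂ E E] [SMulCommClass ℂ E E]

/-- The underlying linear map of `tensHom`. -/
def tensLin (π₁ : A →ₗ[ℂ] Mult C) (π₂ : B →ₗ[ℂ] Mult E) :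
    A ⊗[ℂ] B →ₗ[ℂ] Mult (C ⊗[ℂ] E) :=
  TensorProduct.lift (tens.compl₁₂ π₁ π₂)

@[simp] theorem tensLin_tmul (π₁ : A →ₗ[ℂ] Mult C) (π₂ : B →ₗ[ℂ] Mult E) (a : A) (b : B) :
    tensLin π₁ π₂ (a ⊗ₜ b) = tens (π₁ a) (π₂ b) := rfl

/-- The tensor product `π₁ ⊙ π₂ : A ⊙ B → M(C ⊙ E)` of homomorphisms. -/
def tensHom (π₁ : A →ₙₐ[ℂ] Mult C) (π₂ : B →ₙₐ[ℂ] Mult E) :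
    A ⊗[ℂ] B →ₙₐ[ℂ] Mult (C ⊗[ℂ] E) where
  toFun := tensLin (π₁ : A →ₗ[ℂ] Mult C) (π₂ : B →ₗ[ℂ] Mult E)
  map_smul' := map_smul _
  map_zero' := map_zero _
  map_add' := map_add _
  map_mul' x y := by
    induction x with
    | zero => simp
    | add x₁ x₂ h₁ h₂ => rw [add_mul, map_add, map_add, add_mul, h₁, h₂]
    | tmul a b =>
      induction y with
      | zero => simp
      | add x₁ x₂ h₁ h₂ => rw [mul_add, map_add, map_add, mul_add, h₁, h₂]
      | tmul c d => simp [tens_mul_tens]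

@[simp] theorem tensHom_tmul (π₁ : A →ₙₐ[ℂ] Mult C) (π₂ : B →ₙₐ[ℂ] Mult E) (a : A) (b : B) :
    tensHom π₁ π₂ (a ⊗ₜ b) = tens (π₁ a) (π₂ b) := rfl

theorem assoc_mul (x y : (A ⊗[ℂ] B) ⊗[ℂ] C) :
    TensorProduct.assoc ℂ A B C (x * y) =
      TensorProduct.assoc ℂ A B C x * TensorProduct.assoc ℂ A B C y := by
  induction x with
  | zero => simp
  | add x₁ x₂ h₁ h₂ => rw [add_mul, map_add, map_add, add_mul, h₁, h₂]
  | tmul a c =>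
    induction a with
    | zero => simp
    | add x₁ x₂ h₁ h₂ => rw [TensorProduct.add_tmul, add_mul, map_add, map_add, add_mul, h₁, h₂]
    | tmul a b =>
      induction y with
      | zero => simp
      | add x₁ x₂ h₁ h₂ => rw [mul_add, map_add, map_add, mul_add, h₁, h₂]
      | tmul a' c' =>
        induction a' with
        | zero => simp
        | add x₁ x₂ h₁ h₂ =>
          rw [TensorProduct.add_tmul, mul_add, map_add, map_add, mul_add, h₁, h₂]
        | tmul a' b' => simp

theorem tensorTensorTensorComm_mul (x y : (A ⊗[ℂ] B) ⊗[ℂ] (C ⊗[ℂ] E)) :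
    TensorProduct.tensorTensorTensorComm ℂ A B C E (x * y) =
      TensorProduct.tensorTensorTensorComm ℂ A B C E x *
        TensorProduct.tensorTensorTensorComm ℂ A B C E y := by
  induction x with
  | zero => simp
  | add x₁ x₂ h₁ h₂ => rw [add_mul, map_add, map_add, add_mul, h₁, h₂]
  | tmul a c =>
    induction a with
    | zero => simp
    | add x₁ x₂ h₁ h₂ => rw [TensorProduct.add_tmul, add_mul, map_add, map_add, add_mul, h₁, h₂]
    | tmul a b =>
      induction c with
      | zero => simp
      | add x₁ x₂ h₁ h₂ => rw [TensorProduct.tmul_add, add_mul, map_add, map_add, add_mul, h₁, h₂]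
      | tmul c d =>
        induction y with
        | zero => simp
        | add x₁ x₂ h₁ h₂ => rw [mul_add, map_add, map_add, mul_add, h₁, h₂]
        | tmul a' c' =>
          induction a' with
          | zero => simp
          | add x₁ x₂ h₁ h₂ =>
            rw [TensorProduct.add_tmul, mul_add, map_add, map_add, mul_add, h₁, h₂]
          | tmul a' b' =>
            induction c' with
            | zero => simp
            | add x₁ x₂ h₁ h₂ =>
              rw [TensorProduct.tmul_add, mul_add, map_add, map_add, mul_add, h₁, h₂]
            | tmul c' d' => simp

end Multipliers

section Slices

variable {A B : Type*}
  [NonUnitalRing A] [Module ℂ A] [IsScalarTower ℂ A A] [SMulCommClass ℂ A A]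
  [NonUnitalRing B] [Module ℂ B] [IsScalarTower ℂ B B] [SMulCommClass ℂ B B]

/-- The slice map `ω ⊙ ι : A ⊙ B → B`. -/
def sliceL (ω : Module.Dual ℂ A) : A ⊗[ℂ] B →ₗ[ℂ] B :=
  (TensorProduct.lid ℂ B).toLinearMap ∘ₗ LinearMap.rTensor B ω

/-- The slice map `ι ⊙ ω : A ⊙ B → A`. -/
def sliceR (ω : Module.Dual ℂ B) : A ⊗[ℂ] B →ₗ[ℂ] A :=
  (TensorProduct.rid ℂ A).toLinearMap ∘ₗ LinearMap.lTensor A ω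

@[simp] theorem sliceL_tmul (ω : Module.Dual ℂ A) (a : A) (b : B) :
    sliceL ω (a ⊗ₜ[ℂ] b) = ω a • b := rfl
@[simp] theorem sliceR_tmul (ω : Module.Dual ℂ B) (a : A) (b : B) :
    sliceR ω (a ⊗ₜ[ℂ] b) = ω b • a := rfl

theorem eq_zero_of_sliceR (t : A ⊗[ℂ] B) (h : ∀ ω : Module.Dual ℂ B, sliceR ω t = 0) : t = 0 := by
  classical
  refine (TensorProduct.equivFinsuppOfBasisRight (M := A)
    (Module.Basis.ofVectorSpace ℂ B)).injective ?_
  ext i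
  rw [TensorProduct.equivFinsuppOfBasisRight_apply, map_zero]
  exact h _

theorem sliceR_mul (ω : Module.Dual ℂ B) (t : A ⊗[ℂ] B) (a : A) :
    sliceR ω t * a = sliceR ω ((tens (emb A a) (1 : Mult B)).ract t) := by
  induction t with
  | zero => simp
  | add x y hx hy => simp only [map_add, add_mul, hx, hy]
  | tmul b c => simp [smul_mul_assoc]

theorem mul_sliceR (ω : Module.Dual ℂ B) (t : A ⊗[ℂ] B) (a : A) :
    a * sliceR ω t = sliceR ω ((tens (emb A a) (1 : Mult B)).lact t) := by
  induction t with
  | zero => simp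
  | add x y hx hy => simp only [map_add, mul_add, hx, hy]
  | tmul b c => simp [mul_smul_comm]

theorem sliceL_mul (ω : Module.Dual ℂ A) (t : A ⊗[ℂ] B) (b : B) :
    sliceL ω t * b = sliceL ω ((tens (1 : Mult A) (emb B b)).ract t) := by
  induction t with
  | zero => simp
  | add x y hx hy => simp only [map_add, add_mul, hx, hy]
  | tmul b c => simp [smul_mul_assoc]

theorem mul_sliceL (ω : Module.Dual ℂ A) (t : A ⊗[ℂ] B) (b : B) :
    b * sliceL ω t = sliceL ω ((tens (1 : Mult A) (emb B b)).lact t) := by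
  induction t with
  | zero => simp
  | add x y hx hy => simp only [map_add, mul_add, hx, hy]
  | tmul b c => simp [mul_smul_comm]

theorem NondegAlg.tensor (hA : NondegAlg A) (hB : NondegAlg B) : NondegAlg (A ⊗[ℂ] B) := by
  intro t
  constructor
  · intro ht
    have h1 : ∀ (f : Module.Dual ℂ A) a, sliceL (f ∘ₗ LinearMap.mulRight ℂ a) t = 0 := by
      intro f a
      refine (hB _).1 fun b => ?_
      have : sliceL (f ∘ₗ LinearMap.mulRight ℂ a) t * b = sliceL f (t * (a ⊗ₜ b)) := by
        clear ht
        induction t with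
        | zero => simp
        | add x y hx hy => simp only [map_add, add_mul, hx, hy]
        | tmul b c => simp [smul_mul_assoc]
      rw [this, ht, map_zero]
    refine eq_zero_of_sliceR t fun k => (hA _).1 fun a => ?_
    rw [← Module.forall_dual_apply_eq_zero_iff ℂ]
    intro f
    have : f (sliceR k t * a) = k (sliceL (f ∘ₗ LinearMap.mulRight ℂ a) t) := by
      clear ht h1
      induction t with
      | zero => simp
      | add x y hx hy => simp only [map_add, add_mul, hx, hy]
      | tmul b c => simp [smul_mul_assoc, mul_comm]
    rw [this, h1, map_zero]
  · intro ht
    have h1 : ∀ (f : Module.Dual ℂ A) a, sliceL (f ∘ₗ LinearMap.mulLeft ℂ a) t = 0 := by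
      intro f a
      refine (hB _).2 fun b => ?_
      have : b * sliceL (f ∘ₗ LinearMap.mulLeft ℂ a) t = sliceL f ((a ⊗ₜ b) * t) := by
        clear ht
        induction t with
        | zero => simp
        | add x y hx hy => simp only [map_add, mul_add, hx, hy]
        | tmul b c => simp [mul_smul_comm]
      rw [this, ht, map_zero]
    refine eq_zero_of_sliceR t fun k => (hA _).2 fun a => ?_
    rw [← Module.forall_dual_apply_eq_zero_iff ℂ]
    intro f
    have : f (a * sliceR k t) = k (sliceL (f ∘ₗ LinearMap.mulLeft ℂ a) t) := by
      clear ht h1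
      induction t with
      | zero => simp
      | add x y hx hy => simp only [map_add, mul_add, hx, hy]
      | tmul b c => simp [mul_smul_comm, mul_comm]
    rw [this, h1, map_zero]

/-- `T₁(a ⊗ b) = Δ(a)(b ⊗ 1)`. -/
def T₁ (Δ : A →ₗ[ℂ] Mult (A ⊗[ℂ] A)) : A ⊗[ℂ] A →ₗ[ℂ] Mult (A ⊗[ℂ] A) :=
  TensorProduct.lift ((LinearMap.mul ℂ (Mult (A ⊗[ℂ] A))).compl₁₂ Δ
    (tens.flip 1 ∘ₗ (emb A : A →ₗ[ℂ] Mult A)))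

/-- `T₂(a ⊗ b) = Δ(a)(1 ⊗ b)`. -/
def T₂ (Δ : A →ₗ[ℂ] Mult (A ⊗[ℂ] A)) : A ⊗[ℂ] A →ₗ[ℂ] Mult (A ⊗[ℂ] A) :=
  TensorProduct.lift ((LinearMap.mul ℂ (Mult (A ⊗[ℂ] A))).compl₁₂ Δ
    (tens 1 ∘ₗ (emb A : A →ₗ[ℂ] Mult A)))

/-- `T₃(a ⊗ b) = (b ⊗ 1)Δ(a)`. -/
def T₃ (Δ : A →ₗ[ℂ] Mult (A ⊗[ℂ] A)) : A ⊗[ℂ] A →ₗ[ℂ] Mult (A ⊗[ℂ] A) :=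
  TensorProduct.lift ((LinearMap.mul ℂ (Mult (A ⊗[ℂ] A))).flip.compl₁₂ Δ
    (tens.flip 1 ∘ₗ (emb A : A →ₗ[ℂ] Mult A)))

/-- `T₄(a ⊗ b) = (1 ⊗ b)Δ(a)`. -/
def T₄ (Δ : A →ₗ[ℂ] Mult (A ⊗[ℂ] A)) : A ⊗[ℂ] A →ₗ[ℂ] Mult (A ⊗[ℂ] A) :=
  TensorProduct.lift ((LinearMap.mul ℂ (Mult (A ⊗[ℂ] A))).flip.compl₁₂ Δ
    (tens 1 ∘ₗ (emb A : A →ₗ[ℂ] Mult A)))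

theorem T₁_tmul (Δ : A →ₗ[ℂ] Mult (A ⊗[ℂ] A)) (a b : A) :
    T₁ Δ (a ⊗ₜ b) = Δ a * tens (emb A b) 1 := rfl
theorem T₂_tmul (Δ : A →ₗ[ℂ] Mult (A ⊗[ℂ] A)) (a b : A) :
    T₂ Δ (a ⊗ₜ b) = Δ a * tens 1 (emb A b) := rfl
theorem T₃_tmul (Δ : A →ₗ[ℂ] Mult (A ⊗[ℂ] A)) (a b : A) :
    T₃ Δ (a ⊗ₜ b) = tens (emb A b) 1 * Δ a := rfl
theorem T₄_tmul (Δ : A →ₗ[ℂ] Mult (A ⊗[ℂ] A)) (a b : A) :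
    T₄ Δ (a ⊗ₜ b) = tens 1 (emb A b) * Δ a := rfl

/-- `(ω ⊙ ι)Δ(a)`, as the pair of its left and right multiplication maps
`b ↦ (ω ⊙ ι)(Δ(a)(1 ⊗ b))` and `b ↦ (ω ⊙ ι)((1 ⊗ b)Δ(a))`. Meaningful when all `Δ(a)(1 ⊗ b)` and
`(1 ⊗ b)Δ(a)` belong to `A ⊙ A`. -/
def leftSlice (Δ : A →ₗ[ℂ] Mult (A ⊗[ℂ] A)) (ω : Module.Dual ℂ A) :
    A →ₗ[ℂ] Module.End ℂ A × (Module.End ℂ A)ᵐᵒᵖ :=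
  LinearMap.prod (TensorProduct.curry (sliceL ω ∘ₗ toAlg ∘ₗ T₂ Δ))
    ((MulOpposite.opLinearEquiv ℂ).toLinearMap ∘ₗ
      TensorProduct.curry (sliceL ω ∘ₗ toAlg ∘ₗ T₄ Δ))

/-- `(ι ⊙ ω)Δ(a)`, as the pair of its left and right multiplication maps
`b ↦ (ι ⊙ ω)(Δ(a)(b ⊗ 1))` and `b ↦ (ι ⊙ ω)((b ⊗ 1)Δ(a))`. Meaningful when all `Δ(a)(b ⊗ 1)` and
`(b ⊗ 1)Δ(a)` belong to `A ⊙ A`. -/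
def rightSlice (Δ : A →ₗ[ℂ] Mult (A ⊗[ℂ] A)) (ω : Module.Dual ℂ A) :
    A →ₗ[ℂ] Module.End ℂ A × (Module.End ℂ A)ᵐᵒᵖ :=
  LinearMap.prod (TensorProduct.curry (sliceR ω ∘ₗ toAlg ∘ₗ T₁ Δ))
    ((MulOpposite.opLinearEquiv ℂ).toLinearMap ∘ₗ
      TensorProduct.curry (sliceR ω ∘ₗ toAlg ∘ₗ T₃ Δ))

/-- A multiplier, given as a pair of linear maps, belongs to `A`. -/
def BelongsTo (T : Module.End ℂ A × (Module.End ℂ A)ᵐᵒᵖ) : Prop :=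
  ∃ a : A, T = Mult.pair (emb A a)

/-- `(ω ⊙ ι)Δ(a)` as an element of `A`, when it belongs to `A`. -/
def leftElt (Δ : A →ₗ[ℂ] Mult (A ⊗[ℂ] A)) (ω : Module.Dual ℂ A) : A →ₗ[ℂ] A :=
  unPair A ∘ₗ leftSlice Δ ω

/-- `(ι ⊙ ω)Δ(a)` as an element of `A`, when it belongs to `A`. -/
def rightElt (Δ : A →ₗ[ℂ] Mult (A ⊗[ℂ] A)) (ω : Module.Dual ℂ A) : A →ₗ[ℂ] A :=
  unPair A ∘ₗ rightSlice Δ ω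

/-- The functionals `θ` for which all `(θ ⊙ ι)Δ(a)` and `(ι ⊙ θ)Δ(a)` belong to `A`. -/
def smoothFunctionals (Δ : A →ₗ[ℂ] Mult (A ⊗[ℂ] A)) : Set (Module.Dual ℂ A) :=
  {θ | ∀ a, BelongsTo (leftSlice Δ θ a) ∧ BelongsTo (rightSlice Δ θ a)}

end Slices

section QuantumGroup

variable {A : Type*} [NonUnitalRing A] [Module ℂ A] [IsScalarTower ℂ A A] [SMulCommClass ℂ A A]

/-- Regular multiplier Hopf algebras `(A, Δ)`. -/
structure IsRegularMultiplierHopf (Δ : A →ₙₐ[ℂ] Mult (A ⊗[ℂ] A)) : Prop where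
  nondeg : NondegAlg A
  nondegHom : NondegHom (Δ : A →ₗ[ℂ] Mult (A ⊗[ℂ] A))
  /-- `(Δ ⊙ ι)Δ = (ι ⊙ Δ)Δ` -/
  coassoc : ∀ a, Mult.congr (TensorProduct.assoc ℂ A A A) assoc_mul
    (extend (tensHom Δ (emb A) : A ⊗[ℂ] A →ₗ[ℂ] Mult ((A ⊗[ℂ] A) ⊗[ℂ] A)) (Δ a)) =
      extend (tensHom (emb A) Δ : A ⊗[ℂ] A →ₗ[ℂ] Mult (A ⊗[ℂ] (A ⊗[ℂ] A))) (Δ a)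
  bij₁ : Set.BijOn (T₁ (Δ : A →ₗ[ℂ] Mult (A ⊗[ℂ] A))) Set.univ (Set.range (emb (A ⊗[ℂ] A)))
  bij₂ : Set.BijOn (T₂ (Δ : A →ₗ[ℂ] Mult (A ⊗[ℂ] A))) Set.univ (Set.range (emb (A ⊗[ℂ] A)))
  bij₃ : Set.BijOn (T₃ (Δ : A →ₗ[ℂ] Mult (A ⊗[ℂ] A))) Set.univ (Set.range (emb (A ⊗[ℂ] A)))
  bij₄ : Set.BijOn (T₄ (Δ : A →ₗ[ℂ] Mult (A ⊗[ℂ] A))) Set.univ (Set.range (emb (A ⊗[ℂ] A)))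

variable (A) in
/-- An algebraic quantum group on `A`, with a chosen left Haar functional. -/
structure AlgebraicQuantumGroup where
  /-- the comultiplication `Δ` -/
  comul : A →ₙₐ[ℂ] Mult (A ⊗[ℂ] A)
  regular : IsRegularMultiplierHopf comul
  /-- the left Haar functional `φ` -/
  haar : Module.Dual ℂ A
  haar_ne_zero : haar ≠ 0
  /-- `(ι ⊙ φ)Δ(a) = φ(a)1` -/
  left_invariant : ∀ a, rightSlice (comul : A →ₗ[ℂ] Mult (A ⊗[ℂ] A)) haar a = haar a • 1

namespace AlgebraicQuantumGroup

variable (G : AlgebraicQuantumGroup A)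

/-- The comultiplication as a linear map. -/
def comulₗ : A →ₗ[ℂ] Mult (A ⊗[ℂ] A) := G.comul

theorem comulₗ_mul (a b : A) : G.comulₗ (a * b) = G.comulₗ a * G.comulₗ b := map_mul G.comul a b

/-- `a ↦ φa`, where `(φa)(x) = φ(ax)`. -/
def hatMap : A →ₗ[ℂ] Module.Dual ℂ A := (LinearMap.mul ℂ A).compr₂ G.haar

@[simp] theorem hatMap_apply (a x : A) : G.hatMap a x = G.haar (a * x) := rfl

/-- The space `Â = {φa | a ∈ A}` of functionals on `A`. -/
def hat : Submodule ℂ (Module.Dual ℂ A) := LinearMap.range G.hatMap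

/-- The space `Â` as a type. -/
abbrev Hat : Type _ := ↥G.hat

theorem nondeg₂ (G : AlgebraicQuantumGroup A) : NondegAlg (A ⊗[ℂ] A) := G.regular.nondeg.tensor G.regular.nondeg

/-- The element `(a ⊗ 1)Δ(x)` of `A ⊙ A`. -/
def s₁ (a x : A) : A ⊗[ℂ] A := toAlg (T₃ G.comulₗ (x ⊗ₜ a))

/-- The element `(1 ⊗ a)Δ(x)` of `A ⊙ A`. -/
def s₂ (a x : A) : A ⊗[ℂ] A := toAlg (T₄ G.comulₗ (x ⊗ₜ a))

theorem emb_toAlg (G : AlgebraicQuantumGroup A) {T : Mult (A ⊗[ℂ] A)} (h : T ∈ Set.range (emb (A ⊗[ℂ] A))) :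
    emb (A ⊗[ℂ] A) (toAlg T) = T := by
  obtain ⟨t, rfl⟩ := h
  rw [toAlg_emb G.nondeg₂]

theorem emb_T₁ (G : AlgebraicQuantumGroup A) (u : A ⊗[ℂ] A) :
    emb (A ⊗[ℂ] A) (toAlg (T₁ G.comulₗ u)) = T₁ G.comulₗ u :=
  G.emb_toAlg (G.regular.bij₁.mapsTo (Set.mem_univ _))

theorem emb_T₂ (G : AlgebraicQuantumGroup A) (u : A ⊗[ℂ] A) :
    emb (A ⊗[ℂ] A) (toAlg (T₂ G.comulₗ u)) = T₂ G.comulₗ u :=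
  G.emb_toAlg (G.regular.bij₂.mapsTo (Set.mem_univ _))

theorem emb_T₃ (G : AlgebraicQuantumGroup A) (u : A ⊗[ℂ] A) :
    emb (A ⊗[ℂ] A) (toAlg (T₃ G.comulₗ u)) = T₃ G.comulₗ u :=
  G.emb_toAlg (G.regular.bij₃.mapsTo (Set.mem_univ _))

theorem emb_T₄ (G : AlgebraicQuantumGroup A) (u : A ⊗[ℂ] A) :
    emb (A ⊗[ℂ] A) (toAlg (T₄ G.comulₗ u)) = T₄ G.comulₗ u :=
  G.emb_toAlg (G.regular.bij₄.mapsTo (Set.mem_univ _))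

theorem emb_s₁ (a x : A) : emb (A ⊗[ℂ] A) (G.s₁ a x) = tens (emb A a) 1 * G.comulₗ x :=
  G.emb_toAlg (G.regular.bij₃.mapsTo (Set.mem_univ _))

theorem emb_s₂ (a x : A) : emb (A ⊗[ℂ] A) (G.s₂ a x) = tens 1 (emb A a) * G.comulₗ x :=
  G.emb_toAlg (G.regular.bij₄.mapsTo (Set.mem_univ _))

theorem sliceR_hatMap (a : A) (t : A ⊗[ℂ] A) :
    sliceR (G.hatMap a) t = sliceR G.haar ((tens (1 : Mult A) (emb A a)).lact t) := by
  induction t with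
  | zero => simp
  | add x y hx hy => simp only [map_add, hx, hy]
  | tmul b c => simp

theorem sliceL_hatMap (a : A) (t : A ⊗[ℂ] A) :
    sliceL (G.hatMap a) t = sliceL G.haar ((tens (emb A a) (1 : Mult A)).lact t) := by
  induction t with
  | zero => simp
  | add x y hx hy => simp only [map_add, hx, hy]
  | tmul b c => simp

theorem tens_comm (a b : A) : tens (1 : Mult A) (emb A a) * tens (emb A b) (1 : Mult A) =
    tens (emb A b) (1 : Mult A) * tens (1 : Mult A) (emb A a) := by
  simp [tens_mul_tens]

theorem rightSlice_hatMap (a x : A) :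
    rightSlice G.comulₗ (G.hatMap a) x = Mult.pair (emb A (sliceR G.haar (G.s₂ a x))) := by
  refine Prod.ext ?_ ?_
  · refine LinearMap.ext fun b => ?_
    change sliceR (G.hatMap a) (toAlg (T₁ G.comulₗ (x ⊗ₜ b))) = sliceR G.haar (G.s₂ a x) * b
    rw [sliceR_hatMap, sliceR_mul]
    congr 1
    apply emb_injective G.nondeg₂
    rw [← mul_emb, ← emb_mul, emb_s₂, G.emb_T₁,
      T₁_tmul, mul_assoc]
  · refine MulOpposite.unop_injective (LinearMap.ext fun b => ?_)
    change sliceR (G.hatMap a) (toAlg (T₃ G.comulₗ (x ⊗ₜ b))) = b * sliceR G.haar (G.s₂ a x)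
    rw [sliceR_hatMap, mul_sliceR]
    congr 1
    apply emb_injective G.nondeg₂
    rw [← mul_emb, ← mul_emb, emb_s₂, G.emb_T₃,
      T₃_tmul, ← mul_assoc, ← mul_assoc, tens_comm]

theorem leftSlice_hatMap (a x : A) :
    leftSlice G.comulₗ (G.hatMap a) x = Mult.pair (emb A (sliceL G.haar (G.s₁ a x))) := by
  refine Prod.ext ?_ ?_
  · refine LinearMap.ext fun b => ?_
    change sliceL (G.hatMap a) (toAlg (T₂ G.comulₗ (x ⊗ₜ b))) = sliceL G.haar (G.s₁ a x) * b
    rw [sliceL_hatMap, sliceL_mul]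
    congr 1
    apply emb_injective G.nondeg₂
    rw [← mul_emb, ← emb_mul, emb_s₁, G.emb_T₂,
      T₂_tmul, mul_assoc]
  · refine MulOpposite.unop_injective (LinearMap.ext fun b => ?_)
    change sliceL (G.hatMap a) (toAlg (T₄ G.comulₗ (x ⊗ₜ b))) = b * sliceL G.haar (G.s₁ a x)
    rw [sliceL_hatMap, mul_sliceL]
    congr 1
    apply emb_injective G.nondeg₂
    rw [← mul_emb, ← mul_emb, emb_s₁, G.emb_T₄,
      T₄_tmul, ← mul_assoc, ← mul_assoc, tens_comm]

theorem rightElt_hatMap (a x : A) :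
    rightElt G.comulₗ (G.hatMap a) x = sliceR G.haar (G.s₂ a x) := by
  rw [rightElt, LinearMap.comp_apply, rightSlice_hatMap, unPair_emb G.regular.nondeg]

theorem leftElt_hatMap (a x : A) :
    leftElt G.comulₗ (G.hatMap a) x = sliceL G.haar (G.s₁ a x) := by
  rw [leftElt, LinearMap.comp_apply, leftSlice_hatMap, unPair_emb G.regular.nondeg]

/-- The functional `φ ⊙ φ` on `A ⊙ A`. -/
def haar₂ : Module.Dual ℂ (A ⊗[ℂ] A) := G.haar ∘ₗ sliceR G.haar

theorem haar₂_eq (t : A ⊗[ℂ] A) : G.haar₂ t = G.haar (sliceL G.haar t) := by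
  induction t with
  | zero => simp
  | add x y hx hy => simp only [map_add, hx, hy]
  | tmul b c => simp [haar₂, mul_comm]

theorem hatMap_rightElt (a b x : A) : G.hatMap a (rightElt G.comulₗ (G.hatMap b) x) =
    G.haar₂ ((G.comulₗ x).ract (a ⊗ₜ b)) := by
  rw [rightElt_hatMap, hatMap_apply, mul_sliceR, haar₂, LinearMap.comp_apply]
  congr 2
  apply emb_injective G.nondeg₂
  rw [← mul_emb, ← emb_mul, emb_s₂, ← tens_emb_emb, ← mul_assoc, tens_mul_tens, mul_one, one_mul]

theorem hatMap_leftElt (a b x : A) : G.hatMap b (leftElt G.comulₗ (G.hatMap a) x) =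
    G.haar₂ ((G.comulₗ x).ract (a ⊗ₜ b)) := by
  rw [leftElt_hatMap, hatMap_apply, mul_sliceL, haar₂_eq]
  congr 2
  apply emb_injective G.nondeg₂
  rw [← mul_emb, ← emb_mul, emb_s₁, ← tens_emb_emb, ← mul_assoc, tens_mul_tens, mul_one, one_mul]

theorem sliceR_haar_s₁ (a x : A) : sliceR G.haar (G.s₁ a x) = G.haar x • a := by
  have h := congrArg (fun T => (MulOpposite.unop T.2) a) (G.left_invariant x)
  exact h

theorem exists_hatMap (t : A ⊗[ℂ] A) :
    ∃ c, ∀ x, G.haar₂ ((G.comulₗ x).ract t) = G.haar (c * x) := by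
  obtain ⟨u, -, hu⟩ := G.regular.bij₃.surjOn (Set.mem_range_self t)
  have ht : t = toAlg (T₃ G.comulₗ u) := by
    change T₃ G.comulₗ u = _ at hu
    rw [hu, toAlg_emb G.nondeg₂]
  subst ht
  clear hu
  induction u with
  | zero => exact ⟨0, by simp⟩
  | add u v hu hv =>
    obtain ⟨c, hc⟩ := hu
    obtain ⟨d, hd⟩ := hv
    exact ⟨c + d, fun x => by simp only [map_add, add_mul, hc, hd]⟩
  | tmul p q =>
    refine ⟨G.haar q • p, fun x => ?_⟩
    have : (G.comulₗ x).ract (toAlg (T₃ G.comulₗ (p ⊗ₜ q))) = G.s₁ q (p * x) := by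
      apply emb_injective G.nondeg₂
      rw [← emb_mul, emb_s₁, comulₗ_mul, ← mul_assoc]
      congr 1
      exact G.emb_s₁ q p
    rw [this, haar₂, LinearMap.comp_apply, sliceR_haar_s₁]
    simp [smul_mul_assoc, mul_comm]

theorem comp_rightElt_mem {ω₁ ω₂ : Module.Dual ℂ A} (h₁ : ω₁ ∈ G.hat) (h₂ : ω₂ ∈ G.hat) :
    ω₁ ∘ₗ rightElt G.comulₗ ω₂ ∈ G.hat := by
  obtain ⟨a, rfl⟩ := h₁
  obtain ⟨b, rfl⟩ := h₂
  obtain ⟨c, hc⟩ := G.exists_hatMap (a ⊗ₜ b)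
  refine ⟨c, LinearMap.ext fun x => ?_⟩
  rw [LinearMap.comp_apply, hatMap_rightElt, hc, hatMap_apply]

/-- The product on `Â`: `(ω₁ω₂)(a) = ω₁((ι ⊙ ω₂)Δ(a))`. -/
def hatMul (ω₁ ω₂ : G.Hat) : G.Hat :=
  ⟨ω₁.1 ∘ₗ rightElt G.comulₗ ω₂.1, G.comp_rightElt_mem ω₁.2 ω₂.2⟩

theorem hatMul_apply (ω₁ ω₂ : G.Hat) (a : A) :
    (G.hatMul ω₁ ω₂).1 a = ω₁.1 (rightElt G.comulₗ ω₂.1 a) := rfl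

/-- `(ω₁ω₂)(a) = ω₂((ω₁ ⊙ ι)Δ(a))`. -/
theorem hatMul_apply' (ω₁ ω₂ : G.Hat) (a : A) :
    (G.hatMul ω₁ ω₂).1 a = ω₂.1 (leftElt G.comulₗ ω₁.1 a) := by
  obtain ⟨_, b, rfl⟩ := ω₁
  obtain ⟨_, c, rfl⟩ := ω₂
  rw [hatMul_apply, hatMap_rightElt, hatMap_leftElt]

theorem hatMul_add (ω ω₁ ω₂ : G.Hat) :
    G.hatMul ω (ω₁ + ω₂) = G.hatMul ω ω₁ + G.hatMul ω ω₂ :=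
  Subtype.ext (LinearMap.ext fun x => by
    simp only [hatMul_apply', Submodule.coe_add, LinearMap.add_apply])

theorem hatMul_smul (r : ℂ) (ω₁ ω₂ : G.Hat) :
    G.hatMul ω₁ (r • ω₂) = r • G.hatMul ω₁ ω₂ :=
  Subtype.ext (LinearMap.ext fun x => by
    simp only [hatMul_apply', Submodule.coe_smul, LinearMap.smul_apply])

/-- `A = A²` -/
theorem span_mul (G : AlgebraicQuantumGroup A) : Submodule.span ℂ {z : A | ∃ a b, z = a * b} = ⊤ := by
  rw [eq_top_iff]
  intro x _
  obtain ⟨d, hd⟩ : ∃ d, G.haar d ≠ 0 := by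
    by_contra! h
    exact G.haar_ne_zero (LinearMap.ext h)
  have key : (⊤ : Submodule ℂ (A ⊗[ℂ] A)) ≤
      (Submodule.span ℂ {z : A | ∃ a b, z = a * b}).comap (sliceL G.haar) := by
    rw [← G.regular.nondegHom.1, Submodule.span_le]
    rintro _ ⟨a, t, rfl⟩
    change sliceL G.haar ((G.comulₗ a).lact t) ∈ Submodule.span ℂ {z : A | ∃ a b, z = a * b}
    induction t with
    | zero => simp
    | add u v hu hv => rw [map_add, map_add]; exact Submodule.add_mem _ hu hv
    | tmul b c =>
      have : (G.comulₗ a).lact (b ⊗ₜ c) =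
          (tens 1 (emb A c)).ract (toAlg (T₁ G.comulₗ (a ⊗ₜ b))) := by
        apply emb_injective G.nondeg₂
        rw [← mul_emb, ← emb_mul, ← tens_emb_emb,
          G.emb_T₁, T₁_tmul, mul_assoc,
          tens_mul_tens, mul_one, one_mul]
      rw [this, ← sliceL_mul]
      exact Submodule.subset_span ⟨_, _, rfl⟩
  have := key (Submodule.mem_top (x := d ⊗ₜ[ℂ] x))
  rw [Submodule.mem_comap, sliceL_tmul] at this
  exact (Submodule.smul_mem_iff _ hd).1 this

theorem nondegHom_emb (G : AlgebraicQuantumGroup A) : NondegHom (emb A : A →ₗ[ℂ] Mult A) := by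
  constructor
  · rw [← G.span_mul]; rfl
  · rw [← G.span_mul]
    congr 1
    ext z
    exact ⟨fun ⟨a, b, h⟩ => ⟨b, a, h⟩, fun ⟨a, b, h⟩ => ⟨b, a, h⟩⟩

end AlgebraicQuantumGroup

end QuantumGroup

section TensorNondeg

variable {A B C E : Type*}
  [NonUnitalRing A] [Module ℂ A] [IsScalarTower ℂ A A] [SMulCommClass ℂ A A]
  [NonUnitalRing B] [Module ℂ B] [IsScalarTower ℂ B B] [SMulCommClass ℂ B B]
  [NonUnitalRing C] [Module ℂ C] [IsScalarTower ℂ C C] [SMulCommClass ℂ C C]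
  [NonUnitalRing E] [Module ℂ E] [IsScalarTower ℂ E E] [SMulCommClass ℂ E E]

theorem span_tensor {S : Set C} {T : Set E} (hS : Submodule.span ℂ S = ⊤)
    (hT : Submodule.span ℂ T = ⊤) (P : Submodule ℂ (C ⊗[ℂ] E))
    (h : ∀ s ∈ S, ∀ t ∈ T, s ⊗ₜ t ∈ P) : P = ⊤ := by
  rw [eq_top_iff]
  intro z _
  induction z with
  | zero => exact P.zero_mem
  | add x y hx hy => exact P.add_mem (hx trivial) (hy trivial)
  | tmul c e =>
    have h1 : ∀ t ∈ T, c ⊗ₜ t ∈ P := by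
      intro t ht
      have : Submodule.span ℂ S ≤ P.comap ((TensorProduct.mk ℂ C E).flip t) :=
        Submodule.span_le.2 fun s hs => h s hs t ht
      exact this (hS ▸ Submodule.mem_top : c ∈ Submodule.span ℂ S)
    have : Submodule.span ℂ T ≤ P.comap (TensorProduct.mk ℂ C E c) :=
      Submodule.span_le.2 fun t ht => h1 t ht
    exact this (hT ▸ Submodule.mem_top : e ∈ Submodule.span ℂ T)

theorem NondegHom.tensor {π₁ : A →ₙₐ[ℂ] Mult C} {π₂ : B →ₙₐ[ℂ] Mult E}
    (h₁ : NondegHom (π₁ : A →ₗ[ℂ] Mult C)) (h₂ : NondegHom (π₂ : B →ₗ[ℂ] Mult E)) :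
    NondegHom (tensHom π₁ π₂ : A ⊗[ℂ] B →ₗ[ℂ] Mult (C ⊗[ℂ] E)) := by
  constructor
  · refine span_tensor h₁.1 h₂.1 _ ?_
    rintro _ ⟨a, c, rfl⟩ _ ⟨b, e, rfl⟩
    exact Submodule.subset_span ⟨a ⊗ₜ b, c ⊗ₜ e, rfl⟩
  · refine span_tensor h₁.2 h₂.2 _ ?_
    rintro _ ⟨a, c, rfl⟩ _ ⟨b, e, rfl⟩
    exact Submodule.subset_span ⟨a ⊗ₜ b, c ⊗ₜ e, rfl⟩

end TensorNondeg

section DualAlgebra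

variable {A : Type*} [NonUnitalRing A] [Module ℂ A] [IsScalarTower ℂ A A] [SMulCommClass ℂ A A]

namespace AlgebraicQuantumGroup

variable (G : AlgebraicQuantumGroup A)

theorem ract_tmul_eq_s₂ (p x a : A) :
    (G.comulₗ x).ract (p ⊗ₜ a) = (tens (emb A p) 1).lact (G.s₂ a x) := by
  apply emb_injective G.nondeg₂
  rw [← mul_emb, ← emb_mul, emb_s₂, ← tens_emb_emb, ← mul_assoc, tens_mul_tens, mul_one, one_mul]

theorem ract_tmul_eq_s₁ (a x p : A) :
    (G.comulₗ x).ract (a ⊗ₜ p) = (tens 1 (emb A p)).lact (G.s₁ a x) := by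
  apply emb_injective G.nondeg₂
  rw [← mul_emb, ← emb_mul, emb_s₁, ← tens_emb_emb, ← mul_assoc, tens_mul_tens, mul_one, one_mul]

/-- The linear map `p ↦ tΔ(p)`. -/
def ractL (t : A ⊗[ℂ] A) : A →ₗ[ℂ] A ⊗[ℂ] A where
  toFun p := (G.comulₗ p).ract t
  map_add' p q := by simp
  map_smul' r p := by simp

/-- `(Δ ⊙ ι)Δ(x)` -/
def X (x : A) : Mult ((A ⊗[ℂ] A) ⊗[ℂ] A) :=
  extend (tensHom G.comul (emb A) : A ⊗[ℂ] A →ₗ[ℂ] Mult ((A ⊗[ℂ] A) ⊗[ℂ] A)) (G.comul x)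

/-- `(ι ⊙ Δ)Δ(x)` -/
def Y (x : A) : Mult (A ⊗[ℂ] (A ⊗[ℂ] A)) :=
  extend (tensHom (emb A) G.comul : A ⊗[ℂ] A →ₗ[ℂ] Mult (A ⊗[ℂ] (A ⊗[ℂ] A))) (G.comul x)

theorem X_spec (x : A) (u : A ⊗[ℂ] A) : tensHom G.comul (emb A) u * G.X x =
    tensHom G.comul (emb A) ((G.comulₗ x).ract u) :=
  (extend_spec (G.nondeg₂.tensor G.regular.nondeg)
    (NondegHom.tensor G.regular.nondegHom G.nondegHom_emb) (G.comul x) u).2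

theorem Y_spec (x : A) (u : A ⊗[ℂ] A) : tensHom (emb A) G.comul u * G.Y x =
    tensHom (emb A) G.comul ((G.comulₗ x).ract u) :=
  (extend_spec (G.regular.nondeg.tensor G.nondeg₂)
    (NondegHom.tensor G.nondegHom_emb G.regular.nondegHom) (G.comul x) u).2

theorem assoc_X (x : A) (z : (A ⊗[ℂ] A) ⊗[ℂ] A) :
    TensorProduct.assoc ℂ A A A ((G.X x).ract z) =
      (G.Y x).ract (TensorProduct.assoc ℂ A A A z) := by
  have h := congrArg (fun T => Mult.ract T (TensorProduct.assoc ℂ A A A z)) (G.regular.coassoc x)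
  simpa [Mult.congr, LinearEquiv.conj_apply, X, Y] using h

theorem tensHom_lact_left (p : A) (s : A ⊗[ℂ] A) :
    tensHom G.comul (emb A) ((tens (emb A p) 1).lact s) =
      tens (G.comulₗ p) 1 * tensHom G.comul (emb A) s := by
  induction s with
  | zero => simp
  | add u v hu hv => rw [map_add, map_add, map_add, mul_add, hu, hv]
  | tmul a b =>
    rw [lact_tens_tmul, tensHom_tmul, tensHom_tmul, tens_mul_tens, lact_emb, map_mul, one_mul,
      Mult.lact_one]
    rfl

theorem tensHom_lact_right (p : A) (s : A ⊗[ℂ] A) :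
    tensHom (emb A) G.comul ((tens 1 (emb A p)).lact s) =
      tens 1 (G.comulₗ p) * tensHom (emb A) G.comul s := by
  induction s with
  | zero => simp
  | add u v hu hv => rw [map_add, map_add, map_add, mul_add, hu, hv]
  | tmul a b =>
    rw [lact_tens_tmul, tensHom_tmul, tensHom_tmul, tens_mul_tens, lact_emb, map_mul, one_mul,
      Mult.lact_one]
    rfl

theorem tens_emb_mul_left (t s : A ⊗[ℂ] A) :
    tens (emb (A ⊗[ℂ] A) t) 1 * tensHom G.comul (emb A) s =
      emb ((A ⊗[ℂ] A) ⊗[ℂ] A) ((G.ractL t).rTensor A s) := by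
  induction s with
  | zero => simp
  | add u v hu hv => rw [map_add, map_add, map_add, mul_add, hu, hv]
  | tmul a b =>
    rw [tensHom_tmul, tens_mul_tens, one_mul, emb_mul, tens_emb_emb]
    rfl

theorem tens_emb_mul_right (t s : A ⊗[ℂ] A) :
    tens 1 (emb (A ⊗[ℂ] A) t) * tensHom (emb A) G.comul s =
      emb (A ⊗[ℂ] (A ⊗[ℂ] A)) ((G.ractL t).lTensor A s) := by
  induction s with
  | zero => simp
  | add u v hu hv => rw [map_add, map_add, map_add, mul_add, hu, hv]
  | tmul a b =>
    rw [tensHom_tmul, tens_mul_tens, one_mul, emb_mul, tens_emb_emb]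
    rfl

theorem emb_X (x a : A) (t : A ⊗[ℂ] A) : emb ((A ⊗[ℂ] A) ⊗[ℂ] A) ((G.X x).ract (t ⊗ₜ a)) =
    tens (emb (A ⊗[ℂ] A) t) 1 * tensHom G.comul (emb A) (G.s₂ a x) := by
  have ht : t ∈ Submodule.span ℂ {z | ∃ a b, z = (G.comulₗ a).ract b} :=
    G.regular.nondegHom.2 ▸ Submodule.mem_top
  induction ht using Submodule.span_induction with
  | zero => simp
  | add u v _ _ hu hv => simp only [TensorProduct.add_tmul, map_add, LinearMap.add_apply, add_mul,
      hu, hv]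
  | smul r u _ hu => rw [← TensorProduct.smul_tmul', map_smul, map_smul, map_smul, hu, map_smul,
      LinearMap.smul_apply, smul_mul_assoc]
  | mem z hz =>
    obtain ⟨p, c, rfl⟩ := hz
    have e1 : emb ((A ⊗[ℂ] A) ⊗[ℂ] A) ((G.comulₗ p).ract c ⊗ₜ a) =
        tens (emb (A ⊗[ℂ] A) c) 1 * tensHom G.comul (emb A) (p ⊗ₜ a) := by
      rw [tensHom_tmul, tens_mul_tens, one_mul, ← tens_emb_emb, ← emb_mul]
      rfl
    rw [← emb_mul, e1, mul_assoc, X_spec, ract_tmul_eq_s₂, tensHom_lact_left, ← mul_assoc,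
      tens_mul_tens, one_mul, ← emb_mul]

theorem emb_Y (x a : A) (t : A ⊗[ℂ] A) : emb (A ⊗[ℂ] (A ⊗[ℂ] A)) ((G.Y x).ract (a ⊗ₜ t)) =
    tens 1 (emb (A ⊗[ℂ] A) t) * tensHom (emb A) G.comul (G.s₁ a x) := by
  have ht : t ∈ Submodule.span ℂ {z | ∃ a b, z = (G.comulₗ a).ract b} :=
    G.regular.nondegHom.2 ▸ Submodule.mem_top
  induction ht using Submodule.span_induction with
  | zero => simp
  | add u v _ _ hu hv => simp only [TensorProduct.tmul_add, map_add, add_mul, hu, hv]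
  | smul r u _ hu => rw [TensorProduct.tmul_smul, map_smul, map_smul, map_smul, hu, map_smul,
      smul_mul_assoc]
  | mem z hz =>
    obtain ⟨p, c, rfl⟩ := hz
    have e1 : emb (A ⊗[ℂ] (A ⊗[ℂ] A)) (a ⊗ₜ (G.comulₗ p).ract c) =
        tens 1 (emb (A ⊗[ℂ] A) c) * tensHom (emb A) G.comul (a ⊗ₜ p) := by
      rw [tensHom_tmul, tens_mul_tens, one_mul, ← tens_emb_emb, ← emb_mul]
      rfl
    rw [← emb_mul, e1, mul_assoc, Y_spec, ract_tmul_eq_s₁, tensHom_lact_right, ← mul_assoc,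
      tens_mul_tens, one_mul, ← emb_mul]

theorem X_ract (x a : A) (t : A ⊗[ℂ] A) :
    (G.X x).ract (t ⊗ₜ a) = (G.ractL t).rTensor A (G.s₂ a x) :=
  emb_injective (G.nondeg₂.tensor G.regular.nondeg) (by rw [emb_X, tens_emb_mul_left])

theorem Y_ract (x a : A) (t : A ⊗[ℂ] A) :
    (G.Y x).ract (a ⊗ₜ t) = (G.ractL t).lTensor A (G.s₁ a x) :=
  emb_injective (G.regular.nondeg.tensor G.nondeg₂) (by rw [emb_Y, tens_emb_mul_right])

theorem haar_assoc (z : (A ⊗[ℂ] A) ⊗[ℂ] A) : G.haar (sliceL G.haar₂ z) =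
    G.haar (sliceR G.haar₂ (TensorProduct.assoc ℂ A A A z)) := by
  induction z with
  | zero => simp
  | add u v hu hv => simp only [map_add, hu, hv]
  | tmul t c =>
    induction t with
    | zero => simp
    | add u v hu hv => simp only [map_add, TensorProduct.add_tmul, hu, hv]
    | tmul a b => simp [haar₂]; ring

theorem haar_rTensor (t s : A ⊗[ℂ] A) :
    G.haar (sliceL G.haar₂ ((G.ractL t).rTensor A s)) =
      G.haar₂ ((G.comulₗ (sliceR G.haar s)).ract t) := by
  change _ = G.haar₂ (G.ractL t (sliceR G.haar s))
  induction s with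
  | zero => simp
  | add u v hu hv => simp only [map_add, hu, hv]
  | tmul a b => simp [mul_comm]

theorem haar_lTensor (t s : A ⊗[ℂ] A) :
    G.haar (sliceR G.haar₂ ((G.ractL t).lTensor A s)) =
      G.haar₂ ((G.comulₗ (sliceL G.haar s)).ract t) := by
  change _ = G.haar₂ (G.ractL t (sliceL G.haar s))
  induction s with
  | zero => simp
  | add u v hu hv => simp only [map_add, hu, hv]
  | tmul a b => simp [mul_comm]

theorem hatMul_assoc (ω₁ ω₂ ω₃ : G.Hat) :
    G.hatMul (G.hatMul ω₁ ω₂) ω₃ = G.hatMul ω₁ (G.hatMul ω₂ ω₃) := by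
  apply Subtype.ext
  refine LinearMap.ext fun x => ?_
  obtain ⟨_, a, rfl⟩ := ω₁
  obtain ⟨_, b, rfl⟩ := ω₂
  obtain ⟨_, c, rfl⟩ := ω₃
  rw [hatMul_apply, hatMul_apply, hatMul_apply', hatMul_apply]
  dsimp only
  rw [hatMap_rightElt, hatMap_rightElt, rightElt_hatMap, leftElt_hatMap, ← haar_rTensor,
    ← haar_lTensor, ← X_ract, ← Y_ract, haar_assoc, assoc_X, TensorProduct.assoc_tmul]

/-- The algebra structure on `Â`. -/
instance : NonUnitalRing G.Hat where
  mul := G.hatMul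
  left_distrib := G.hatMul_add
  right_distrib ω₁ ω₂ ω₃ := Subtype.ext (LinearMap.ext fun _ => rfl)
  zero_mul ω := Subtype.ext (LinearMap.ext fun _ => rfl)
  mul_zero ω := Subtype.ext (LinearMap.ext fun x => by
    change (G.hatMul ω 0).1 x = 0
    rw [hatMul_apply']; rfl)
  mul_assoc := G.hatMul_assoc

instance : IsScalarTower ℂ G.Hat G.Hat where
  smul_assoc _ _ _ := Subtype.ext (LinearMap.ext fun _ => rfl)

instance : SMulCommClass ℂ G.Hat G.Hat where
  smul_comm r ω₁ ω₂ := (G.hatMul_smul r ω₁ ω₂).symm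

theorem Hat.mul_apply (ω₁ ω₂ : G.Hat) (a : A) :
    (ω₁ * ω₂).1 a = ω₁.1 (rightElt G.comulₗ ω₂.1 a) := rfl

theorem Hat.mul_apply' (ω₁ ω₂ : G.Hat) (a : A) :
    (ω₁ * ω₂).1 a = ω₂.1 (leftElt G.comulₗ ω₁.1 a) := G.hatMul_apply' ω₁ ω₂ a

/-- `Â` is a non-degenerate algebra. -/
theorem nondegAlg_hat : NondegAlg G.Hat := by
  obtain ⟨d, hd⟩ : ∃ d, G.haar d ≠ 0 := by
    by_contra! h
    exact G.haar_ne_zero (LinearMap.ext h)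
  intro ω
  constructor
  · intro h
    have h0 : ω.1 ∘ₗ sliceR G.haar ∘ₗ toAlg ∘ₗ T₄ G.comulₗ = 0 := by
      refine TensorProduct.ext' fun x a => ?_
      have := DFunLike.congr_fun (congrArg Subtype.val (h ⟨G.hatMap a, a, rfl⟩)) x
      rw [Hat.mul_apply, rightElt_hatMap] at this
      exact this
    refine Subtype.ext (LinearMap.ext fun c => ?_)
    obtain ⟨u, -, hu⟩ := G.regular.bij₄.surjOn (Set.mem_range_self (c ⊗ₜ[ℂ] d))
    have := DFunLike.congr_fun h0 u
    change ω.1 (sliceR G.haar (toAlg (T₄ (G.comul : A →ₗ[ℂ] Mult (A ⊗[ℂ] A)) u))) = 0 at this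
    rw [hu, toAlg_emb G.nondeg₂, sliceR_tmul, map_smul, smul_eq_zero] at this
    exact this.resolve_left hd
  · intro h
    have h0 : ω.1 ∘ₗ sliceL G.haar ∘ₗ toAlg ∘ₗ T₃ G.comulₗ = 0 := by
      refine TensorProduct.ext' fun x a => ?_
      have := DFunLike.congr_fun (congrArg Subtype.val (h ⟨G.hatMap a, a, rfl⟩)) x
      rw [Hat.mul_apply', leftElt_hatMap] at this
      exact this
    refine Subtype.ext (LinearMap.ext fun c => ?_)
    obtain ⟨u, -, hu⟩ := G.regular.bij₃.surjOn (Set.mem_range_self (d ⊗ₜ[ℂ] c))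
    have := DFunLike.congr_fun h0 u
    change ω.1 (sliceL G.haar (toAlg (T₃ (G.comul : A →ₗ[ℂ] Mult (A ⊗[ℂ] A)) u))) = 0 at this
    rw [hu, toAlg_emb G.nondeg₂, sliceL_tmul, map_smul, smul_eq_zero] at this
    exact this.resolve_left hd

/-- `Â ⊙ Â` regarded as a space of functionals on `A ⊙ A`. -/
def hat₂ : G.Hat ⊗[ℂ] G.Hat →ₗ[ℂ] Module.Dual ℂ (A ⊗[ℂ] A) :=
  TensorProduct.dualDistrib ℂ A A ∘ₗ TensorProduct.map G.hat.subtype G.hat.subtype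

/-- The comultiplication on `A ⊙ A`: `Δ(a ⊗ b) = (ι ⊙ χ ⊙ ι)(Δ(a) ⊗ Δ(b))`. -/
def comul₂ : A ⊗[ℂ] A →ₗ[ℂ] Mult ((A ⊗[ℂ] A) ⊗[ℂ] (A ⊗[ℂ] A)) :=
  Mult.congr (TensorProduct.tensorTensorTensorComm ℂ A A A A) tensorTensorTensorComm_mul ∘ₗ
    tensLin G.comulₗ G.comulₗ

end AlgebraicQuantumGroup

/-- The functional `θ` on `A` corresponds to the multiplier `T ∈ M(V)`, for an algebra `V` of
functionals on `A` (embedded by `ev`): `Tω = θω` and `ωT = ωθ` for all `ω ∈ V`, where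
`(θω)(x) = θ((ι ⊙ ω)Δ(x))` and `(ωθ)(x) = θ((ω ⊙ ι)Δ(x))`. -/
def Implements {V : Type*} [NonUnitalRing V] [Module ℂ V] [IsScalarTower ℂ V V]
    [SMulCommClass ℂ V V] (Δ : A →ₗ[ℂ] Mult (A ⊗[ℂ] A)) (ev : V →ₗ[ℂ] Module.Dual ℂ A)
    (T : Mult V) (θ : Module.Dual ℂ A) : Prop :=
  ∀ ω : V, ev (T.lact ω) = θ ∘ₗ rightElt Δ (ev ω) ∧ ev (T.ract ω) = θ ∘ₗ leftElt Δ (ev ω)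

namespace AlgebraicQuantumGroup

/-- The defining properties of the comultiplication `Δ̂ : Â → M(Â ⊙ Â)`. -/
structure IsDualComul (G : AlgebraicQuantumGroup A)
    (D : G.Hat →ₙₐ[ℂ] Mult (G.Hat ⊗[ℂ] G.Hat)) : Prop where
  nondegHom : NondegHom (D : G.Hat →ₗ[ℂ] Mult (G.Hat ⊗[ℂ] G.Hat))
  /-- `Δ̂(ω₁)(1 ⊗ ω₂)` belongs to `Â ⊙ Â` and maps `x ⊗ y` to `(ω₁ ⊙ ω₂)((x ⊗ 1)Δ(y))`. -/
  mul_right : ∀ ω₁ ω₂ : G.Hat, ∃ z : G.Hat ⊗[ℂ] G.Hat,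
    D ω₁ * tens 1 (emb G.Hat ω₂) = emb (G.Hat ⊗[ℂ] G.Hat) z ∧
      ∀ x y : A, G.hat₂ z (x ⊗ₜ y) =
        G.hat₂ (ω₁ ⊗ₜ ω₂) (toAlg (tens (emb A x) 1 * G.comulₗ y))
  /-- `(ω₁ ⊗ 1)Δ̂(ω₂)` belongs to `Â ⊙ Â` and maps `x ⊗ y` to `(ω₁ ⊙ ω₂)(Δ(x)(1 ⊗ y))`. -/
  mul_left : ∀ ω₁ ω₂ : G.Hat, ∃ z : G.Hat ⊗[ℂ] G.Hat,
    tens (emb G.Hat ω₁) 1 * D ω₂ = emb (G.Hat ⊗[ℂ] G.Hat) z ∧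
      ∀ x y : A, G.hat₂ z (x ⊗ₜ y) =
        G.hat₂ (ω₁ ⊗ₜ ω₂) (toAlg (G.comulₗ x * tens 1 (emb A y)))

end AlgebraicQuantumGroup

end DualAlgebra

end AQG

end

/-!
Everything follows from the fact that `Â` is an algebra of functionals on `A` under convolution
which has local units, separates the points of `A`, and whose elements `(ι ⊙ ω)Δ(x)` span `A`
(`IsDualPair`). For any such pair, a multiplier `T` determines the functional
`Σ (ι ⊙ ωᵢ)Δ(xᵢ) ↦ Σ (Tωᵢ)(xᵢ)`; it is well defined because a local unit `e` for the `ωᵢ` turns the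
sum into `(Te)(Σ (ι ⊙ ωᵢ)Δ(xᵢ))` (`IsDualPair.exists_implements`). The same argument applies to
`Â ⊙ Â` and `A ⊙ A`.

That `Â` has these properties (`AlgebraicQuantumGroup.isDualPair`) follows from the existence of
counit and antipode and from the faithfulness of the Haar functional `φ`; the later steps also need
the equality of the four spaces of functionals `φ(a ·)`, `φ(· a)`, `ψ(a ·)`, `ψ(· a)`, where `ψ` is
the right invariant functional `φ ∘ S`. This theory is developed for a system of linear maps
(`MultHopf`) consisting of the product and the four canonical bijections of `A ⊙ A`, with
coassociativity in the form that left coefficient maps `z ↦ (f ⊙ ι)((c ⊗ 1)Δ(z))` commute with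
right coefficient maps `z ↦ (ι ⊙ g)((1 ⊗ b)Δ(z))`. The opposite product and the opposite
comultiplication give structures of the same kind on the same space, so that most mirror images
come for free. The existence and bijectivity of the antipode come from strong left invariance,
`S((ι ⊙ φ)(Δ(a)(1 ⊗ y))) = (ι ⊙ φ)((1 ⊗ a)Δ(y))`.

A functional `θ` with slices in `A` comes from a multiplier because
`θ((ι ⊙ φ(a ·))Δ(·)) = φ(c ·)` with `c = S⁻¹((ι ⊙ θ)Δ(S(a)))` (`MultHopf.exists_haar_of_smooth`).

For the comultiplication, `x ⊗ y ↦ ω₁(x (ι ⊙ ω₂)Δ(y))` and `x ⊗ y ↦ ω₂((ω₁ ⊙ ι)Δ(x) y)` belong to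
`Â ⊙ Â`, and these elements span it (`AlgebraicQuantumGroup.exists_isRightProd_and_span`,
`AlgebraicQuantumGroup.exists_isLeftProd_and_span`). Hence the functional `x ⊗ y ↦ ω(xy)` multiplies
`Â ⊙ Â` into itself, and `Δ̂(ω)` is its multiplier. The identity
`m((ι ⊙ Δ̂(ω)v)Δ(t)) = (ι ⊙ ω)Δ(m((ι ⊙ v)Δ(t)))`, with `m` the product of `A`, expresses the
multiplicativity of `Δ` (`AlgebraicQuantumGroup.mul'_rightElt_dualComulₗ`); it makes `Δ̂`
multiplicative and carries the formula `Δ̂(ω)(x ⊗ y) = ω(xy)` over to all `ω ∈ M(Â)`. The last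
formula combines it with `[S(T₁ ⊗ T₂)](x ⊗ y) = S((ι ⊙ T₁)Δ(x) ⊗ (ι ⊙ T₂)Δ(y))`.
-/

noncomputable section

namespace AQG

/-! ### Slices of tensors and coefficient maps -/

section LinearSlices

variable {A B : Type*} [AddCommGroup A] [Module ℂ A] [AddCommGroup B] [Module ℂ B]

/-- The slice map `f ⊙ ι`, on bare vector spaces. -/
def lslice (f : Module.Dual ℂ A) : A ⊗[ℂ] B →ₗ[ℂ] B :=
  (TensorProduct.lid ℂ B).toLinearMap ∘ₗ LinearMap.rTensor B f

/-- The slice map `ι ⊙ f`, on bare vector spaces. -/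
def rslice (f : Module.Dual ℂ B) : A ⊗[ℂ] B →ₗ[ℂ] A :=
  (TensorProduct.rid ℂ A).toLinearMap ∘ₗ LinearMap.lTensor A f

@[simp] theorem lslice_tmul (f : Module.Dual ℂ A) (a : A) (b : B) :
    lslice f (a ⊗ₜ[ℂ] b) = f a • b := rfl
@[simp] theorem rslice_tmul (f : Module.Dual ℂ B) (a : A) (b : B) :
    rslice f (a ⊗ₜ[ℂ] b) = f b • a := rfl

theorem ext_rslice {s t : A ⊗[ℂ] B} (h : ∀ f : Module.Dual ℂ B, rslice f s = rslice f t) :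
    s = t := by
  classical
  refine (TensorProduct.equivFinsuppOfBasisRight (M := A)
    (Module.Basis.ofVectorSpace ℂ B)).injective ?_
  ext i
  simp only [TensorProduct.equivFinsuppOfBasisRight_apply]
  exact h _

theorem ext_lslice {s t : A ⊗[ℂ] B} (h : ∀ f : Module.Dual ℂ A, lslice f s = lslice f t) :
    s = t := by
  classical
  refine (TensorProduct.equivFinsuppOfBasisLeft (N := B)
    (Module.Basis.ofVectorSpace ℂ A)).injective ?_
  ext i
  simp only [TensorProduct.equivFinsuppOfBasisLeft_apply]
  exact h _

theorem eqOn_of_tmul {C : Type*} [AddCommGroup C] [Module ℂ C] {f g : A ⊗[ℂ] B →ₗ[ℂ] C}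
    (h : ∀ a b, f (a ⊗ₜ b) = g (a ⊗ₜ b)) (t : A ⊗[ℂ] B) : f t = g t :=
  DFunLike.congr_fun (TensorProduct.ext' h) t

variable {C : Type*} [AddCommGroup C] [Module ℂ C]

@[simp] theorem rslice_rTensor (f : Module.Dual ℂ B) (u : A →ₗ[ℂ] C) (t : A ⊗[ℂ] B) :
    rslice f (u.rTensor B t) = u (rslice f t) :=
  eqOn_of_tmul (f := rslice f ∘ₗ u.rTensor B) (g := u ∘ₗ rslice f) (by simp) t

@[simp] theorem lslice_lTensor (f : Module.Dual ℂ A) (u : B →ₗ[ℂ] C) (t : A ⊗[ℂ] B) :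
    lslice f (u.lTensor A t) = u (lslice f t) :=
  eqOn_of_tmul (f := lslice f ∘ₗ u.lTensor A) (g := u ∘ₗ lslice f) (by simp) t

theorem rslice_lTensor (f : Module.Dual ℂ C) (u : B →ₗ[ℂ] C) (t : A ⊗[ℂ] B) :
    rslice f (u.lTensor A t) = rslice (f ∘ₗ u) t :=
  eqOn_of_tmul (f := rslice f ∘ₗ u.lTensor A) (g := rslice (f ∘ₗ u)) (by simp) t

theorem lslice_rTensor (f : Module.Dual ℂ C) (u : A →ₗ[ℂ] C) (t : A ⊗[ℂ] B) :
    lslice f (u.rTensor B t) = lslice (f ∘ₗ u) t :=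
  eqOn_of_tmul (f := lslice f ∘ₗ u.rTensor B) (g := lslice (f ∘ₗ u)) (by simp) t

theorem apply_rslice (f : Module.Dual ℂ A) (g : Module.Dual ℂ B) (t : A ⊗[ℂ] B) :
    f (rslice g t) = g (lslice f t) :=
  eqOn_of_tmul (f := f ∘ₗ rslice g) (g := g ∘ₗ lslice f) (by simp [mul_comm]) t

@[simp] theorem rslice_comm (f : Module.Dual ℂ A) (t : A ⊗[ℂ] B) :
    rslice f (TensorProduct.comm ℂ A B t) = lslice f t :=
  eqOn_of_tmul (f := rslice f ∘ₗ (TensorProduct.comm ℂ A B).toLinearMap) (g := lslice f)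
    (by simp) t

@[simp] theorem lslice_comm (f : Module.Dual ℂ B) (t : A ⊗[ℂ] B) :
    lslice f (TensorProduct.comm ℂ A B t) = rslice f t :=
  eqOn_of_tmul (f := lslice f ∘ₗ (TensorProduct.comm ℂ A B).toLinearMap) (g := rslice f)
    (by simp) t

theorem comm_rTensor (u : A →ₗ[ℂ] C) (t : A ⊗[ℂ] B) :
    TensorProduct.comm ℂ C B (u.rTensor B t) = u.lTensor B (TensorProduct.comm ℂ A B t) :=
  eqOn_of_tmul (f := (TensorProduct.comm ℂ C B).toLinearMap ∘ₗ u.rTensor B)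
    (g := u.lTensor B ∘ₗ (TensorProduct.comm ℂ A B).toLinearMap) (by simp) t

theorem comm_lTensor (u : B →ₗ[ℂ] C) (t : A ⊗[ℂ] B) :
    TensorProduct.comm ℂ A C (u.lTensor A t) = u.rTensor A (TensorProduct.comm ℂ A B t) :=
  eqOn_of_tmul (f := (TensorProduct.comm ℂ A C).toLinearMap ∘ₗ u.lTensor A)
    (g := u.rTensor A ∘ₗ (TensorProduct.comm ℂ A B).toLinearMap) (by simp) t

theorem lslice_map {E : Type*} [AddCommGroup E] [Module ℂ E] (f : Module.Dual ℂ E) (u : A →ₗ[ℂ] E)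
    (v : B →ₗ[ℂ] C) (t : A ⊗[ℂ] B) :
    lslice f (TensorProduct.map u v t) = v (lslice (f ∘ₗ u) t) :=
  eqOn_of_tmul (f := lslice f ∘ₗ TensorProduct.map u v) (g := v ∘ₗ lslice (f ∘ₗ u))
    (by simp) t

theorem lTensor_rTensor_comm {E : Type*} [AddCommGroup E] [Module ℂ E] (u : B →ₗ[ℂ] C)
    (v : A →ₗ[ℂ] E) (t : A ⊗[ℂ] B) :
    u.lTensor E (v.rTensor B t) = v.rTensor C (u.lTensor A t) := by
  rw [← LinearMap.comp_apply, ← LinearMap.comp_apply, LinearMap.lTensor_comp_rTensor,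
    LinearMap.rTensor_comp_lTensor]

/-- A bijection onto `A ⊙ B` followed by a non-zero slice is surjective. -/
theorem exists_rslice {X : Type*} [AddCommGroup X] [Module ℂ X] (e : X ≃ₗ[ℂ] A ⊗[ℂ] B)
    {f : Module.Dual ℂ B} (hf : f ≠ 0) (a : A) : ∃ u, rslice f (e u) = a := by
  obtain ⟨d, hd⟩ : ∃ d, f d ≠ 0 := by
    by_contra! h
    exact hf (LinearMap.ext h)
  exact ⟨e.symm ((f d)⁻¹ • a ⊗ₜ d), by simp [hd]⟩

theorem exists_lslice {X : Type*} [AddCommGroup X] [Module ℂ X] (e : X ≃ₗ[ℂ] A ⊗[ℂ] B)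
    {f : Module.Dual ℂ A} (hf : f ≠ 0) (b : B) : ∃ u, lslice f (e u) = b := by
  obtain ⟨d, hd⟩ : ∃ d, f d ≠ 0 := by
    by_contra! h
    exact hf (LinearMap.ext h)
  exact ⟨e.symm ((f d)⁻¹ • d ⊗ₜ b), by simp [hd]⟩

/-- If all slices `(ι ⊙ f)(t)`, `f ∈ F`, vanish, then `t ∈ A ⊙ N` where `N` is the common kernel
of the functionals in `F`. -/
theorem mem_span_of_rslice_eq_zero {ι : Type*} (F : ι → Module.Dual ℂ B) (t : A ⊗[ℂ] B)
    (ht : ∀ i, rslice (F i) t = 0) :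
    t ∈ Submodule.span ℂ {z : A ⊗[ℂ] B | ∃ x n, (∀ i, F i n = 0) ∧ z = x ⊗ₜ n} := by
  classical
  obtain ⟨c, rfl⟩ := TensorProduct.eq_repr_basis_left (Module.Basis.ofVectorSpace ℂ A) t
  refine Submodule.sum_mem _ fun j hj => Submodule.subset_span ⟨_, _, fun i => ?_, rfl⟩
  have h := ht i
  simp only [Finsupp.sum, map_sum, rslice_tmul] at h
  exact linearIndependent_iff'.1 (Module.Basis.ofVectorSpace ℂ A).linearIndependent _ _ h j hj

/-- Two separating families of functionals on the legs separate the points of the tensor product. -/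
theorem eq_zero_of_rslice_eq_zero {ι κ : Type*} (E : κ → Module.Dual ℂ A) (F : ι → Module.Dual ℂ B)
    (hE : ∀ a, (∀ j, E j a = 0) → a = 0) (hF : ∀ b, (∀ i, F i b = 0) → b = 0) (t : A ⊗[ℂ] B)
    (ht : ∀ j i, E j (rslice (F i) t) = 0) : t = 0 := by
  have h := mem_span_of_rslice_eq_zero F t fun i => hE _ fun j => ht j i
  refine Submodule.span_induction (p := fun t _ => t = 0) ?_ rfl
    (fun x y _ _ hx hy => by simp [hx, hy]) (fun r x _ hx => by simp [hx]) h
  rintro _ ⟨x, n, hn, rfl⟩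
  simp [hF n hn]

/-- The map `z ↦ (f ⊙ ι)(e(c ⊗ z))`. -/
def lco (e : A ⊗[ℂ] A ≃ₗ[ℂ] A ⊗[ℂ] A) (f : Module.Dual ℂ A) (c : A) : A →ₗ[ℂ] A :=
  lslice f ∘ₗ e.toLinearMap ∘ₗ TensorProduct.mk ℂ A A c

/-- The map `z ↦ (ι ⊙ f)(e(z ⊗ b))`. -/
def rco (e : A ⊗[ℂ] A ≃ₗ[ℂ] A ⊗[ℂ] A) (f : Module.Dual ℂ A) (b : A) : A →ₗ[ℂ] A :=
  rslice f ∘ₗ e.toLinearMap ∘ₗ (TensorProduct.mk ℂ A A).flip b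

theorem lco_apply (e : A ⊗[ℂ] A ≃ₗ[ℂ] A ⊗[ℂ] A) (f : Module.Dual ℂ A) (c z : A) :
    lco e f c z = lslice f (e (c ⊗ₜ z)) := rfl

theorem rco_apply (e : A ⊗[ℂ] A ≃ₗ[ℂ] A ⊗[ℂ] A) (f : Module.Dual ℂ A) (b z : A) :
    rco e f b z = rslice f (e (z ⊗ₜ b)) := rfl

/-- The form in which coassociativity is used: the left coefficient maps of `e` commute with the
right coefficient maps of `e'`, that is, `e` acting on the first two legs of `A ⊙ A ⊙ A` commutes
with `e'` acting on the last two. -/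
def CoefCommute (e e' : A ⊗[ℂ] A ≃ₗ[ℂ] A ⊗[ℂ] A) : Prop :=
  ∀ f c g b z, lco e f c (rco e' g b z) = rco e' g b (lco e f c z)

theorem CoefCommute.lTensor_rco {e e' : A ⊗[ℂ] A ≃ₗ[ℂ] A ⊗[ℂ] A} (h : CoefCommute e e')
    (g : Module.Dual ℂ A) (b : A) (t : A ⊗[ℂ] A) :
    e ((rco e' g b).lTensor A t) = (rco e' g b).lTensor A (e t) :=
  eqOn_of_tmul (f := e.toLinearMap ∘ₗ (rco e' g b).lTensor A)
    (g := (rco e' g b).lTensor A ∘ₗ e.toLinearMap)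
    (fun c z => ext_lslice fun f => by
      simpa [lco_apply] using h f c g b z) t

theorem CoefCommute.rTensor_lco {e e' : A ⊗[ℂ] A ≃ₗ[ℂ] A ⊗[ℂ] A} (h : CoefCommute e e')
    (f : Module.Dual ℂ A) (c : A) (t : A ⊗[ℂ] A) :
    e' ((lco e f c).rTensor A t) = (lco e f c).rTensor A (e' t) :=
  eqOn_of_tmul (f := e'.toLinearMap ∘ₗ (lco e f c).rTensor A)
    (g := (lco e f c).rTensor A ∘ₗ e'.toLinearMap)
    (fun z b => ext_rslice fun g => by
      simpa [rco_apply] using (h f c g b z).symm) t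

end LinearSlices

/-! ### Multiplier Hopf algebras as systems of linear maps -/

/-- The linear maps attached to a regular multiplier Hopf algebra structure on the vector space
`A`. The product is kept as data, so that passing to the opposite product or to the opposite
comultiplication does not change the space. The comultiplication enters through the four canonical
bijections and through the multiplications by `Δ(a)`; the fields `dl_e₁` to `dr_e₄`, `e₁_mul` to
`e₄_mul` and `e₁_e₃` to `e₂_e₄` are associativity in the multiplier algebra and the
multiplicativity of `Δ`. -/
structure MultHopf (A : Type*) [AddCommGroup A] [Module ℂ A] where
  /-- the product -/
  mul : A →ₗ[ℂ] A →ₗ[ℂ] A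
  mul_assoc : ∀ a b c, mul (mul a b) c = mul a (mul b c)
  eq_zero_of_mul_right : ∀ a, (∀ b, mul a b = 0) → a = 0
  eq_zero_of_mul_left : ∀ a, (∀ b, mul b a = 0) → a = 0
  /-- `b ⊗ a ↦ Δ(a)(b ⊗ 1)` -/
  e₁ : A ⊗[ℂ] A ≃ₗ[ℂ] A ⊗[ℂ] A
  /-- `a ⊗ b ↦ Δ(a)(1 ⊗ b)` -/
  e₂ : A ⊗[ℂ] A ≃ₗ[ℂ] A ⊗[ℂ] A
  /-- `b ⊗ a ↦ (b ⊗ 1)Δ(a)` -/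
  e₃ : A ⊗[ℂ] A ≃ₗ[ℂ] A ⊗[ℂ] A
  /-- `a ⊗ b ↦ (1 ⊗ b)Δ(a)` -/
  e₄ : A ⊗[ℂ] A ≃ₗ[ℂ] A ⊗[ℂ] A
  /-- `t ↦ Δ(a)t` -/
  dl : A → A ⊗[ℂ] A →ₗ[ℂ] A ⊗[ℂ] A
  /-- `t ↦ tΔ(a)` -/
  dr : A → A ⊗[ℂ] A →ₗ[ℂ] A ⊗[ℂ] A
  dl_e₁ : ∀ a x y, dl a (x ⊗ₜ y) = (mul.flip y).lTensor A (e₁ (x ⊗ₜ a))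
  dl_e₂ : ∀ a x y, dl a (x ⊗ₜ y) = (mul.flip x).rTensor A (e₂ (a ⊗ₜ y))
  dr_e₃ : ∀ a x y, dr a (x ⊗ₜ y) = (mul y).lTensor A (e₃ (x ⊗ₜ a))
  dr_e₄ : ∀ a x y, dr a (x ⊗ₜ y) = (mul x).rTensor A (e₄ (a ⊗ₜ y))
  e₁_mul : ∀ x a b, e₁ (x ⊗ₜ mul a b) = dl a (e₁ (x ⊗ₜ b))
  e₂_mul : ∀ a b y, e₂ (mul a b ⊗ₜ y) = dl a (e₂ (b ⊗ₜ y))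
  e₃_mul : ∀ x a b, e₃ (x ⊗ₜ mul a b) = dr b (e₃ (x ⊗ₜ a))
  e₄_mul : ∀ a b y, e₄ (mul a b ⊗ₜ y) = dr b (e₄ (a ⊗ₜ y))
  e₁_e₃ : ∀ a b c, (mul c).rTensor A (e₁ (b ⊗ₜ a)) = (mul.flip b).rTensor A (e₃ (c ⊗ₜ a))
  e₁_e₄ : ∀ a b c, (mul c).lTensor A (e₁ (b ⊗ₜ a)) = (mul.flip b).rTensor A (e₄ (a ⊗ₜ c))
  e₃_e₂ : ∀ a b c, (mul.flip c).lTensor A (e₃ (b ⊗ₜ a)) = (mul b).rTensor A (e₂ (a ⊗ₜ c))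
  e₂_e₄ : ∀ a b c, (mul c).lTensor A (e₂ (a ⊗ₜ b)) = (mul.flip b).lTensor A (e₄ (a ⊗ₜ c))
  coassoc₁₂ : CoefCommute e₁ e₂
  coassoc₁₄ : CoefCommute e₁ e₄
  coassoc₃₂ : CoefCommute e₃ e₂
  coassoc₃₄ : CoefCommute e₃ e₄

namespace MultHopf

variable {A : Type*} [AddCommGroup A] [Module ℂ A] (H : MultHopf A)

/-- The same comultiplication, with the opposite product. -/
def op : MultHopf A where
  mul := H.mul.flip
  mul_assoc a b c := (H.mul_assoc c b a).symm
  eq_zero_of_mul_right := H.eq_zero_of_mul_left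
  eq_zero_of_mul_left := H.eq_zero_of_mul_right
  e₁ := H.e₃
  e₂ := H.e₄
  e₃ := H.e₁
  e₄ := H.e₂
  dl := H.dr
  dr := H.dl
  dl_e₁ := H.dr_e₃
  dl_e₂ := H.dr_e₄
  dr_e₃ := H.dl_e₁
  dr_e₄ := H.dl_e₂
  e₁_mul x a b := H.e₃_mul x b a
  e₂_mul a b y := H.e₄_mul b a y
  e₃_mul x a b := H.e₁_mul x b a
  e₄_mul a b y := H.e₂_mul b a y
  e₁_e₃ a b c := (H.e₁_e₃ a c b).symm
  e₁_e₄ a b c := H.e₃_e₂ a b c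
  e₃_e₂ a b c := H.e₁_e₄ a b c
  e₂_e₄ a b c := (H.e₂_e₄ a c b).symm
  coassoc₁₂ := H.coassoc₃₄
  coassoc₁₄ := H.coassoc₃₂
  coassoc₃₂ := H.coassoc₁₄
  coassoc₃₄ := H.coassoc₁₂

/-- Conjugation of an automorphism of `A ⊙ A` with the flip. -/
def flipConj (e : A ⊗[ℂ] A ≃ₗ[ℂ] A ⊗[ℂ] A) : A ⊗[ℂ] A ≃ₗ[ℂ] A ⊗[ℂ] A :=
  TensorProduct.comm ℂ A A ≪≫ₗ e ≪≫ₗ TensorProduct.comm ℂ A A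

@[simp] theorem flipConj_tmul (e : A ⊗[ℂ] A ≃ₗ[ℂ] A ⊗[ℂ] A) (a b : A) :
    flipConj e (a ⊗ₜ b) = TensorProduct.comm ℂ A A (e (b ⊗ₜ a)) := rfl

@[simp] theorem flipConj_symm_tmul (e : A ⊗[ℂ] A ≃ₗ[ℂ] A ⊗[ℂ] A) (a b : A) :
    (flipConj e).symm (a ⊗ₜ b) = TensorProduct.comm ℂ A A (e.symm (b ⊗ₜ a)) := rfl

theorem lco_flipConj (e : A ⊗[ℂ] A ≃ₗ[ℂ] A ⊗[ℂ] A) (f : Module.Dual ℂ A) (c : A) :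
    lco (flipConj e) f c = rco e f c :=
  LinearMap.ext fun z => by simp [lco_apply, rco_apply]

theorem rco_flipConj (e : A ⊗[ℂ] A ≃ₗ[ℂ] A ⊗[ℂ] A) (f : Module.Dual ℂ A) (c : A) :
    rco (flipConj e) f c = lco e f c :=
  LinearMap.ext fun z => by simp [lco_apply, rco_apply]

theorem _root_.AQG.CoefCommute.flipConj {e e' : A ⊗[ℂ] A ≃ₗ[ℂ] A ⊗[ℂ] A} (h : CoefCommute e e') :
    CoefCommute (flipConj e') (flipConj e) := fun f c g b z => by
  rw [lco_flipConj, rco_flipConj, h g b f c z]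

/-- The same product, with the opposite comultiplication. -/
def cop : MultHopf A where
  mul := H.mul
  mul_assoc := H.mul_assoc
  eq_zero_of_mul_right := H.eq_zero_of_mul_right
  eq_zero_of_mul_left := H.eq_zero_of_mul_left
  e₁ := flipConj H.e₂
  e₂ := flipConj H.e₁
  e₃ := flipConj H.e₄
  e₄ := flipConj H.e₃
  dl a := (TensorProduct.comm ℂ A A).toLinearMap ∘ₗ H.dl a ∘ₗ
    (TensorProduct.comm ℂ A A).toLinearMap
  dr a := (TensorProduct.comm ℂ A A).toLinearMap ∘ₗ H.dr a ∘ₗ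
    (TensorProduct.comm ℂ A A).toLinearMap
  dl_e₁ a x y := by simp [H.dl_e₂, comm_rTensor]
  dl_e₂ a x y := by simp [H.dl_e₁, comm_lTensor]
  dr_e₃ a x y := by simp [H.dr_e₄, comm_rTensor]
  dr_e₄ a x y := by simp [H.dr_e₃, comm_lTensor]
  e₁_mul x a b := by simp [H.e₂_mul]
  e₂_mul x a b := by simp [H.e₁_mul]
  e₃_mul x a b := by simp [H.e₄_mul]
  e₄_mul x a b := by simp [H.e₃_mul]
  e₁_e₃ a b c := by simp only [flipConj_tmul, ← comm_lTensor, H.e₂_e₄]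
  e₁_e₄ a b c := by
    simp only [flipConj_tmul, ← comm_lTensor, ← comm_rTensor, H.e₃_e₂]
  e₃_e₂ a b c := by
    simp only [flipConj_tmul, ← comm_lTensor, ← comm_rTensor, H.e₁_e₄]
  e₂_e₄ a b c := by simp only [flipConj_tmul, ← comm_rTensor, H.e₁_e₃]
  coassoc₁₂ := H.coassoc₁₂.flipConj
  coassoc₁₄ := H.coassoc₃₂.flipConj
  coassoc₃₂ := H.coassoc₁₄.flipConj
  coassoc₃₄ := H.coassoc₃₄.flipConj

end MultHopf

/-! ### Counit, antipode and Haar functionals -/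

namespace MultHopf

variable {A : Type*} [AddCommGroup A] [Module ℂ A] (H : MultHopf A)

theorem ext_mul_right {a b : A} (h : ∀ c, H.mul a c = H.mul b c) : a = b := by
  rw [← sub_eq_zero]
  exact H.eq_zero_of_mul_right _ fun c => by simp [h]

theorem ext_mul_left {a b : A} (h : ∀ c, H.mul c a = H.mul c b) : a = b := by
  rw [← sub_eq_zero]
  exact H.eq_zero_of_mul_left _ fun c => by simp [h]

theorem ext_lTensor_flip {s t : A ⊗[ℂ] A}
    (h : ∀ b, (H.mul.flip b).lTensor A s = (H.mul.flip b).lTensor A t) : s = t :=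
  ext_lslice fun f => H.ext_mul_right fun b => by
    simpa using congrArg (lslice f) (h b)

theorem ext_lTensor {s t : A ⊗[ℂ] A}
    (h : ∀ b, (H.mul b).lTensor A s = (H.mul b).lTensor A t) : s = t :=
  ext_lslice fun f => H.ext_mul_left fun b => by
    simpa using congrArg (lslice f) (h b)

theorem ext_rTensor {s t : A ⊗[ℂ] A}
    (h : ∀ b, (H.mul b).rTensor A s = (H.mul b).rTensor A t) : s = t :=
  ext_rslice fun f => H.ext_mul_left fun b => by
    simpa using congrArg (rslice f) (h b)

/-- The product as a linear map on `A ⊙ A`. -/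
def mu : A ⊗[ℂ] A →ₗ[ℂ] A := TensorProduct.lift H.mul

@[simp] theorem mu_tmul (a b : A) : H.mu (a ⊗ₜ b) = H.mul a b := rfl

/-- `ε` is the counit: `(ι ⊙ ε)Δ(a) = a = (ε ⊙ ι)Δ(a)`, with the multipliers `Δ(a)` reduced to
elements of `A ⊙ A` in the four possible ways. -/
structure IsCounit (ε : Module.Dual ℂ A) : Prop where
  e₁ : ∀ a b, rslice ε (H.e₁ (b ⊗ₜ a)) = H.mul a b
  e₂ : ∀ a b, lslice ε (H.e₂ (a ⊗ₜ b)) = H.mul a b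
  e₃ : ∀ a b, rslice ε (H.e₃ (b ⊗ₜ a)) = H.mul b a
  e₄ : ∀ a b, lslice ε (H.e₄ (a ⊗ₜ b)) = H.mul b a

variable {H} {ε : Module.Dual ℂ A}

theorem IsCounit.op (h : H.IsCounit ε) : H.op.IsCounit ε :=
  ⟨h.e₃, h.e₄, h.e₁, h.e₂⟩

theorem IsCounit.cop (h : H.IsCounit ε) : H.cop.IsCounit ε where
  e₁ a b := by simpa [MultHopf.cop] using h.e₂ a b
  e₂ a b := by simpa [MultHopf.cop] using h.e₁ a b
  e₃ a b := by simpa [MultHopf.cop] using h.e₄ a b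
  e₄ a b := by simpa [MultHopf.cop] using h.e₃ a b

variable (H)

/-- Elements of the form `(f ⊙ ι)((c ⊗ 1)Δ(p))` behave under `p ⊗ q ↦ m(T⁻¹(p ⊗ q))`,
`T(a ⊗ b) = Δ(a)(1 ⊗ b)`, as if a counit were applied to the first leg. -/
theorem mu_e₂_symm_lco (f : Module.Dual ℂ A) (c p q : A) :
    H.mu (H.e₂.symm (lco H.e₃ f c p ⊗ₜ q)) = f (H.mul c p) • q := by
  have key : ∀ u : A ⊗[ℂ] A, H.mu ((lco H.e₃ f c).rTensor A u) =
      lslice f ((H.mul c).rTensor A (H.e₂ u)) :=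
    eqOn_of_tmul (f := H.mu ∘ₗ (lco H.e₃ f c).rTensor A)
      (g := lslice f ∘ₗ (H.mul c).rTensor A ∘ₗ H.e₂.toLinearMap) fun a b => by
        simp [lco_apply, ← H.e₃_e₂]
  have h2 : H.e₂.symm (lco H.e₃ f c p ⊗ₜ q) = (lco H.e₃ f c).rTensor A (H.e₂.symm (p ⊗ₜ q)) := by
    rw [LinearEquiv.symm_apply_eq, H.coassoc₃₂.rTensor_lco]
    simp
  rw [h2, key]
  simp

theorem exists_isCounit [Nontrivial A] : ∃ ε, H.IsCounit ε := by
  obtain ⟨x₀, hx₀⟩ := exists_ne (0 : A)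
  obtain ⟨f₀, hf₀⟩ : ∃ f₀ : Module.Dual ℂ A, f₀ x₀ = 1 := by
    obtain ⟨f, hf⟩ : ∃ f : Module.Dual ℂ A, f x₀ ≠ 0 := by
      by_contra! h
      exact hx₀ ((Module.forall_dual_apply_eq_zero_iff ℂ x₀).1 h)
    exact ⟨(f x₀)⁻¹ • f, by simp [hf]⟩
  let ε : Module.Dual ℂ A := f₀ ∘ₗ H.mu ∘ₗ H.e₃.symm.toLinearMap ∘ₗ TensorProduct.mk ℂ A A x₀
  have hE : ∀ y q, H.mu (H.e₂.symm (y ⊗ₜ q)) = ε y • q := by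
    intro y q
    have key : ∀ u : A ⊗[ℂ] A, H.mu (H.e₂.symm (lslice f₀ (H.e₃ u) ⊗ₜ q)) = f₀ (H.mu u) • q :=
      eqOn_of_tmul (f := H.mu ∘ₗ H.e₂.symm.toLinearMap ∘ₗ (TensorProduct.mk ℂ A A).flip q ∘ₗ
        lslice f₀ ∘ₗ H.e₃.toLinearMap)
        (g := (f₀ ∘ₗ H.mu).smulRight q) fun c p => by
          simpa [lco_apply] using H.mu_e₂_symm_lco f₀ c p q
    have := key (H.e₃.symm (x₀ ⊗ₜ y))
    simpa [hf₀, ε] using this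
  have hE' : ∀ t, H.mu (H.e₂.symm t) = lslice ε t :=
    eqOn_of_tmul (f := H.mu ∘ₗ H.e₂.symm.toLinearMap) (g := lslice ε)
      fun y q => by simpa using hE y q
  have h₂ : ∀ a b, lslice ε (H.e₂ (a ⊗ₜ b)) = H.mul a b := fun a b => by
    rw [← hE']; simp
  have h₃ : ∀ a b, rslice ε (H.e₃ (b ⊗ₜ a)) = H.mul b a := by
    intro a b
    rw [← sub_eq_zero, ← Module.forall_dual_apply_eq_zero_iff ℂ]
    intro f
    have h := H.mu_e₂_symm_lco f b a x₀
    rw [hE, lco_apply, ← apply_rslice] at h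
    have := smul_left_injective ℂ hx₀ h
    rw [map_sub, sub_eq_zero, this]
  refine ⟨ε, ?_, h₂, h₃, ?_⟩
  · intro a b
    refine H.ext_mul_left fun c => ?_
    rw [← rslice_rTensor, H.e₁_e₃, rslice_rTensor, h₃]
    exact H.mul_assoc _ _ _
  · intro a b
    refine H.ext_mul_right fun c => ?_
    rw [← LinearMap.flip_apply, ← lslice_lTensor, ← H.e₂_e₄, lslice_lTensor, h₂]
    exact (H.mul_assoc _ _ _).symm

variable {H}

namespace IsCounit

variable (hε : H.IsCounit ε)
include hε

theorem ne_zero [Nontrivial A] : ε ≠ 0 := by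
  rintro rfl
  obtain ⟨x, hx⟩ := exists_ne (0 : A)
  refine hx (H.eq_zero_of_mul_right x fun b => ?_)
  rw [← hε.e₂]
  simp [lslice]

theorem lslice_e₂ (u : A ⊗[ℂ] A) : lslice ε (H.e₂ u) = H.mu u :=
  eqOn_of_tmul (f := lslice ε ∘ₗ H.e₂.toLinearMap) (g := H.mu)
    (fun a b => by simpa using hε.e₂ a b) u

theorem mu_e₂_symm (t : A ⊗[ℂ] A) : H.mu (H.e₂.symm t) = lslice ε t := by
  rw [← hε.lslice_e₂]; simp

/-- The counit is multiplicative. -/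
theorem map_mul [Nontrivial A] (a x : A) : ε (H.mul a x) = ε a * ε x := by
  obtain ⟨y, hy⟩ := exists_ne (0 : A)
  -- `(ε ⊙ ι)(Δ(a)t) = a (ε ⊙ ι)(t)`
  have h1 : ∀ a t, lslice ε (H.dl a t) = H.mul a (lslice ε t) := by
    intro a t
    have : ∀ u, lslice ε (H.dl a (H.e₂ u)) = H.mul a (lslice ε (H.e₂ u)) :=
      eqOn_of_tmul (f := lslice ε ∘ₗ H.dl a ∘ₗ H.e₂.toLinearMap)
        (g := H.mul a ∘ₗ lslice ε ∘ₗ H.e₂.toLinearMap) fun b y => by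
          simp [← H.e₂_mul, hε.e₂, H.mul_assoc]
    simpa using this (H.e₂.symm t)
  have h2 : ∀ u : A ⊗[ℂ] A, lslice ε ((H.mul.flip x).rTensor A (H.e₂ u)) =
      ε x • lslice ε (H.e₂ u) :=
    eqOn_of_tmul (f := lslice ε ∘ₗ (H.mul.flip x).rTensor A ∘ₗ H.e₂.toLinearMap)
      (g := ε x • (lslice ε ∘ₗ H.e₂.toLinearMap)) fun b z => by
        simp [← H.dl_e₂, h1, hε.e₂]
  have := h2 (H.e₂.symm (a ⊗ₜ y))
  simp only [LinearEquiv.apply_symm_apply, LinearMap.rTensor_tmul, lslice_tmul,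
    LinearMap.flip_apply, smul_smul] at this
  rw [smul_left_injective ℂ hy this, mul_comm]

end IsCounit

variable (H)

/-- `S` is the antipode, as a bijection: `S(x)n`, `dS(x)`, `S⁻¹(x)d` and `nS⁻¹(x)`
come from the inverses of the four canonical maps. -/
structure IsAntipode (ε : Module.Dual ℂ A) (S : A ≃ₗ[ℂ] A) : Prop where
  e₁ : ∀ d x, H.mul (S.symm x) d = rslice ε (H.e₁.symm (d ⊗ₜ x))
  e₂ : ∀ x n, H.mul (S x) n = lslice ε (H.e₂.symm (x ⊗ₜ n))
  e₃ : ∀ d x, H.mul d (S x) = rslice ε (H.e₃.symm (d ⊗ₜ x))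
  e₄ : ∀ x n, H.mul n (S.symm x) = lslice ε (H.e₄.symm (x ⊗ₜ n))

/-- `φ` is a left Haar functional: `φ ≠ 0` and `(ι ⊙ φ)Δ(a) = φ(a)1`. -/
structure IsLeftHaar (φ : Module.Dual ℂ A) : Prop where
  ne_zero : φ ≠ 0
  e₁ : ∀ a b, rslice φ (H.e₁ (b ⊗ₜ a)) = φ a • b
  e₃ : ∀ a b, rslice φ (H.e₃ (b ⊗ₜ a)) = φ a • b

variable {H} {φ : Module.Dual ℂ A} {S : A ≃ₗ[ℂ] A}

theorem IsAntipode.op (h : H.IsAntipode ε S) : H.op.IsAntipode ε S.symm :=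
  ⟨h.e₃, h.e₄, h.e₁, h.e₂⟩

theorem IsAntipode.cop (h : H.IsAntipode ε S) : H.cop.IsAntipode ε S.symm where
  e₁ d x := by simpa [MultHopf.cop] using h.e₂ x d
  e₂ d x := by simpa [MultHopf.cop] using h.e₁ x d
  e₃ d x := by simpa [MultHopf.cop] using h.e₄ x d
  e₄ d x := by simpa [MultHopf.cop] using h.e₃ x d

theorem IsLeftHaar.op (h : H.IsLeftHaar φ) : H.op.IsLeftHaar φ := ⟨h.ne_zero, h.e₃, h.e₁⟩

/-- Strong left invariance: `d S((ι ⊙ φ)(Δ(a)(1 ⊗ y))) = d (ι ⊙ φ)((1 ⊗ a)Δ(y))`. -/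
theorem rslice_e₃_symm_rco (hε : H.IsCounit ε) (hφ : H.IsLeftHaar φ) (d a y : A) :
    rslice ε (H.e₃.symm (d ⊗ₜ rco H.e₂ φ y a)) = H.mul d (rco H.e₄ φ a y) := by
  have h1 : H.e₃.symm (d ⊗ₜ rco H.e₂ φ y a) =
      (rco H.e₂ φ y).lTensor A (H.e₃.symm (d ⊗ₜ a)) := by
    rw [LinearEquiv.symm_apply_eq, H.coassoc₃₂.lTensor_rco]
    simp
  have h2 : H.mul d (rco H.e₄ φ a y) = rslice φ (H.dr y (d ⊗ₜ a)) := by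
    rw [H.dr_e₄, rslice_rTensor, rco_apply]
  have h3 : ∀ u : A ⊗[ℂ] A, rslice ε ((rco H.e₂ φ y).lTensor A u) =
      rslice φ (H.dr y (H.e₃ u)) :=
    eqOn_of_tmul (f := rslice ε ∘ₗ (rco H.e₂ φ y).lTensor A)
      (g := rslice φ ∘ₗ H.dr y ∘ₗ H.e₃.toLinearMap) fun f g => by
        simp [← H.e₃_mul, hφ.e₃, rco_apply, apply_rslice, hε.e₂]
  rw [h1, h2, h3, LinearEquiv.apply_symm_apply]

/-- `(d S(x)) n = d (S(x) n)`. -/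
theorem mul_rslice_e₃_symm (hε : H.IsCounit ε) (d x n : A) :
    H.mul (rslice ε (H.e₃.symm (d ⊗ₜ x))) n = H.mul d (lslice ε (H.e₂.symm (x ⊗ₜ n))) := by
  let Ln : A →ₗ[ℂ] A := lslice ε ∘ₗ H.e₂.symm.toLinearMap ∘ₗ (TensorProduct.mk ℂ A A).flip n
  have h1 : ∀ f h (w : A ⊗[ℂ] A), lslice ε ((lco H.e₃ h f).rTensor A w) =
      lslice h ((H.mul f).rTensor A w) := fun f h w =>
    eqOn_of_tmul (f := lslice ε ∘ₗ (lco H.e₃ h f).rTensor A)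
      (g := lslice h ∘ₗ (H.mul f).rTensor A) (fun r s => by
        simp [lco_apply, ← apply_rslice, hε.e₃]) w
  have h2 : ∀ f g, Ln.lTensor A (H.e₃ (f ⊗ₜ g)) = (H.mul f).rTensor A (H.e₂.symm (g ⊗ₜ n)) := by
    intro f g
    refine ext_lslice fun h => ?_
    rw [lslice_lTensor, ← h1]
    have : H.e₂.symm (lco H.e₃ h f g ⊗ₜ n) = (lco H.e₃ h f).rTensor A (H.e₂.symm (g ⊗ₜ n)) := by
      rw [LinearEquiv.symm_apply_eq, H.coassoc₃₂.rTensor_lco]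
      simp
    rw [← this]
    rfl
  have h3 : ∀ f (w : A ⊗[ℂ] A), H.mu ((H.mul f).rTensor A w) = H.mul f (H.mu w) := fun f w =>
    eqOn_of_tmul (f := H.mu ∘ₗ (H.mul f).rTensor A) (g := H.mul f ∘ₗ H.mu)
      (fun r s => by simp [H.mul_assoc]) w
  have h4 : ∀ u : A ⊗[ℂ] A, H.mul (rslice ε u) n = H.mu (Ln.lTensor A (H.e₃ u)) := fun u =>
    eqOn_of_tmul (f := H.mul.flip n ∘ₗ rslice ε) (g := H.mu ∘ₗ Ln.lTensor A ∘ₗ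
      H.e₃.toLinearMap) (fun f g => by simp [h2, h3, hε.mu_e₂_symm]) u
  rw [h4, LinearEquiv.apply_symm_apply]
  rfl

/-- The antipode exists, as a bijection of `A`: strong invariance shows that the multiplier `S(x)`
belongs to `A`, and that the antipode of the opposite product inverts `S`. -/
theorem exists_isAntipode (hε : H.IsCounit ε) (hφ : H.IsLeftHaar φ) : ∃ S, H.IsAntipode ε S := by
  -- for `u = a ⊗ y`, `p u = (ι ⊙ φ)(Δ(a)(1 ⊗ y))` and `q u = (ι ⊙ φ)((1 ⊗ a)Δ(y))`; `S (p u) = q u`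
  let p : A ⊗[ℂ] A →ₗ[ℂ] A := rslice φ ∘ₗ H.e₂.toLinearMap
  let q : A ⊗[ℂ] A →ₗ[ℂ] A := rslice φ ∘ₗ H.e₄.toLinearMap ∘ₗ
    (TensorProduct.comm ℂ A A).toLinearMap
  have hp : Function.Surjective p := exists_rslice H.e₂ hφ.ne_zero
  have hq : Function.Surjective q :=
    exists_rslice (TensorProduct.comm ℂ A A ≪≫ₗ H.e₄) hφ.ne_zero
  have h3 : ∀ d u, rslice ε (H.e₃.symm (d ⊗ₜ p u)) = H.mul d (q u) := fun d u =>
    eqOn_of_tmul (f := rslice ε ∘ₗ H.e₃.symm.toLinearMap ∘ₗ TensorProduct.mk ℂ A A d ∘ₗ p)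
      (g := H.mul d ∘ₗ q) (fun a y => by
        simpa [rco_apply, p, q] using rslice_e₃_symm_rco hε hφ d a y) u
  have h1 : ∀ d u, rslice ε (H.e₁.symm (d ⊗ₜ q u)) = H.mul (p u) d := fun d u =>
    eqOn_of_tmul (f := rslice ε ∘ₗ H.e₁.symm.toLinearMap ∘ₗ TensorProduct.mk ℂ A A d ∘ₗ q)
      (g := H.mul.flip d ∘ₗ p) (fun a y => by
        simpa [rco_apply, p, q, MultHopf.op] using rslice_e₃_symm_rco hε.op hφ.op d y a) u
  obtain ⟨S, hS⟩ := exists_descend p q hp fun u hu => H.eq_zero_of_mul_left _ fun d => by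
    rw [← h3, hu]; simp
  obtain ⟨S', hS'⟩ := exists_descend q p hq fun u hu => H.eq_zero_of_mul_right _ fun d => by
    rw [← h1, hu]; simp
  have hSS' : S ∘ₗ S' = LinearMap.id := LinearMap.ext fun x => by
    obtain ⟨u, rfl⟩ := hq x
    simp [hS, hS']
  have hS'S : S' ∘ₗ S = LinearMap.id := LinearMap.ext fun x => by
    obtain ⟨u, rfl⟩ := hp x
    simp [hS, hS']
  have k3 : ∀ d x, H.mul d (S x) = rslice ε (H.e₃.symm (d ⊗ₜ x)) := fun d x => by
    obtain ⟨u, rfl⟩ := hp x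
    rw [hS, h3]
  have k1 : ∀ d x, H.mul (S' x) d = rslice ε (H.e₁.symm (d ⊗ₜ x)) := fun d x => by
    obtain ⟨u, rfl⟩ := hq x
    rw [hS', h1]
  refine ⟨LinearEquiv.ofLinearMap S S' hSS' hS'S, k1, fun x n => H.ext_mul_left fun d => ?_, k3,
    fun x n => H.ext_mul_right fun d => ?_⟩
  · rw [← mul_rslice_e₃_symm hε, ← k3, H.mul_assoc]
    rfl
  · have := mul_rslice_e₃_symm hε.op d x n
    refine Eq.trans ?_ this
    refine (H.mul_assoc _ _ _).trans ?_
    exact congrArg (H.mul n) (k1 d x)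

/-- `Σ S(a₁d)a₂t = ε(a)S(d)t`. -/
theorem IsCounit.lslice_e₂_symm_dl [Nontrivial A] (hε : H.IsCounit ε) (a : A) (t : A ⊗[ℂ] A) :
    lslice ε (H.e₂.symm (H.dl a t)) = ε a • lslice ε (H.e₂.symm t) := by
  have : ∀ u : A ⊗[ℂ] A, lslice ε (H.e₂.symm (H.dl a (H.e₂ u))) = ε a • lslice ε u :=
    eqOn_of_tmul (f := lslice ε ∘ₗ H.e₂.symm.toLinearMap ∘ₗ H.dl a ∘ₗ H.e₂.toLinearMap)
      (g := ε a • lslice ε) fun p q => by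
        simp [← H.e₂_mul, hε.map_mul, smul_smul]
  simpa using this (H.e₂.symm t)

/-- The bilinear map `(w, q) ↦ (ι ⊙ φ)((1 ⊗ q)w)`. -/
def sliceMul (H : MultHopf A) (φ : Module.Dual ℂ A) : A ⊗[ℂ] A →ₗ[ℂ] A →ₗ[ℂ] A :=
  TensorProduct.lift (LinearMap.mk₂ ℂ (fun k y => (φ ∘ₗ H.mul.flip y).smulRight k)
    (fun _ _ _ => by ext; simp) (fun _ _ _ => LinearMap.ext fun _ => smul_comm _ _ _)
    (fun _ _ _ => by ext; simp [add_smul]) (fun _ _ _ => by ext; simp [smul_smul]))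

theorem sliceMul_apply (w : A ⊗[ℂ] A) (q : A) :
    sliceMul H φ w q = rslice φ ((H.mul q).lTensor A w) :=
  eqOn_of_tmul (f := LinearMap.applyₗ q ∘ₗ sliceMul H φ)
    (g := rslice φ ∘ₗ (H.mul q).lTensor A) (fun k y => by simp [sliceMul]) w

/-- The element `Δ(a)(1 ⊗ k)` for `a = (ι ⊙ φ)(Δ(c)(1 ⊗ y))`, when `k ⊗ y = Σ Δ(yᵢ)(kᵢ ⊗ 1)`: it
is the sum of the `(ι ⊙ φ)(Δ(c)(1 ⊗ yᵢ)) ⊗ kᵢ`. -/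
theorem e₂_rco_e₂ (hφ : H.IsLeftHaar φ) (c k y : A) : H.e₂ (rco H.e₂ φ y c ⊗ₜ k) =
    TensorProduct.comm ℂ A A
      ((rslice φ ∘ₗ H.e₂.toLinearMap ∘ₗ TensorProduct.mk ℂ A A c).lTensor A
        (H.e₁.symm (k ⊗ₜ y))) := by
  have h1 : ∀ (q : A) (w : A ⊗[ℂ] A), rslice φ (H.dl q (H.e₁ w)) =
      rslice φ ((H.mul q).lTensor A w) := fun q w =>
    eqOn_of_tmul (f := rslice φ ∘ₗ H.dl q ∘ₗ H.e₁.toLinearMap)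
      (g := rslice φ ∘ₗ (H.mul q).lTensor A) (fun d z => by simp [← H.e₁_mul, hφ.e₁]) w
  refine H.ext_rTensor fun d => ?_
  rw [← H.e₃_e₂]
  have h2 : H.e₃ (d ⊗ₜ rco H.e₂ φ y c) = (rco H.e₂ φ y).lTensor A (H.e₃ (d ⊗ₜ c)) := by
    rw [← H.coassoc₃₂.lTensor_rco]; simp
  have h3 : H.mul.flip k ∘ₗ rco H.e₂ φ y = sliceMul H φ (H.e₁.symm (k ⊗ₜ y)) := by
    refine LinearMap.ext fun q => ?_
    rw [sliceMul_apply, ← h1, LinearEquiv.apply_symm_apply, H.dl_e₂, rslice_rTensor]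
    rfl
  rw [h2, ← LinearMap.comp_apply, ← LinearMap.lTensor_comp, h3]
  generalize H.e₁.symm (k ⊗ₜ[ℂ] y) = w
  induction w with
  | zero => simp
  | add u v hu hv => simp only [map_add, LinearMap.lTensor_add, LinearMap.add_apply, hu, hv]
  | tmul k' y' =>
    have h4 : ∀ t : A ⊗[ℂ] A, (sliceMul H φ (k' ⊗ₜ y')).lTensor A t =
        rslice φ ((H.mul.flip y').lTensor A t) ⊗ₜ k' :=
      eqOn_of_tmul (f := (sliceMul H φ (k' ⊗ₜ y')).lTensor A)
        (g := (TensorProduct.mk ℂ A A).flip k' ∘ₗ rslice φ ∘ₗ (H.mul.flip y').lTensor A)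
        fun p q => by simp [sliceMul]
    rw [h4, H.e₃_e₂, rslice_rTensor]
    simp

namespace IsAntipode

variable (hε : H.IsCounit ε) (hS : H.IsAntipode ε S)
include hε hS

theorem rco_e₂ (hφ : H.IsLeftHaar φ) (a y : A) : S (rco H.e₂ φ y a) = rco H.e₄ φ a y :=
  H.ext_mul_left fun d => by rw [hS.e₃, rslice_e₃_symm_rco hε hφ]

theorem map_mul [Nontrivial A] (x e : A) : S (H.mul x e) = H.mul (S e) (S x) := by
  refine H.ext_mul_right fun b => ?_
  have key : ∀ u : A ⊗[ℂ] A, lslice ε (H.e₂.symm ((H.mul.flip e).rTensor A (H.e₂ u))) =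
      H.mul (S e) (lslice ε u) :=
    eqOn_of_tmul (f := lslice ε ∘ₗ H.e₂.symm.toLinearMap ∘ₗ (H.mul.flip e).rTensor A ∘ₗ
      H.e₂.toLinearMap) (g := H.mul (S e) ∘ₗ lslice ε) fun a b => by
        simp [← H.dl_e₂, hε.lslice_e₂_symm_dl, hS.e₂]
  have := key (H.e₂.symm (x ⊗ₜ b))
  rw [LinearEquiv.apply_symm_apply, ← hS.e₂] at this
  rw [H.mul_assoc, ← this, hS.e₂]
  rfl

/-- `Σ S(a₁d)a₂ = ε(a)S(d)`. -/
theorem mu_rTensor_e₁ [Nontrivial A] (d a : A) :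
    H.mu (S.toLinearMap.rTensor A (H.e₁ (d ⊗ₜ a))) = ε a • S d := by
  refine H.ext_mul_right fun z => ?_
  have key : ∀ t : A ⊗[ℂ] A, H.mul (H.mu (S.toLinearMap.rTensor A t)) z =
      lslice ε (H.e₂.symm ((H.mul.flip z).lTensor A t)) :=
    eqOn_of_tmul (f := H.mul.flip z ∘ₗ H.mu ∘ₗ S.toLinearMap.rTensor A)
      (g := lslice ε ∘ₗ H.e₂.symm.toLinearMap ∘ₗ (H.mul.flip z).lTensor A) fun p q => by
        simp [← hS.e₂, H.mul_assoc]
  rw [key, ← H.dl_e₁, hε.lslice_e₂_symm_dl, ← hS.e₂]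
  simp

/-- `e₃ ∘ (S ⊙ ι) ∘ e₁ = S ⊙ ι`, that is `Σ S(a₁d)a₂ ⊗ a₃ = S(d) ⊗ a`. -/
theorem e₃_rTensor_e₁ [Nontrivial A] (u : A ⊗[ℂ] A) :
    H.e₃ (S.toLinearMap.rTensor A (H.e₁ u)) = S.toLinearMap.rTensor A u := by
  refine eqOn_of_tmul (f := H.e₃.toLinearMap ∘ₗ S.toLinearMap.rTensor A ∘ₗ
    H.e₁.toLinearMap) (g := S.toLinearMap.rTensor A) (fun d a => ?_) u
  refine H.ext_lTensor_flip fun b => ext_rslice fun f => ?_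
  have key : ∀ t : A ⊗[ℂ] A, rslice f ((H.mul.flip b).lTensor A (H.e₃
      (S.toLinearMap.rTensor A t))) =
      H.mu (S.toLinearMap.rTensor A ((rco H.e₂ f b).lTensor A t)) :=
    eqOn_of_tmul (f := rslice f ∘ₗ (H.mul.flip b).lTensor A ∘ₗ H.e₃.toLinearMap ∘ₗ
      S.toLinearMap.rTensor A)
      (g := H.mu ∘ₗ S.toLinearMap.rTensor A ∘ₗ (rco H.e₂ f b).lTensor A) fun p q => by
        simp [H.e₃_e₂, rco_apply]
  simp only [LinearMap.comp_apply, LinearEquiv.coe_coe]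
  rw [key, ← H.coassoc₁₂.lTensor_rco]
  simp [hS.mu_rTensor_e₁ hε, rco_apply, apply_rslice, hε.e₂]

/-- The antipode reverses the comultiplication. -/
theorem map_e₂ [Nontrivial A] (hφ : H.IsLeftHaar φ) (a b : A) :
    TensorProduct.map S.toLinearMap S.toLinearMap (H.e₂ (a ⊗ₜ b)) =
      TensorProduct.comm ℂ A A (H.e₃ (S b ⊗ₜ S a)) := by
  obtain ⟨u, rfl⟩ := exists_rslice H.e₂ hφ.ne_zero a
  refine eqOn_of_tmul (f := TensorProduct.map S.toLinearMap S.toLinearMap ∘ₗ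
    H.e₂.toLinearMap ∘ₗ (TensorProduct.mk ℂ A A).flip b ∘ₗ rslice φ ∘ₗ H.e₂.toLinearMap)
    (g := (TensorProduct.comm ℂ A A).toLinearMap ∘ₗ H.e₃.toLinearMap ∘ₗ
      TensorProduct.mk ℂ A A (S b) ∘ₗ S.toLinearMap ∘ₗ rslice φ ∘ₗ H.e₂.toLinearMap)
    (fun c y => ?_) u
  have h1 := e₂_rco_e₂ hφ c b y
  have h2 : H.e₃ (S b ⊗ₜ rco H.e₄ φ c y) = (rco H.e₄ φ c).lTensor A (H.e₃ (S b ⊗ₜ y)) := by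
    rw [← H.coassoc₃₄.lTensor_rco]; simp
  have h3 : H.e₃ (S b ⊗ₜ y) = S.toLinearMap.rTensor A (H.e₁.symm (b ⊗ₜ y)) := by
    rw [← hS.e₃_rTensor_e₁ hε]; simp
  have h4 : ∀ w : A ⊗[ℂ] A, TensorProduct.map S.toLinearMap S.toLinearMap
      (TensorProduct.comm ℂ A A ((rslice φ ∘ₗ H.e₂.toLinearMap ∘ₗ
        TensorProduct.mk ℂ A A c).lTensor A w)) =
      TensorProduct.comm ℂ A A ((rco H.e₄ φ c).lTensor A (S.toLinearMap.rTensor A w)) :=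
    eqOn_of_tmul (f := TensorProduct.map S.toLinearMap S.toLinearMap ∘ₗ
      (TensorProduct.comm ℂ A A).toLinearMap ∘ₗ (rslice φ ∘ₗ H.e₂.toLinearMap ∘ₗ
        TensorProduct.mk ℂ A A c).lTensor A)
      (g := (TensorProduct.comm ℂ A A).toLinearMap ∘ₗ (rco H.e₄ φ c).lTensor A ∘ₗ
        S.toLinearMap.rTensor A) fun p q => by
        simp [← hS.rco_e₂ hε hφ]
        rfl
  simp only [LinearMap.comp_apply, LinearEquiv.coe_coe, LinearMap.flip_apply,
    TensorProduct.mk_apply]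
  change TensorProduct.map S.toLinearMap S.toLinearMap (H.e₂ (rco H.e₂ φ y c ⊗ₜ b)) =
    TensorProduct.comm ℂ A A (H.e₃ (S b ⊗ₜ S (rco H.e₂ φ y c)))
  rw [hS.rco_e₂ hε hφ, h1, h2, h3, h4]

/-- `φ ∘ S` is right invariant. -/
theorem isLeftHaar_cop [Nontrivial A] (hφ : H.IsLeftHaar φ) :
    H.cop.IsLeftHaar (φ ∘ₗ S.toLinearMap) := by
  have h2 : ∀ a b, lslice (φ ∘ₗ S.toLinearMap) (H.e₂ (a ⊗ₜ b)) = φ (S a) • b := fun a b => by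
    apply S.injective
    have h := congrArg (lslice φ) (hS.map_e₂ hε hφ a b)
    rw [lslice_map, lslice_comm, hφ.e₃] at h
    rw [map_smul]
    exact h
  refine ⟨fun h => hφ.ne_zero (LinearMap.ext fun x => ?_), fun a b => ?_, fun a b => ?_⟩
  · simpa using DFunLike.congr_fun h (S.symm x)
  · simpa [MultHopf.cop] using h2 a b
  · simp only [MultHopf.cop, flipConj_tmul, rslice_comm]
    refine H.ext_mul_right fun c => ?_
    rw [← LinearMap.flip_apply, ← lslice_lTensor, ← H.e₂_e₄, lslice_lTensor, h2]
    simp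

end IsAntipode

end MultHopf

/-! ### Faithfulness, local units and uniqueness of Haar functionals -/

namespace MultHopf

variable {A : Type*} [AddCommGroup A] [Module ℂ A] {H : MultHopf A}
  {ε φ ψ : Module.Dual ℂ A} {S : A ≃ₗ[ℂ] A}

theorem mu_surjective [Nontrivial A] (hε : H.IsCounit ε) : Function.Surjective H.mu := fun x => by
  obtain ⟨u, hu⟩ := exists_lslice H.e₂ hε.ne_zero x
  exact ⟨u, by rw [← hε.lslice_e₂, hu]⟩

/-- The left Haar functional is faithful. If `φ(Aa) = 0`, invariance gives `Δ(a)(e ⊗ 1) ∈ A ⊙ N`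
with `N = {n | φ(An) = 0}`; applying `x ⊗ n ↦ φ(dS(x)n)` shows that the counit vanishes on `N`, and
applying the counit to the second leg that `ae = 0`. -/
theorem eq_zero_of_haar_mul_left [Nontrivial A] (hε : H.IsCounit ε) (hS : H.IsAntipode ε S)
    (hφ : H.IsLeftHaar φ) {a : A} (ha : ∀ b, φ (H.mul b a) = 0) : a = 0 := by
  have h0 : ∀ a, (∀ b, φ (H.mul b a) = 0) → ∀ e, H.e₁ (e ⊗ₜ a) ∈
      Submodule.span ℂ {z : A ⊗[ℂ] A | ∃ x n, (∀ b, (φ ∘ₗ H.mul b) n = 0) ∧ z = x ⊗ₜ n} := by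
    intro a ha e
    refine mem_span_of_rslice_eq_zero (fun b => φ ∘ₗ H.mul b) _ fun b => ?_
    rw [← rslice_lTensor, H.e₁_e₄, rslice_rTensor]
    have h1 : ∀ u : A ⊗[ℂ] A, rslice φ (H.dr a (H.e₃ u)) = 0 := fun u =>
      eqOn_of_tmul (f := rslice φ ∘ₗ H.dr a ∘ₗ H.e₃.toLinearMap) (g := 0)
        (fun p q => by simp [← H.e₃_mul, hφ.e₃, ha]) u
    have h2 : rslice φ (H.e₄ (a ⊗ₜ b)) = 0 := H.eq_zero_of_mul_left _ fun d => by
      rw [← rslice_rTensor, ← H.dr_e₄, ← LinearEquiv.apply_symm_apply H.e₃ (d ⊗ₜ b), h1]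
    rw [h2, map_zero]
  have hεN : ∀ a, (∀ b, φ (H.mul b a) = 0) → ε a = 0 := by
    intro a ha
    by_contra hne
    have h1 : ∀ d e, φ (H.mul d (H.mu (S.toLinearMap.rTensor A (H.e₁ (e ⊗ₜ a))))) = 0 := by
      intro d e
      refine Submodule.span_induction (p := fun t _ =>
        φ (H.mul d (H.mu (S.toLinearMap.rTensor A t))) = 0) ?_ (by simp)
        (fun x y _ _ hx hy => by simp [hx, hy]) (fun r x _ hx => by simp [hx]) (h0 a ha e)
      rintro _ ⟨x, n, hn, rfl⟩
      simpa [H.mul_assoc] using hn (H.mul d (S x))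
    refine hφ.ne_zero (LinearMap.ext fun x => ?_)
    obtain ⟨u, rfl⟩ := mu_surjective hε x
    refine eqOn_of_tmul (f := φ ∘ₗ H.mu) (g := 0) (fun d e => ?_) u
    have := h1 d (S.symm e)
    rw [hS.mu_rTensor_e₁ hε] at this
    simpa [hne] using this
  refine H.eq_zero_of_mul_right a fun e => ?_
  rw [← hε.e₁]
  refine Submodule.span_induction (p := fun t _ => rslice ε t = 0) ?_ (by simp)
        (fun x y _ _ hx hy => by simp [hx, hy]) (fun r x _ hx => by simp [hx]) (h0 a ha e)
  rintro _ ⟨x, n, hn, rfl⟩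
  simp [hεN n hn]

theorem e₃_rTensor_mul (H : MultHopf A) (d : A) (t : A ⊗[ℂ] A) :
    H.e₃ ((H.mul d).rTensor A t) = (H.mul d).rTensor A (H.e₃ t) := by
  refine eqOn_of_tmul (f := H.e₃.toLinearMap ∘ₗ (H.mul d).rTensor A)
    (g := (H.mul d).rTensor A ∘ₗ H.e₃.toLinearMap) (fun p a => H.ext_lTensor fun y => ?_) t
  have h2 : H.mul (H.mul d p) = H.mul d ∘ₗ H.mul p := LinearMap.ext fun z => H.mul_assoc _ _ _
  simp only [LinearMap.comp_apply, LinearEquiv.coe_coe, LinearMap.rTensor_tmul]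
  rw [lTensor_rTensor_comm, ← H.dr_e₃, ← H.dr_e₃, H.dr_e₄, H.dr_e₄, h2, LinearMap.rTensor_comp]
  rfl

theorem e₃_symm_rTensor_mul (H : MultHopf A) (d : A) (t : A ⊗[ℂ] A) :
    H.e₃.symm ((H.mul d).rTensor A t) = (H.mul d).rTensor A (H.e₃.symm t) := by
  rw [LinearEquiv.symm_apply_eq, e₃_rTensor_mul]; simp

theorem IsCounit.lslice_e₃ [Nontrivial A] (hε : H.IsCounit ε) (u : A ⊗[ℂ] A) :
    lslice ε (H.e₃ u) = lslice ε u := by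
  refine eqOn_of_tmul (f := lslice ε ∘ₗ H.e₃.toLinearMap) (g := lslice ε)
    (fun f g => H.ext_mul_right fun b => ?_) u
  have h : ε ∘ₗ H.mul f = ε f • ε := LinearMap.ext fun z => by simp [hε.map_mul]
  have h' : ∀ t : A ⊗[ℂ] A, lslice (ε f • ε) t = ε f • lslice ε t :=
    fun t => by
    rw [lslice, LinearMap.rTensor_smul, LinearMap.comp_smul]
    rfl
  simp only [LinearMap.comp_apply, LinearEquiv.coe_coe]
  rw [← LinearMap.flip_apply, ← lslice_lTensor, H.e₃_e₂, lslice_rTensor, h, h', hε.e₂]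
  simp

/-- Local left units, for the product `p ⊗ q ↦ (φ ⊙ ι)(T⁻¹(p ⊗ q))`, `T(f ⊗ g) = (f ⊗ 1)Δ(g)`,
which is the convolution product of the functionals `φ(p ·)` and `φ(q ·)`. If there were none for
`q₁, …, qₙ`, a family of functionals `fᵢ` would separate `(qᵢ)` from the products; by
faithfulness `Σ (ι ⊙ fᵢ)(T⁻¹(p ⊗ qᵢ)) = 0`, and the counit gives `Σ fᵢ(qᵢ) = 0`. -/
theorem exists_local_unit [Nontrivial A] (hε : H.IsCounit ε) (hS : H.IsAntipode ε S)
    (hφ : H.IsLeftHaar φ) {ι : Type*} [Finite ι] (q : ι → A) :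
    ∃ p, ∀ i, lslice φ (H.e₃.symm (p ⊗ₜ q i)) = q i := by
  classical
  cases nonempty_fintype ι
  let M : A →ₗ[ℂ] (ι → A) := LinearMap.pi fun i =>
    lslice φ ∘ₗ H.e₃.symm.toLinearMap ∘ₗ (TensorProduct.mk ℂ A A).flip (q i)
  by_contra! hno
  have hq : q ∉ LinearMap.range M := by
    rintro ⟨p, hp⟩
    obtain ⟨i, hi⟩ := hno p
    exact hi (congrFun hp i)
  obtain ⟨f, hfq, hf⟩ := Submodule.exists_le_ker_of_notMem hq
  let F : ι → Module.Dual ℂ A := fun i => f ∘ₗ LinearMap.single ℂ (fun _ => A) i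
  have hF : ∀ g : ι → A, f g = ∑ i, F i (g i) := fun g => by
    rw [← LinearMap.sum_single_apply (fun _ => A) g, map_sum]
    simp [F]
  let w : A → A := fun p => ∑ i, rslice (F i) (H.e₃.symm (p ⊗ₜ q i))
  have hw : ∀ d p, H.mul d (w p) = w (H.mul d p) := fun d p => by
    simp only [w, map_sum]
    refine Finset.sum_congr rfl fun i _ => ?_
    rw [← rslice_rTensor, ← e₃_symm_rTensor_mul, LinearMap.rTensor_tmul]
  have hφw : ∀ p, φ (w p) = 0 := fun p => by
    have : f (M p) = 0 := hf ⟨p, rfl⟩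
    rw [hF] at this
    rw [← this, map_sum]
    exact Finset.sum_congr rfl fun i _ => apply_rslice _ _ _
  have hw0 : ∀ p, w p = 0 := fun p =>
    eq_zero_of_haar_mul_left hε hS hφ fun d => by rw [hw, hφw]
  obtain ⟨p, hp⟩ : ∃ p, ε p ≠ 0 := by
    by_contra! h
    exact hε.ne_zero (LinearMap.ext h)
  have hεw : ε (w p) = ε p • f q := by
    rw [hF, map_sum, Finset.smul_sum]
    refine Finset.sum_congr rfl fun i _ => ?_
    rw [apply_rslice, ← hε.lslice_e₃]
    simp
  rw [hw0, map_zero, eq_comm, smul_eq_zero] at hεw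
  exact hεw.elim hp hfq

/-- If all `(ι ⊙ θ)Δ(x)` belong to `A`, then the product of `θ` with `φ(a ·)` is again of the form
`φ(c ·)`, with `c = S⁻¹((ι ⊙ θ)Δ(S(a)))`. -/
theorem exists_haar_of_smooth [Nontrivial A] (hε : H.IsCounit ε) (hS : H.IsAntipode ε S)
    (hφ : H.IsLeftHaar φ) (θ : Module.Dual ℂ A)
    (hθ : ∀ x, ∃ z, ∀ d, H.mul d z = rslice θ (H.e₃ (d ⊗ₜ x))) (a : A) :
    ∃ c, ∀ x, θ (rslice φ (H.e₄ (x ⊗ₜ a))) = φ (H.mul c x) := by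
  obtain ⟨z, hz⟩ := hθ (S a)
  refine ⟨S.symm z, fun x => ?_⟩
  have h1 := congrArg (lslice θ) (hS.map_e₂ hε hφ a x)
  rw [lslice_comm, ← hz, lslice_map] at h1
  have h2 : lslice (θ ∘ₗ S.toLinearMap) (H.e₂ (a ⊗ₜ x)) = H.mul (S.symm z) x := by
    apply S.injective
    rw [hS.map_mul hε, S.apply_symm_apply]
    exact h1
  rw [← rco_apply, ← hS.rco_e₂ hε hφ, rco_apply, ← h2, ← apply_rslice]
  rfl

/-- `(ι ⊙ φ)((1 ⊗ b)Δ(y)) a = Σ φ(cᵢy) S(kᵢ)` with `Σ kᵢ ⊗ cᵢ = (S⁻¹(a) ⊗ 1)Δ(b)`. -/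
theorem rslice_e₄_mul [Nontrivial A] (hε : H.IsCounit ε) (hS : H.IsAntipode ε S)
    (hφ : H.IsLeftHaar φ) (a b y : A) :
    H.mul (rslice φ (H.e₄ (y ⊗ₜ b))) a =
      S (rslice φ ((H.mul.flip y).lTensor A (H.e₃ (S.symm a ⊗ₜ b)))) := by
  rw [H.e₃_e₂, rslice_rTensor, hS.map_mul hε, ← rco_apply, ← rco_apply, hS.rco_e₂ hε hφ,
    S.apply_symm_apply]

/-- `a (ψ ⊙ ι)(Δ(y)(b ⊗ 1)) = Σ ψ(ykᵢ) S(cᵢ)` with `Σ kᵢ ⊗ cᵢ = Δ(b)(1 ⊗ S⁻¹(a))`. -/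
theorem mul_lslice_e₁ [Nontrivial A] (hε : H.IsCounit ε) (hS : H.IsAntipode ε S)
    (hψ : H.cop.IsLeftHaar ψ) (a b y : A) :
    H.mul a (lslice ψ (H.e₁ (b ⊗ₜ y))) =
      S (lslice ψ ((H.mul y).rTensor A (H.e₂ (b ⊗ₜ S.symm a)))) := by
  have h := rslice_e₄_mul hε.cop.op hS.cop.op hψ.op a b y
  simp only [MultHopf.op, MultHopf.cop, flipConj_tmul, rslice_comm, ← comm_rTensor] at h
  exact h

/-- A form of the uniqueness of Haar functionals: the functionals `φ(c ·)` are among the `ψ(c' ·)`,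
for a left Haar functional `φ` and a right Haar functional `ψ`. Let `t = (d ⊗ 1)Δ(c)` with
`ψ(d) ≠ 0`, and write `t = Σ (1 ⊗ bᵢ)Δ(aᵢ)`. By invariance, `(ψ ⊙ φ)(tΔ(x))` is
`ψ(d)φ(cx)` on the one hand and `Σ φ(bᵢ)ψ(aᵢx)` on the other hand. -/
theorem exists_haar_mul_left_eq (hφ : H.IsLeftHaar φ) (hψ : H.cop.IsLeftHaar ψ) (c : A) :
    ∃ c', ∀ x, φ (H.mul c x) = ψ (H.mul c' x) := by
  obtain ⟨d, hd⟩ : ∃ d, ψ d ≠ 0 := by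
    by_contra! h
    exact hψ.ne_zero (LinearMap.ext h)
  have h3 : ∀ x (u : A ⊗[ℂ] A), ψ (rslice φ (H.dr x (H.e₃ u))) =
      ψ (rslice φ ((H.mul.flip x).lTensor A u)) := fun x =>
    eqOn_of_tmul (f := ψ ∘ₗ rslice φ ∘ₗ H.dr x ∘ₗ H.e₃.toLinearMap)
      (g := ψ ∘ₗ rslice φ ∘ₗ (H.mul.flip x).lTensor A) fun p q => by
        simp [← H.e₃_mul, hφ.e₃]
  have hψ4 : ∀ a b, lslice ψ (H.e₄ (a ⊗ₜ b)) = ψ a • b := fun a b => by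
    simpa [MultHopf.cop] using hψ.e₃ a b
  have h4 : ∀ x (u : A ⊗[ℂ] A), ψ (rslice φ (H.dr x (H.e₄ u))) =
      ψ (H.mul.flip x (rslice φ u)) := fun x =>
    eqOn_of_tmul (f := ψ ∘ₗ rslice φ ∘ₗ H.dr x ∘ₗ H.e₄.toLinearMap)
      (g := ψ ∘ₗ H.mul.flip x ∘ₗ rslice φ) fun p q => by
        simp [← H.e₄_mul, apply_rslice, hψ4, mul_comm]
  refine ⟨(ψ d)⁻¹ • rslice φ (H.e₄.symm (H.e₃ (d ⊗ₜ c))), fun x => ?_⟩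
  have := h4 x (H.e₄.symm (H.e₃ (d ⊗ₜ c)))
  rw [LinearEquiv.apply_symm_apply, h3] at this
  simp only [LinearMap.lTensor_tmul, rslice_tmul, map_smul, LinearMap.flip_apply] at this
  rw [map_smul, LinearMap.smul_apply, map_smul, ← this, smul_eq_mul, smul_eq_mul]
  field_simp

/-- The functionals `φ(c ·)` are among the `ψ(· c')`, for a left Haar functional `φ` and a right
Haar functional `ψ`: evaluate `(ψ ⊙ φ)((1 ⊗ a)Δ(x)(b ⊗ 1))` by `rslice_e₄_mul` and by
`mul_lslice_e₁`. -/
theorem exists_haar_mul_right_eq [Nontrivial A] (hε : H.IsCounit ε) (hS : H.IsAntipode ε S)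
    (hφ : H.IsLeftHaar φ) (hψ : H.cop.IsLeftHaar ψ) (c : A) :
    ∃ c', ∀ x, φ (H.mul c x) = ψ (H.mul x c') := by
  obtain ⟨d, hd⟩ : ∃ d, ψ d ≠ 0 := by
    by_contra! h
    exact hψ.ne_zero (LinearMap.ext h)
  have key : ∀ x (u : A ⊗[ℂ] A),
      ψ (S (rslice φ ((H.mul.flip x).lTensor A (H.e₃ u)))) =
      ψ (H.mul x (rslice (φ ∘ₗ S.toLinearMap)
        (H.e₂ (TensorProduct.map S.toLinearMap S.symm.toLinearMap u)))) := fun x =>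
    eqOn_of_tmul (f := ψ ∘ₗ S.toLinearMap ∘ₗ rslice φ ∘ₗ (H.mul.flip x).lTensor A ∘ₗ
      H.e₃.toLinearMap)
      (g := ψ ∘ₗ H.mul x ∘ₗ rslice (φ ∘ₗ S.toLinearMap) ∘ₗ H.e₂.toLinearMap ∘ₗ
        TensorProduct.map S.toLinearMap S.symm.toLinearMap) fun p a => by
      have h1 := rslice_e₄_mul hε hS hφ (S p) a x
      rw [S.symm_apply_apply] at h1
      simp only [LinearMap.comp_apply, LinearEquiv.coe_coe, TensorProduct.map_tmul]
      rw [← h1, ← LinearMap.flip_apply, ← rslice_rTensor, ← H.e₁_e₄, apply_rslice, lslice_lTensor,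
        mul_lslice_e₁ hε hS hψ, ← rslice_rTensor, apply_rslice]
      rfl
  refine ⟨(ψ d)⁻¹ • rslice (φ ∘ₗ S.toLinearMap) (H.e₂ (TensorProduct.map S.toLinearMap
    S.symm.toLinearMap (H.e₃.symm (S.symm d ⊗ₜ c)))), fun x => ?_⟩
  rw [map_smul, map_smul, ← key]
  simp [field]

theorem IsLeftHaar.cop_cop (hφ : H.IsLeftHaar φ) : H.cop.cop.IsLeftHaar φ :=
  ⟨hφ.ne_zero, fun a b => by simpa [MultHopf.cop] using hφ.e₁ a b,
    fun a b => by simpa [MultHopf.cop] using hφ.e₃ a b⟩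

/-- The slice of `Δ(x)` by `φ(a ·)` depends on the functional only. -/
theorem lslice_e₃_congr (H : MultHopf A) {a a' : A} (h : ∀ x, φ (H.mul a x) = ψ (H.mul a' x))
    (x : A) : lslice φ (H.e₃ (a ⊗ₜ x)) = lslice ψ (H.e₃ (a' ⊗ₜ x)) := by
  have h' : φ ∘ₗ H.mul a = ψ ∘ₗ H.mul a' := LinearMap.ext h
  refine H.ext_mul_right fun b => ?_
  have key : ∀ (χ : Module.Dual ℂ A) (c : A), H.mul (lslice χ (H.e₃ (c ⊗ₜ x))) b =
      lslice (χ ∘ₗ H.mul c) (H.e₂ (x ⊗ₜ b)) := fun χ c => by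
    rw [← LinearMap.flip_apply, ← lslice_lTensor, H.e₃_e₂, lslice_rTensor]
  rw [key, key, h']

end MultHopf

/-! ### The canonical maps of an algebraic quantum group -/

section Transfer

variable {A : Type*} [NonUnitalRing A] [Module ℂ A] [IsScalarTower ℂ A A] [SMulCommClass ℂ A A]

theorem rTensor_mulLeft (c : A) (t : A ⊗[ℂ] A) :
    (LinearMap.mul ℂ A c).rTensor A t = (tens (emb A c) (1 : Mult A)).lact t :=
  eqOn_of_tmul (f := (LinearMap.mul ℂ A c).rTensor A)
    (g := (tens (emb A c) (1 : Mult A)).lact) (fun _ _ => rfl) t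

theorem lTensor_mulLeft (c : A) (t : A ⊗[ℂ] A) :
    (LinearMap.mul ℂ A c).lTensor A t = (tens (1 : Mult A) (emb A c)).lact t :=
  eqOn_of_tmul (f := (LinearMap.mul ℂ A c).lTensor A)
    (g := (tens (1 : Mult A) (emb A c)).lact) (fun _ _ => rfl) t

theorem rTensor_mulRight (c : A) (t : A ⊗[ℂ] A) :
    ((LinearMap.mul ℂ A).flip c).rTensor A t = (tens (emb A c) (1 : Mult A)).ract t :=
  eqOn_of_tmul (f := ((LinearMap.mul ℂ A).flip c).rTensor A)
    (g := (tens (emb A c) (1 : Mult A)).ract) (fun _ _ => rfl) t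

theorem lTensor_mulRight (c : A) (t : A ⊗[ℂ] A) :
    ((LinearMap.mul ℂ A).flip c).lTensor A t = (tens (1 : Mult A) (emb A c)).ract t :=
  eqOn_of_tmul (f := ((LinearMap.mul ℂ A).flip c).lTensor A)
    (g := (tens (1 : Mult A) (emb A c)).ract) (fun _ _ => rfl) t

/-- Coassociativity passes from `a ⊗ c ↦ (1 ⊗ c)Δ(a)` to `a ⊗ b ↦ Δ(a)(1 ⊗ b)`. -/
theorem CoefCommute.right_of_rel (hA : NondegAlg A) {e e₂ e₄ : A ⊗[ℂ] A ≃ₗ[ℂ] A ⊗[ℂ] A}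
    (h : CoefCommute e e₄)
    (hrel : ∀ a b c, (LinearMap.mul ℂ A c).lTensor A (e₂ (a ⊗ₜ b)) =
      ((LinearMap.mul ℂ A).flip b).lTensor A (e₄ (a ⊗ₜ c))) : CoefCommute e e₂ := by
  intro f c g b z
  have : e₂ (lco e f c z ⊗ₜ b) = (lco e f c).rTensor A (e₂ (z ⊗ₜ b)) := by
    refine ext_lslice fun k => ?_
    rw [← sub_eq_zero]
    refine (hA _).2 fun d => ?_
    change LinearMap.mul ℂ A d _ = 0
    rw [map_sub, ← lslice_lTensor, ← lslice_lTensor, hrel, lTensor_rTensor_comm, hrel,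
      ← lTensor_rTensor_comm, ← h.rTensor_lco]
    simp
  rw [rco_apply e₂ g b (lco e f c z), this]
  simp [rco_apply]

/-- Coassociativity passes from `c ⊗ a ↦ (c ⊗ 1)Δ(a)` to `b ⊗ a ↦ Δ(a)(b ⊗ 1)`. -/
theorem CoefCommute.left_of_rel (hA : NondegAlg A) {e e₁ e₃ : A ⊗[ℂ] A ≃ₗ[ℂ] A ⊗[ℂ] A}
    (h : CoefCommute e₃ e)
    (hrel : ∀ a b c, (LinearMap.mul ℂ A c).rTensor A (e₁ (b ⊗ₜ a)) =
      ((LinearMap.mul ℂ A).flip b).rTensor A (e₃ (c ⊗ₜ a))) : CoefCommute e₁ e := by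
  intro f c g b z
  have : e₁ (c ⊗ₜ rco e g b z) = (rco e g b).lTensor A (e₁ (c ⊗ₜ z)) := by
    refine ext_rslice fun k => ?_
    rw [← sub_eq_zero]
    refine (hA _).2 fun d => ?_
    change LinearMap.mul ℂ A d _ = 0
    rw [map_sub, ← rslice_rTensor, ← rslice_rTensor, hrel, ← lTensor_rTensor_comm, hrel,
      lTensor_rTensor_comm, ← h.lTensor_rco]
    simp
  rw [lco_apply e₁ f c (rco e g b z), this]
  simp [lco_apply]

namespace AlgebraicQuantumGroup

variable (G : AlgebraicQuantumGroup A)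

/-- A canonical map with values in `A ⊙ A`, as an automorphism of the vector space `A ⊙ A`. -/
def equivOfBijOn (T : A ⊗[ℂ] A →ₗ[ℂ] Mult (A ⊗[ℂ] A))
    (h : Set.BijOn T Set.univ (Set.range (emb (A ⊗[ℂ] A)))) : A ⊗[ℂ] A ≃ₗ[ℂ] A ⊗[ℂ] A :=
  LinearEquiv.ofBijective (toAlg ∘ₗ T) (by
    constructor
    · intro u v huv
      refine h.injOn (Set.mem_univ u) (Set.mem_univ v) ?_
      rw [← G.emb_toAlg (h.mapsTo (Set.mem_univ u)), ← G.emb_toAlg (h.mapsTo (Set.mem_univ v))]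
      exact congrArg _ huv
    · intro t
      obtain ⟨u, -, hu⟩ := h.surjOn (Set.mem_range_self t)
      exact ⟨u, by rw [LinearMap.comp_apply, hu, toAlg_emb G.nondeg₂]⟩)

/-- `b ⊗ a ↦ Δ(a)(b ⊗ 1)` -/
def can₁ : A ⊗[ℂ] A ≃ₗ[ℂ] A ⊗[ℂ] A :=
  TensorProduct.comm ℂ A A ≪≫ₗ G.equivOfBijOn (T₁ G.comulₗ) G.regular.bij₁

/-- `a ⊗ b ↦ Δ(a)(1 ⊗ b)` -/
def can₂ : A ⊗[ℂ] A ≃ₗ[ℂ] A ⊗[ℂ] A := G.equivOfBijOn (T₂ G.comulₗ) G.regular.bij₂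

/-- `b ⊗ a ↦ (b ⊗ 1)Δ(a)` -/
def can₃ : A ⊗[ℂ] A ≃ₗ[ℂ] A ⊗[ℂ] A :=
  TensorProduct.comm ℂ A A ≪≫ₗ G.equivOfBijOn (T₃ G.comulₗ) G.regular.bij₃

/-- `a ⊗ b ↦ (1 ⊗ b)Δ(a)` -/
def can₄ : A ⊗[ℂ] A ≃ₗ[ℂ] A ⊗[ℂ] A := G.equivOfBijOn (T₄ G.comulₗ) G.regular.bij₄

theorem emb_can₁ (b a : A) : emb (A ⊗[ℂ] A) (G.can₁ (b ⊗ₜ a)) = G.comulₗ a * tens (emb A b) 1 :=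
  G.emb_T₁ (a ⊗ₜ b)

theorem emb_can₂ (a b : A) : emb (A ⊗[ℂ] A) (G.can₂ (a ⊗ₜ b)) = G.comulₗ a * tens 1 (emb A b) :=
  G.emb_T₂ (a ⊗ₜ b)

theorem emb_can₃ (b a : A) : emb (A ⊗[ℂ] A) (G.can₃ (b ⊗ₜ a)) = tens (emb A b) 1 * G.comulₗ a :=
  G.emb_T₃ (a ⊗ₜ b)

theorem emb_can₄ (a b : A) : emb (A ⊗[ℂ] A) (G.can₄ (a ⊗ₜ b)) = tens 1 (emb A b) * G.comulₗ a :=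
  G.emb_T₄ (a ⊗ₜ b)

theorem tens_emb_one_mul (a b : A) : tens (emb A a) (1 : Mult A) * tens (1 : Mult A) (emb A b) =
    emb (A ⊗[ℂ] A) (a ⊗ₜ b) := by
  rw [tens_mul_tens, mul_one, one_mul, tens_emb_emb]

theorem tens_one_emb_mul (a b : A) : tens (1 : Mult A) (emb A b) * tens (emb A a) (1 : Mult A) =
    emb (A ⊗[ℂ] A) (a ⊗ₜ b) := by
  rw [tens_mul_tens, mul_one, one_mul, tens_emb_emb]

theorem can₁_can₃ (a b c : A) : (LinearMap.mul ℂ A c).rTensor A (G.can₁ (b ⊗ₜ a)) =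
    ((LinearMap.mul ℂ A).flip b).rTensor A (G.can₃ (c ⊗ₜ a)) := by
  apply emb_injective G.nondeg₂
  rw [rTensor_mulLeft, rTensor_mulRight, ← mul_emb, ← emb_mul, emb_can₁, emb_can₃, mul_assoc]

theorem can₂_can₄ (a b c : A) : (LinearMap.mul ℂ A c).lTensor A (G.can₂ (a ⊗ₜ b)) =
    ((LinearMap.mul ℂ A).flip b).lTensor A (G.can₄ (a ⊗ₜ c)) := by
  apply emb_injective G.nondeg₂
  rw [lTensor_mulLeft, lTensor_mulRight, ← mul_emb, ← emb_mul, emb_can₂, emb_can₄, mul_assoc]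

theorem comul_ract_can₃ (a x y : A) : (G.comulₗ a).ract (x ⊗ₜ y) =
    (LinearMap.mul ℂ A y).lTensor A (G.can₃ (x ⊗ₜ a)) := by
  apply emb_injective G.nondeg₂
  rw [lTensor_mulLeft, ← mul_emb, ← emb_mul, emb_can₃, ← mul_assoc, tens_one_emb_mul]

theorem comul_ract_can₄ (a x y : A) : (G.comulₗ a).ract (x ⊗ₜ y) =
    (LinearMap.mul ℂ A x).rTensor A (G.can₄ (a ⊗ₜ y)) := by
  apply emb_injective G.nondeg₂
  rw [rTensor_mulLeft, ← mul_emb, ← emb_mul, emb_can₄, ← mul_assoc, tens_emb_one_mul]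

/-- The coassociativity law, sliced in the first and the third leg: both sides are slices of
`(c ⊗ e ⊗ a)(Δ ⊙ ι)Δ(x)`. -/
theorem coefCommute_can₃_can₄ : CoefCommute G.can₃ G.can₄ := by
  intro f c g a x
  rw [← sub_eq_zero]
  refine (G.regular.nondeg _).2 fun e => ?_
  change LinearMap.mul ℂ A e _ = 0
  rw [map_sub, sub_eq_zero]
  have h := G.assoc_X x ((c ⊗ₜ e) ⊗ₜ a)
  rw [TensorProduct.assoc_tmul, G.X_ract, G.Y_ract] at h
  have h1 : ∀ t : A ⊗[ℂ] A, rslice g (lslice f (TensorProduct.assoc ℂ A A A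
      ((G.ractL (c ⊗ₜ e)).rTensor A t))) = LinearMap.mul ℂ A e (lco G.can₃ f c (rslice g t)) := by
    have h0 : ∀ (s : A ⊗[ℂ] A) r, rslice g (lslice f (TensorProduct.assoc ℂ A A A (s ⊗ₜ r))) =
        g r • lslice f s := fun s r =>
      eqOn_of_tmul (f := rslice g ∘ₗ lslice f ∘ₗ (TensorProduct.assoc ℂ A A A).toLinearMap ∘ₗ
        (TensorProduct.mk ℂ (A ⊗[ℂ] A) A).flip r) (g := LinearMap.lsmul ℂ A (g r) ∘ₗ lslice f)
        (fun p q => by simp) s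
    exact eqOn_of_tmul (f := rslice g ∘ₗ lslice f ∘ₗ (TensorProduct.assoc ℂ A A A).toLinearMap ∘ₗ
      (G.ractL (c ⊗ₜ e)).rTensor A) (g := LinearMap.mul ℂ A e ∘ₗ lco G.can₃ f c ∘ₗ rslice g)
      fun p r => by
        simp only [LinearMap.comp_apply, LinearEquiv.coe_coe, LinearMap.rTensor_tmul, rslice_tmul,
          map_smul, h0]
        rw [lco_apply, ← lslice_lTensor, ← comul_ract_can₃]
        rfl
  have h2 : ∀ t : A ⊗[ℂ] A, rslice g (lslice f ((G.ractL (e ⊗ₜ a)).lTensor A t)) =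
      LinearMap.mul ℂ A e (rco G.can₄ g a (lslice f t)) :=
    eqOn_of_tmul (f := rslice g ∘ₗ lslice f ∘ₗ (G.ractL (e ⊗ₜ a)).lTensor A)
      (g := LinearMap.mul ℂ A e ∘ₗ rco G.can₄ g a ∘ₗ lslice f) fun p r => by
        simp only [LinearMap.comp_apply, LinearMap.lTensor_tmul, lslice_tmul, map_smul]
        rw [rco_apply, ← rslice_rTensor, ← comul_ract_can₄]
        rfl
  have h3 := congrArg (fun z => rslice g (lslice f z)) h
  simp only [h1, h2] at h3
  exact h3

/-- An algebraic quantum group as a system of linear maps. -/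
def toMultHopf : MultHopf A where
  mul := LinearMap.mul ℂ A
  mul_assoc := mul_assoc
  eq_zero_of_mul_right a := (G.regular.nondeg a).1
  eq_zero_of_mul_left a := (G.regular.nondeg a).2
  e₁ := G.can₁
  e₂ := G.can₂
  e₃ := G.can₃
  e₄ := G.can₄
  dl a := (G.comulₗ a).lact
  dr a := (G.comulₗ a).ract
  dl_e₁ a x y := by
    apply emb_injective G.nondeg₂
    rw [lTensor_mulRight, ← mul_emb, ← emb_mul, emb_can₁, mul_assoc, tens_emb_one_mul]
  dl_e₂ a x y := by
    apply emb_injective G.nondeg₂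
    rw [rTensor_mulRight, ← mul_emb, ← emb_mul, emb_can₂, mul_assoc, tens_one_emb_mul]
  dr_e₃ := G.comul_ract_can₃
  dr_e₄ := G.comul_ract_can₄
  e₁_mul x a b := by
    apply emb_injective G.nondeg₂
    rw [← mul_emb, emb_can₁, emb_can₁, ← mul_assoc, ← comulₗ_mul]; rfl
  e₂_mul a b y := by
    apply emb_injective G.nondeg₂
    rw [← mul_emb, emb_can₂, emb_can₂, ← mul_assoc, ← comulₗ_mul]; rfl
  e₃_mul x a b := by
    apply emb_injective G.nondeg₂
    rw [← emb_mul, emb_can₃, emb_can₃, mul_assoc, ← comulₗ_mul]; rfl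
  e₄_mul a b y := by
    apply emb_injective G.nondeg₂
    rw [← emb_mul, emb_can₄, emb_can₄, mul_assoc, ← comulₗ_mul]; rfl
  e₁_e₃ := G.can₁_can₃
  e₁_e₄ a b c := by
    apply emb_injective G.nondeg₂
    rw [lTensor_mulLeft, rTensor_mulRight, ← mul_emb, ← emb_mul, emb_can₁, emb_can₄, mul_assoc]
  e₃_e₂ a b c := by
    apply emb_injective G.nondeg₂
    rw [lTensor_mulRight, rTensor_mulLeft, ← mul_emb, ← emb_mul, emb_can₂, emb_can₃, mul_assoc]
  e₂_e₄ := G.can₂_can₄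
  coassoc₁₂ := (G.coefCommute_can₃_can₄.left_of_rel G.regular.nondeg G.can₁_can₃).right_of_rel
    G.regular.nondeg G.can₂_can₄
  coassoc₁₄ := G.coefCommute_can₃_can₄.left_of_rel G.regular.nondeg G.can₁_can₃
  coassoc₃₂ := G.coefCommute_can₃_can₄.right_of_rel G.regular.nondeg G.can₂_can₄
  coassoc₃₄ := G.coefCommute_can₃_can₄

theorem isLeftHaar : G.toMultHopf.IsLeftHaar G.haar where
  ne_zero := G.haar_ne_zero
  e₁ a b := congrArg (fun T => T.1 b) (G.left_invariant a)
  e₃ a b := congrArg (fun T => (MulOpposite.unop T.2) b) (G.left_invariant a)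

theorem nontrivial (G : AlgebraicQuantumGroup A) : Nontrivial A := by
  by_contra h
  rw [not_nontrivial_iff_subsingleton] at h
  exact G.haar_ne_zero (LinearMap.ext fun x => by
    rw [Subsingleton.elim x 0, map_zero, map_zero])

theorem exists_hopf (G : AlgebraicQuantumGroup A) :
    ∃ (ε : Module.Dual ℂ A) (S : A ≃ₗ[ℂ] A), G.toMultHopf.IsCounit ε ∧
      G.toMultHopf.IsAntipode ε S := by
  have := G.nontrivial
  obtain ⟨ε, hε⟩ := G.toMultHopf.exists_isCounit
  obtain ⟨S, hS⟩ := MultHopf.exists_isAntipode hε G.isLeftHaar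
  exact ⟨ε, S, hε, hS⟩

end AlgebraicQuantumGroup

end Transfer

/-! ### Multipliers of an algebra of functionals -/

section DualPair

variable {B V : Type*} [NonUnitalRing B] [Module ℂ B] [IsScalarTower ℂ B B] [SMulCommClass ℂ B B]
  [NonUnitalRing V] [Module ℂ V] [IsScalarTower ℂ V V] [SMulCommClass ℂ V V]

/-- `ω ↦ (ι ⊙ ω)Δ(x)` as a linear map. -/
def rightEltₗ (Δ : B →ₗ[ℂ] Mult (B ⊗[ℂ] B)) (x : B) : Module.Dual ℂ B →ₗ[ℂ] B where
  toFun ω := rightElt Δ ω x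
  map_add' ω ω' := by
    have h : ∀ t : B ⊗[ℂ] B, sliceR (ω + ω') t = sliceR ω t + sliceR ω' t := fun t => by
      simp [sliceR]
    rw [rightElt, rightElt, rightElt, LinearMap.comp_apply, LinearMap.comp_apply,
      LinearMap.comp_apply, ← map_add]
    congr 1
    exact Prod.ext (LinearMap.ext fun b => h _)
      (MulOpposite.unop_injective (LinearMap.ext fun b => h _))
  map_smul' r ω := by
    have h : ∀ t : B ⊗[ℂ] B, sliceR (r • ω) t = r • sliceR ω t := fun t => by
      simp [sliceR]
    rw [rightElt, rightElt, LinearMap.comp_apply, LinearMap.comp_apply, ← map_smul]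
    congr 1
    exact Prod.ext (LinearMap.ext fun b => h _)
      (MulOpposite.unop_injective (LinearMap.ext fun b => h _))

/-- `ω ↦ (ω ⊙ ι)Δ(x)` as a linear map. -/
def leftEltₗ (Δ : B →ₗ[ℂ] Mult (B ⊗[ℂ] B)) (x : B) : Module.Dual ℂ B →ₗ[ℂ] B where
  toFun ω := leftElt Δ ω x
  map_add' ω ω' := by
    have h : ∀ t : B ⊗[ℂ] B, sliceL (ω + ω') t = sliceL ω t + sliceL ω' t := fun t => by
      simp [sliceL]
    rw [leftElt, leftElt, leftElt, LinearMap.comp_apply, LinearMap.comp_apply,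
      LinearMap.comp_apply, ← map_add]
    congr 1
    exact Prod.ext (LinearMap.ext fun b => h _)
      (MulOpposite.unop_injective (LinearMap.ext fun b => h _))
  map_smul' r ω := by
    have h : ∀ t : B ⊗[ℂ] B, sliceL (r • ω) t = r • sliceL ω t := fun t => by
      simp [sliceL]
    rw [leftElt, leftElt, LinearMap.comp_apply, LinearMap.comp_apply, ← map_smul]
    congr 1
    exact Prod.ext (LinearMap.ext fun b => h _)
      (MulOpposite.unop_injective (LinearMap.ext fun b => h _))

theorem rightEltₗ_apply (Δ : B →ₗ[ℂ] Mult (B ⊗[ℂ] B)) (x : B) (ω : Module.Dual ℂ B) :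
    rightEltₗ Δ x ω = rightElt Δ ω x := rfl

theorem leftEltₗ_apply (Δ : B →ₗ[ℂ] Mult (B ⊗[ℂ] B)) (x : B) (ω : Module.Dual ℂ B) :
    leftEltₗ Δ x ω = leftElt Δ ω x := rfl

/-- An algebra `V` of functionals on `B` (embedded by `ev`), with the convolution product of
functionals, that has local left units and separates the points of `B`, and for which the elements
`(ι ⊙ ω)Δ(x)` span `B`. -/
structure IsDualPair (Δ : B →ₗ[ℂ] Mult (B ⊗[ℂ] B)) (ev : V →ₗ[ℂ] Module.Dual ℂ B) : Prop where
  ev_injective : Function.Injective ev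
  separates : ∀ x, (∀ v, ev v x = 0) → x = 0
  ev_mul : ∀ v w x, ev (v * w) x = ev v (rightElt Δ (ev w) x)
  ev_mul' : ∀ v w x, ev (v * w) x = ev w (leftElt Δ (ev v) x)
  span_rightElt : Submodule.span ℂ {z | ∃ v x, z = rightElt Δ (ev v) x} = ⊤
  local_unit : ∀ s : Finset V, ∃ e, ∀ v ∈ s, e * v = v

namespace IsDualPair

variable {Δ : B →ₗ[ℂ] Mult (B ⊗[ℂ] B)} {ev : V →ₗ[ℂ] Module.Dual ℂ B} (h : IsDualPair Δ ev)
include h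

theorem ext_ev {v w : V} (hvw : ∀ x, ev v x = ev w x) : v = w :=
  h.ev_injective (LinearMap.ext hvw)

theorem ext_of_ev {x y : B} (hxy : ∀ v, ev v x = ev v y) : x = y := by
  rw [← sub_eq_zero]
  exact h.separates _ fun v => by rw [map_sub, hxy, sub_self]

theorem rightElt_leftElt (v w : V) (x : B) :
    rightElt Δ (ev v) (leftElt Δ (ev w) x) = leftElt Δ (ev w) (rightElt Δ (ev v) x) :=
  h.ext_of_ev fun u => by rw [← h.ev_mul, ← h.ev_mul', ← h.ev_mul', ← h.ev_mul, mul_assoc]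

theorem rightElt_mul (v w : V) (x : B) :
    rightElt Δ (ev (v * w)) x = rightElt Δ (ev v) (rightElt Δ (ev w) x) :=
  h.ext_of_ev fun u => by rw [← h.ev_mul, ← h.ev_mul, ← h.ev_mul, mul_assoc]

theorem leftElt_mul (v w : V) (x : B) :
    leftElt Δ (ev (v * w)) x = leftElt Δ (ev w) (leftElt Δ (ev v) x) :=
  h.ext_of_ev fun u => by rw [← h.ev_mul', ← h.ev_mul', ← h.ev_mul', mul_assoc]

theorem ext_functional {C : Type*} [AddCommGroup C] [Module ℂ C] {θ θ' : B →ₗ[ℂ] C}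
    (hθ : ∀ v x, θ (rightElt Δ (ev v) x) = θ' (rightElt Δ (ev v) x)) : θ = θ' :=
  LinearMap.ext_on h.span_rightElt (by rintro _ ⟨v, x, rfl⟩; exact hθ v x)

theorem implements_unique {T : Mult V} {θ θ' : Module.Dual ℂ B} (hθ : Implements Δ ev T θ)
    (hθ' : Implements Δ ev T θ') : θ = θ' :=
  h.ext_functional fun v x => by
    have h1 := DFunLike.congr_fun (hθ v).1 x
    have h2 := DFunLike.congr_fun (hθ' v).1 x
    exact h1.symm.trans h2

/-- Every multiplier of `V` is given by a functional on `B`. Writing an element of `B` as a sum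
`Σ (ι ⊙ ωᵢ)Δ(xᵢ)`, the value of the functional has to be `Σ (Tωᵢ)(xᵢ)`; this does not depend on
the choices, as it equals `(Te)(Σ (ι ⊙ ωᵢ)Δ(xᵢ))` when `eωᵢ = ωᵢ` for all `i`. -/
theorem exists_implements (T : Mult V) : ∃ θ, Implements Δ ev T θ := by
  classical
  let l : V ⊗[ℂ] B →ₗ[ℂ] B := TensorProduct.lift (LinearMap.mk₂ ℂ
    (fun v x => rightElt Δ (ev v) x)
    (fun v w x => by rw [map_add]; exact map_add (rightEltₗ Δ x) (ev v) (ev w))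
    (fun r v x => by rw [map_smul]; exact map_smul (rightEltₗ Δ x) r (ev v))
    (fun _ _ _ => map_add _ _ _) (fun _ _ _ => map_smul _ _ _))
  let g : V ⊗[ℂ] B →ₗ[ℂ] ℂ := TensorProduct.lift (ev ∘ₗ T.lact)
  have hl : ∀ v x, l (v ⊗ₜ x) = rightElt Δ (ev v) x := fun _ _ => rfl
  have hg : ∀ v x, g (v ⊗ₜ x) = ev (T.lact v) x := fun _ _ => rfl
  have ls : Function.Surjective l := by
    rw [← LinearMap.range_eq_top, eq_top_iff, ← h.span_rightElt, Submodule.span_le]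
    rintro _ ⟨v, x, rfl⟩
    exact ⟨v ⊗ₜ x, rfl⟩
  obtain ⟨θ, hθ⟩ := exists_descend l g ls fun u hu => by
    obtain ⟨s, rfl⟩ := TensorProduct.exists_finset u
    obtain ⟨e, he⟩ := h.local_unit (s.image Prod.fst)
    have : ∀ i ∈ s, g (i.1 ⊗ₜ i.2) = ev (T.lact e) (l (i.1 ⊗ₜ i.2)) := fun i hi => by
      rw [hg, hl, ← h.ev_mul, ← T.lact_mul', he _ (Finset.mem_image_of_mem _ hi)]
    rw [map_sum, Finset.sum_congr rfl this, ← map_sum, ← map_sum, hu, map_zero]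
  have hθ' : ∀ v x, θ (rightElt Δ (ev v) x) = ev (T.lact v) x := fun v x => hθ (v ⊗ₜ x)
  refine ⟨θ, fun v => ⟨LinearMap.ext fun x => (hθ' v x).symm, ?_⟩⟩
  refine h.ext_functional fun w y => ?_
  rw [← h.ev_mul, T.compat, h.ev_mul', LinearMap.comp_apply, ← h.rightElt_leftElt, hθ']

theorem implements_choose (T : Mult V) :
    Implements Δ ev T (h.exists_implements T).choose := (h.exists_implements T).choose_spec

/-- The embedding of the multiplier algebra of `V` into the functionals on `B`. -/
def functional : Mult V →ₗ[ℂ] Module.Dual ℂ B where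
  toFun T := (h.exists_implements T).choose
  map_add' S T := h.implements_unique (h.implements_choose _) fun v => by
    obtain ⟨h1, h2⟩ := h.implements_choose S v
    obtain ⟨k1, k2⟩ := h.implements_choose T v
    exact ⟨by rw [Mult.lact_add, map_add, h1, k1, LinearMap.add_comp],
      by rw [Mult.ract_add, map_add, h2, k2, LinearMap.add_comp]⟩
  map_smul' r T := h.implements_unique (h.implements_choose _) fun v => by
    obtain ⟨h1, h2⟩ := h.implements_choose T v
    exact ⟨by rw [Mult.lact_smul, map_smul, h1, LinearMap.smul_comp]; rfl,
      by rw [Mult.ract_smul, map_smul, h2, LinearMap.smul_comp]; rfl⟩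

theorem implements_functional (T : Mult V) : Implements Δ ev T (h.functional T) :=
  h.implements_choose T

theorem implements_iff (T : Mult V) (θ : Module.Dual ℂ B) :
    Implements Δ ev T θ ↔ θ = h.functional T :=
  ⟨fun hθ => h.implements_unique hθ (h.implements_functional T),
    fun hθ => hθ ▸ h.implements_functional T⟩

theorem functional_rightElt (T : Mult V) (v : V) (x : B) :
    h.functional T (rightElt Δ (ev v) x) = ev (T.lact v) x :=
  (DFunLike.congr_fun (h.implements_functional T v).1 x).symm

theorem functional_leftElt (T : Mult V) (v : V) (x : B) :
    h.functional T (leftElt Δ (ev v) x) = ev (T.ract v) x :=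
  (DFunLike.congr_fun (h.implements_functional T v).2 x).symm

theorem functional_injective : Function.Injective h.functional := fun S T hST =>
  Mult.ext' (fun v => h.ext_ev fun x => by rw [← h.functional_rightElt, hST, h.functional_rightElt])
    (fun v => h.ext_ev fun x => by rw [← h.functional_leftElt, hST, h.functional_leftElt])

/-- A functional whose products with the elements of `V` lie in `V` is given by a multiplier. -/
theorem exists_mult (θ : Module.Dual ℂ B) (hr : ∀ v, ∃ w, ev w = θ ∘ₗ rightElt Δ (ev v))
    (hl : ∀ v, ∃ w, ev w = θ ∘ₗ leftElt Δ (ev v)) : ∃ T, Implements Δ ev T θ := by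
  choose L hL using hr
  choose R hR using hl
  have hL' : ∀ v x, ev (L v) x = θ (rightElt Δ (ev v) x) := fun v x => by rw [hL]; rfl
  have hR' : ∀ v x, ev (R v) x = θ (leftElt Δ (ev v) x) := fun v x => by rw [hR]; rfl
  let L' : V →ₗ[ℂ] V :=
    { toFun := L
      map_add' := fun v w => h.ext_ev fun x => by
        rw [map_add, LinearMap.add_apply, hL', hL', hL', map_add, ← map_add θ]
        exact congrArg θ (map_add (rightEltₗ Δ x) (ev v) (ev w))
      map_smul' := fun r v => h.ext_ev fun x => by
        rw [RingHom.id_apply, map_smul, LinearMap.smul_apply, hL', hL', map_smul, ← map_smul θ]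
        exact congrArg θ (map_smul (rightEltₗ Δ x) r (ev v)) }
  let R' : V →ₗ[ℂ] V :=
    { toFun := R
      map_add' := fun v w => h.ext_ev fun x => by
        rw [map_add, LinearMap.add_apply, hR', hR', hR', map_add, ← map_add θ]
        exact congrArg θ (map_add (leftEltₗ Δ x) (ev v) (ev w))
      map_smul' := fun r v => h.ext_ev fun x => by
        rw [RingHom.id_apply, map_smul, LinearMap.smul_apply, hR', hR', map_smul, ← map_smul θ]
        exact congrArg θ (map_smul (leftEltₗ Δ x) r (ev v)) }
  refine ⟨Mult.mk' L' R' (fun v w => h.ext_ev fun x => ?_) (fun v w => h.ext_ev fun x => ?_)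
    (fun v w => h.ext_ev fun x => ?_), fun v => ⟨hL v, hR v⟩⟩
  · change ev (L (v * w)) x = ev (L v * w) x
    rw [hL', h.rightElt_mul, h.ev_mul, hL']
  · change ev (R (v * w)) x = ev (v * R w) x
    rw [hR', h.leftElt_mul, h.ev_mul', hR']
  · change ev (R v * w) x = ev (v * L w) x
    rw [h.ev_mul, hR', h.ev_mul', hL', h.rightElt_leftElt]

theorem functional_mul_rightElt (S T : Mult V) (v : V) (x : B) :
    h.functional (S * T) (rightElt Δ (ev v) x) =
      h.functional S (rightElt Δ (ev (T.lact v)) x) := by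
  rw [h.functional_rightElt, h.functional_rightElt, Mult.lact_mul]

end IsDualPair

end DualPair

/-! ### Multipliers of fourfold tensor products -/

section TensorSquare

variable {A : Type*} [NonUnitalRing A] [Module ℂ A] [IsScalarTower ℂ A A] [SMulCommClass ℂ A A]

theorem Mult.congr_mul {B : Type*} [NonUnitalRing B] [Module ℂ B] [IsScalarTower ℂ B B]
    [SMulCommClass ℂ B B] (e : A ≃ₗ[ℂ] B) (he : ∀ x y, e (x * y) = e x * e y) (S T : Mult A) :
    Mult.congr e he (S * T) = Mult.congr e he S * Mult.congr e he T :=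
  Mult.ext' (fun x => by simp [Mult.congr, LinearEquiv.conj_apply])
    (fun x => by simp [Mult.congr, LinearEquiv.conj_apply])

theorem Mult.congr_emb {B : Type*} [NonUnitalRing B] [Module ℂ B] [IsScalarTower ℂ B B]
    [SMulCommClass ℂ B B] (e : A ≃ₗ[ℂ] B) (he : ∀ x y, e (x * y) = e x * e y) (a : A) :
    Mult.congr e he (emb A a) = emb B (e a) :=
  Mult.ext' (fun x => by simp [Mult.congr, LinearEquiv.conj_apply, he])
    (fun x => by simp [Mult.congr, LinearEquiv.conj_apply, he])

namespace AlgebraicQuantumGroup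

/-- `ι ⊙ χ ⊙ ι` on the multiplier algebra. -/
def midFlip : Mult ((A ⊗[ℂ] A) ⊗[ℂ] (A ⊗[ℂ] A)) →ₗ[ℂ] Mult ((A ⊗[ℂ] A) ⊗[ℂ] (A ⊗[ℂ] A)) :=
  Mult.congr (TensorProduct.tensorTensorTensorComm ℂ A A A A) tensorTensorTensorComm_mul

theorem midFlip_mul (S T : Mult ((A ⊗[ℂ] A) ⊗[ℂ] (A ⊗[ℂ] A))) :
    midFlip (S * T) = midFlip S * midFlip T := Mult.congr_mul _ _ S T

theorem midFlip_emb (t : (A ⊗[ℂ] A) ⊗[ℂ] (A ⊗[ℂ] A)) :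
    midFlip (emb _ t) = emb _ (TensorProduct.tensorTensorTensorComm ℂ A A A A t) :=
  Mult.congr_emb _ _ t

theorem midFlip_tens (a b c d : Mult A) :
    midFlip (tens (tens a b) (tens c d)) = tens (tens a c) (tens b d) := by
  refine Mult.ext' (fun z => ?_) (fun z => ?_)
  · refine DFunLike.congr_fun (TensorProduct.ext_fourfold'
      (φ := (midFlip (tens (tens a b) (tens c d))).lact)
      (ψ := (tens (tens a c) (tens b d)).lact) fun w x y z => ?_) z
    simp [midFlip, Mult.congr, LinearEquiv.conj_apply]
  · refine DFunLike.congr_fun (TensorProduct.ext_fourfold'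
      (φ := (midFlip (tens (tens a b) (tens c d))).ract)
      (ψ := (tens (tens a c) (tens b d)).ract) fun w x y z => ?_) z
    simp [midFlip, Mult.congr, LinearEquiv.conj_apply]

end AlgebraicQuantumGroup

end TensorSquare

/-! ### The dual algebra and its tensor square as algebras of functionals -/

section DualPairs

variable {A : Type*} [NonUnitalRing A] [Module ℂ A] [IsScalarTower ℂ A A] [SMulCommClass ℂ A A]

namespace AlgebraicQuantumGroup

variable (G : AlgebraicQuantumGroup A)

/-- The map `a ↦ φ(a ·)` onto `Â`. -/
def toHat : A →ₗ[ℂ] G.Hat := G.hatMap.rangeRestrict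

@[simp] theorem toHat_apply (a x : A) : (G.toHat a).1 x = G.haar (a * x) := rfl

theorem toHat_surjective : Function.Surjective G.toHat := LinearMap.surjective_rangeRestrict _

theorem rightElt_toHat (a x : A) : rightElt G.comulₗ (G.toHat a).1 x =
    rslice G.haar (G.can₄ (x ⊗ₜ a)) := G.rightElt_hatMap a x

theorem leftElt_toHat (a x : A) : leftElt G.comulₗ (G.toHat a).1 x =
    lslice G.haar (G.can₃ (a ⊗ₜ x)) := G.leftElt_hatMap a x

theorem rightSlice_hat (v : G.Hat) (x : A) :
    rightSlice G.comulₗ v.1 x = Mult.pair (emb A (rightElt G.comulₗ v.1 x)) := by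
  obtain ⟨_, a, rfl⟩ := v
  rw [rightSlice_hatMap, rightElt_hatMap]

theorem leftSlice_hat (v : G.Hat) (x : A) :
    leftSlice G.comulₗ v.1 x = Mult.pair (emb A (leftElt G.comulₗ v.1 x)) := by
  obtain ⟨_, a, rfl⟩ := v
  rw [leftSlice_hatMap, leftElt_hatMap]

/-- For `ω = φ(a ·)`, the map `x ↦ (ι ⊙ ω)Δ(x)` is a coefficient map, so that coassociativity in the
form of `CoefCommute` applies to it. -/
theorem rightElt_toHat_eq_rco (a : A) :
    rightElt G.comulₗ (G.toHat a).1 = rco G.can₄ G.haar a :=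
  LinearMap.ext fun x => G.rightElt_toHat a x

theorem leftElt_toHat_eq_lco (a : A) :
    leftElt G.comulₗ (G.toHat a).1 = lco G.can₃ G.haar a :=
  LinearMap.ext fun x => G.leftElt_toHat a x

theorem toHat_mul (p q : A) :
    G.toHat p * G.toHat q = G.toHat (lslice G.haar (G.can₃.symm (p ⊗ₜ q))) := by
  refine Subtype.ext (LinearMap.ext fun x => ?_)
  have h1 : ∀ u : A ⊗[ℂ] A, G.haar₂ ((G.comulₗ x).ract (G.can₃ u)) =
      G.haar (lslice G.haar u * x) :=
    eqOn_of_tmul (f := G.haar₂ ∘ₗ (G.comulₗ x).ract ∘ₗ G.can₃.toLinearMap)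
      (g := G.haar ∘ₗ LinearMap.mulRight ℂ x ∘ₗ lslice G.haar) fun f g => by
        have h2 : (G.comulₗ x).ract (G.can₃ (f ⊗ₜ g)) = G.can₃ (f ⊗ₜ (g * x)) :=
          (G.toMultHopf.e₃_mul f g x).symm
        have h3 : sliceR G.haar (G.can₃ (f ⊗ₜ (g * x))) = G.haar (g * x) • f :=
          G.isLeftHaar.e₃ (g * x) f
        simp [h2, haar₂, h3, mul_comm]
  rw [Hat.mul_apply]
  change G.hatMap p (rightElt G.comulₗ (G.hatMap q) x) = _
  rw [hatMap_rightElt, ← LinearEquiv.apply_symm_apply G.can₃ (p ⊗ₜ q), h1]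
  simp

/-- `Â`, as an algebra of functionals on `A`. -/
theorem isDualPair : IsDualPair G.comulₗ G.hat.subtype := by
  have := G.nontrivial
  obtain ⟨ε, S, hε, hS⟩ := G.exists_hopf
  refine ⟨Subtype.val_injective, fun x hx => ?_, fun v w x => G.hatMul_apply v w x,
    fun v w x => G.hatMul_apply' v w x, ?_, fun s => ?_⟩
  · exact MultHopf.eq_zero_of_haar_mul_left hε hS G.isLeftHaar fun b => hx (G.toHat b)
  · rw [eq_top_iff]
    intro x _
    obtain ⟨u, rfl⟩ := exists_rslice G.can₄ G.haar_ne_zero x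
    induction u with
    | zero => simp
    | add u v hu hv => rw [map_add, map_add]; exact Submodule.add_mem _ (hu trivial) (hv trivial)
    | tmul x a => exact Submodule.subset_span ⟨G.toHat a, x, (G.rightElt_toHat a x).symm⟩
  · choose q hq using G.toHat_surjective
    obtain ⟨p, hp⟩ := MultHopf.exists_local_unit hε hS G.isLeftHaar (fun v : s => q v)
    refine ⟨G.toHat p, fun v hv => ?_⟩
    rw [← hq v, toHat_mul]
    exact congrArg G.toHat (hp ⟨v, hv⟩)

theorem span_leftElt :
    Submodule.span ℂ {z | ∃ (v : G.Hat) (x : A), z = leftElt G.comulₗ v.1 x} = ⊤ := by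
  rw [eq_top_iff]
  intro x _
  obtain ⟨u, rfl⟩ := exists_lslice G.can₃ G.haar_ne_zero x
  induction u with
  | zero => simp
  | add u v hu hv => rw [map_add, map_add]; exact Submodule.add_mem _ (hu trivial) (hv trivial)
  | tmul a x => exact Submodule.subset_span ⟨G.toHat a, x, (G.leftElt_toHat a x).symm⟩

theorem span_hat_mul : Submodule.span ℂ {z : G.Hat | ∃ v w, z = v * w} = ⊤ := by
  rw [eq_top_iff]
  intro v _
  obtain ⟨e, he⟩ := G.isDualPair.local_unit {v}
  exact Submodule.subset_span ⟨e, v, (he v (by simp)).symm⟩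

theorem hat₂_tmul (v w : G.Hat) (x y : A) : G.hat₂ (v ⊗ₜ w) (x ⊗ₜ y) = v.1 x * w.1 y := rfl

theorem hat₂_apply (z : G.Hat ⊗[ℂ] G.Hat) (x y : A) : G.hat₂ z (x ⊗ₜ y) =
    (LinearMap.applyₗ x ∘ₗ G.hat.subtype)
      (rslice (LinearMap.applyₗ y ∘ₗ G.hat.subtype) z) := by
  refine eqOn_of_tmul (f := LinearMap.applyₗ (x ⊗ₜ[ℂ] y) ∘ₗ G.hat₂)
    (g := (LinearMap.applyₗ x ∘ₗ G.hat.subtype) ∘ₗ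
      rslice (LinearMap.applyₗ y ∘ₗ G.hat.subtype)) (fun v w => ?_) z
  simp [hat₂_tmul, mul_comm]

theorem hat₂_tmul_apply (v w : G.Hat) (t : A ⊗[ℂ] A) :
    G.hat₂ (v ⊗ₜ w) t = v.1 (rslice w.1 t) :=
  eqOn_of_tmul (f := G.hat₂ (v ⊗ₜ w)) (g := v.1 ∘ₗ rslice w.1) (fun x y => by
    simp [hat₂_tmul, mul_comm]) t

theorem hat₂_injective : Function.Injective G.hat₂ := by
  rw [injective_iff_map_eq_zero]
  intro z hz
  have key : ∀ v : G.Hat, (∀ x, (LinearMap.applyₗ x ∘ₗ G.hat.subtype :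
      Module.Dual ℂ G.Hat) v = 0) → v = 0 := fun v hv => Subtype.ext (LinearMap.ext hv)
  refine eq_zero_of_rslice_eq_zero
    (fun x => (LinearMap.applyₗ x ∘ₗ G.hat.subtype : Module.Dual ℂ G.Hat))
    (fun y => (LinearMap.applyₗ y ∘ₗ G.hat.subtype : Module.Dual ℂ G.Hat))
    key key z fun x y => ?_
  rw [← hat₂_apply, hz]
  rfl

theorem sliceR_tensorTensorTensorComm (ω ω' : Module.Dual ℂ A)
    (t : (A ⊗[ℂ] A) ⊗[ℂ] (A ⊗[ℂ] A)) :
    sliceR (TensorProduct.dualDistrib ℂ A A (ω ⊗ₜ ω'))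
      (TensorProduct.tensorTensorTensorComm ℂ A A A A t) =
    TensorProduct.map (sliceR ω) (sliceR ω') t := by
  refine DFunLike.congr_fun (TensorProduct.ext_fourfold'
    (φ := sliceR (TensorProduct.dualDistrib ℂ A A (ω ⊗ₜ ω')) ∘ₗ
      (TensorProduct.tensorTensorTensorComm ℂ A A A A).toLinearMap)
    (ψ := TensorProduct.map (sliceR ω) (sliceR ω')) fun w x y z => ?_) t
  simp [TensorProduct.smul_tmul', TensorProduct.tmul_smul, smul_smul, mul_comm]

theorem sliceL_tensorTensorTensorComm (ω ω' : Module.Dual ℂ A)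
    (t : (A ⊗[ℂ] A) ⊗[ℂ] (A ⊗[ℂ] A)) :
    sliceL (TensorProduct.dualDistrib ℂ A A (ω ⊗ₜ ω'))
      (TensorProduct.tensorTensorTensorComm ℂ A A A A t) =
    TensorProduct.map (sliceL ω) (sliceL ω') t := by
  refine DFunLike.congr_fun (TensorProduct.ext_fourfold'
    (φ := sliceL (TensorProduct.dualDistrib ℂ A A (ω ⊗ₜ ω')) ∘ₗ
      (TensorProduct.tensorTensorTensorComm ℂ A A A A).toLinearMap)
    (ψ := TensorProduct.map (sliceL ω) (sliceL ω')) fun w x y z => ?_) t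
  simp [TensorProduct.smul_tmul', TensorProduct.tmul_smul, smul_smul, mul_comm]

theorem nondeg₄ (G : AlgebraicQuantumGroup A) : NondegAlg ((A ⊗[ℂ] A) ⊗[ℂ] (A ⊗[ℂ] A)) :=
  G.nondeg₂.tensor G.nondeg₂

theorem tens_one_one : tens (1 : Mult A) (1 : Mult A) = 1 :=
  Mult.ext_tmul (fun _ _ => rfl) (fun _ _ => rfl)

theorem comul₂_tmul (x y : A) : G.comul₂ (x ⊗ₜ y) = midFlip (tens (G.comulₗ x) (G.comulₗ y)) := rfl

theorem midFlip_tens_emb (s t : A ⊗[ℂ] A) : midFlip (tens (emb _ s) (emb _ t)) =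
    emb _ (TensorProduct.tensorTensorTensorComm ℂ A A A A (s ⊗ₜ t)) := by
  rw [tens_emb_emb, midFlip_emb]

theorem toAlg_T₁_comul₂ (x y b c : A) : toAlg (T₁ G.comul₂ ((x ⊗ₜ y) ⊗ₜ (b ⊗ₜ c))) =
    TensorProduct.tensorTensorTensorComm ℂ A A A A (G.can₁ (b ⊗ₜ x) ⊗ₜ G.can₁ (c ⊗ₜ y)) := by
  rw [T₁_tmul, comul₂_tmul, ← tens_emb_emb, ← tens_one_one, ← midFlip_tens, ← midFlip_mul,
    tens_mul_tens, ← emb_can₁, ← emb_can₁, midFlip_tens_emb, toAlg_emb G.nondeg₄]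

theorem toAlg_T₂_comul₂ (x y b c : A) : toAlg (T₂ G.comul₂ ((x ⊗ₜ y) ⊗ₜ (b ⊗ₜ c))) =
    TensorProduct.tensorTensorTensorComm ℂ A A A A (G.can₂ (x ⊗ₜ b) ⊗ₜ G.can₂ (y ⊗ₜ c)) := by
  rw [T₂_tmul, comul₂_tmul, ← tens_emb_emb, ← tens_one_one, ← midFlip_tens, ← midFlip_mul,
    tens_mul_tens, ← emb_can₂, ← emb_can₂, midFlip_tens_emb, toAlg_emb G.nondeg₄]

theorem toAlg_T₃_comul₂ (x y b c : A) : toAlg (T₃ G.comul₂ ((x ⊗ₜ y) ⊗ₜ (b ⊗ₜ c))) =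
    TensorProduct.tensorTensorTensorComm ℂ A A A A (G.can₃ (b ⊗ₜ x) ⊗ₜ G.can₃ (c ⊗ₜ y)) := by
  rw [T₃_tmul, comul₂_tmul, ← tens_emb_emb, ← tens_one_one, ← midFlip_tens, ← midFlip_mul,
    tens_mul_tens, ← emb_can₃, ← emb_can₃, midFlip_tens_emb, toAlg_emb G.nondeg₄]

theorem toAlg_T₄_comul₂ (x y b c : A) : toAlg (T₄ G.comul₂ ((x ⊗ₜ y) ⊗ₜ (b ⊗ₜ c))) =
    TensorProduct.tensorTensorTensorComm ℂ A A A A (G.can₄ (x ⊗ₜ b) ⊗ₜ G.can₄ (y ⊗ₜ c)) := by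
  rw [T₄_tmul, comul₂_tmul, ← tens_emb_emb, ← tens_one_one, ← midFlip_tens, ← midFlip_mul,
    tens_mul_tens, ← emb_can₄, ← emb_can₄, midFlip_tens_emb, toAlg_emb G.nondeg₄]

theorem hat_can₁ (v : G.Hat) (b x : A) :
    sliceR v.1 (G.can₁ (b ⊗ₜ x)) = rightElt G.comulₗ v.1 x * b :=
  congrArg (fun T => T.1 b) (G.rightSlice_hat v x)

theorem hat_can₂ (v : G.Hat) (b x : A) :
    sliceL v.1 (G.can₂ (x ⊗ₜ b)) = leftElt G.comulₗ v.1 x * b :=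
  congrArg (fun T => T.1 b) (G.leftSlice_hat v x)

theorem hat_can₃ (v : G.Hat) (b x : A) :
    sliceR v.1 (G.can₃ (b ⊗ₜ x)) = b * rightElt G.comulₗ v.1 x :=
  congrArg (fun T => (MulOpposite.unop T.2) b) (G.rightSlice_hat v x)

theorem hat_can₄ (v : G.Hat) (b x : A) :
    sliceL v.1 (G.can₄ (x ⊗ₜ b)) = b * leftElt G.comulₗ v.1 x :=
  congrArg (fun T => (MulOpposite.unop T.2) b) (G.leftSlice_hat v x)

theorem rightElt_comul₂ (v w : G.Hat) (x y : A) : rightElt G.comul₂ (G.hat₂ (v ⊗ₜ w)) (x ⊗ₜ y) =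
    rightElt G.comulₗ v.1 x ⊗ₜ rightElt G.comulₗ w.1 y := by
  rw [rightElt, LinearMap.comp_apply,
    ← unPair_emb G.nondeg₂ (rightElt G.comulₗ v.1 x ⊗ₜ rightElt G.comulₗ w.1 y)]
  congr 1
  refine Prod.ext (TensorProduct.ext' fun b c => ?_)
    (MulOpposite.unop_injective (TensorProduct.ext' fun b c => ?_))
  · change sliceR (TensorProduct.dualDistrib ℂ A A (v.1 ⊗ₜ w.1))
      (toAlg (T₁ G.comul₂ ((x ⊗ₜ y) ⊗ₜ (b ⊗ₜ c)))) = _ * _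
    rw [toAlg_T₁_comul₂, sliceR_tensorTensorTensorComm, TensorProduct.map_tmul, hat_can₁, hat_can₁,
      Algebra.TensorProduct.tmul_mul_tmul]
  · change sliceR (TensorProduct.dualDistrib ℂ A A (v.1 ⊗ₜ w.1))
      (toAlg (T₃ G.comul₂ ((x ⊗ₜ y) ⊗ₜ (b ⊗ₜ c)))) = _ * _
    rw [toAlg_T₃_comul₂, sliceR_tensorTensorTensorComm, TensorProduct.map_tmul, hat_can₃, hat_can₃,
      Algebra.TensorProduct.tmul_mul_tmul]

theorem leftElt_comul₂ (v w : G.Hat) (x y : A) : leftElt G.comul₂ (G.hat₂ (v ⊗ₜ w)) (x ⊗ₜ y) =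
    leftElt G.comulₗ v.1 x ⊗ₜ leftElt G.comulₗ w.1 y := by
  rw [leftElt, LinearMap.comp_apply,
    ← unPair_emb G.nondeg₂ (leftElt G.comulₗ v.1 x ⊗ₜ leftElt G.comulₗ w.1 y)]
  congr 1
  refine Prod.ext (TensorProduct.ext' fun b c => ?_)
    (MulOpposite.unop_injective (TensorProduct.ext' fun b c => ?_))
  · change sliceL (TensorProduct.dualDistrib ℂ A A (v.1 ⊗ₜ w.1))
      (toAlg (T₂ G.comul₂ ((x ⊗ₜ y) ⊗ₜ (b ⊗ₜ c)))) = _ * _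
    rw [toAlg_T₂_comul₂, sliceL_tensorTensorTensorComm, TensorProduct.map_tmul, hat_can₂, hat_can₂,
      Algebra.TensorProduct.tmul_mul_tmul]
  · change sliceL (TensorProduct.dualDistrib ℂ A A (v.1 ⊗ₜ w.1))
      (toAlg (T₄ G.comul₂ ((x ⊗ₜ y) ⊗ₜ (b ⊗ₜ c)))) = _ * _
    rw [toAlg_T₄_comul₂, sliceL_tensorTensorTensorComm, TensorProduct.map_tmul, hat_can₄, hat_can₄,
      Algebra.TensorProduct.tmul_mul_tmul]

/-- `Â ⊙ Â`, as an algebra of functionals on `A ⊙ A`. -/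
theorem isDualPair₂ : IsDualPair G.comul₂ G.hat₂ := by
  classical
  have h := G.isDualPair
  refine ⟨G.hat₂_injective, fun t ht => ?_, fun z z' t => ?_, fun z z' t => ?_, ?_, fun s => ?_⟩
  · refine eq_zero_of_rslice_eq_zero (fun v : G.Hat => v.1) (fun v : G.Hat => v.1)
      h.separates h.separates t fun v w => ?_
    rw [← hat₂_tmul_apply, ht]
  · induction t with
    | zero => simp
    | add t t' ht ht' => simp only [map_add, ht, ht']
    | tmul x y =>
      rw [← rightEltₗ_apply]
      induction z with
      | zero => simp
      | add u u' hu hu' => simp only [add_mul, map_add, LinearMap.add_apply, hu, hu']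
      | tmul v w =>
        induction z' with
        | zero => simp
        | add u u' hu hu' => simp only [mul_add, map_add, LinearMap.add_apply, hu, hu']
        | tmul v' w' =>
          rw [rightEltₗ_apply, rightElt_comul₂, Algebra.TensorProduct.tmul_mul_tmul, hat₂_tmul,
            hat₂_tmul, Hat.mul_apply, Hat.mul_apply]
  · induction t with
    | zero => simp
    | add t t' ht ht' => simp only [map_add, ht, ht']
    | tmul x y =>
      rw [← leftEltₗ_apply]
      induction z with
      | zero => simp
      | add u u' hu hu' => simp only [add_mul, map_add, LinearMap.add_apply, hu, hu']
      | tmul v w =>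
        induction z' with
        | zero => simp
        | add u u' hu hu' => simp only [mul_add, map_add, LinearMap.add_apply, hu, hu']
        | tmul v' w' =>
          rw [leftEltₗ_apply, leftElt_comul₂, Algebra.TensorProduct.tmul_mul_tmul, hat₂_tmul,
            hat₂_tmul, Hat.mul_apply', Hat.mul_apply']
  · refine span_tensor h.span_rightElt h.span_rightElt _ ?_
    rintro _ ⟨v, x, rfl⟩ _ ⟨w, y, rfl⟩
    exact Submodule.subset_span ⟨v ⊗ₜ w, x ⊗ₜ y, (G.rightElt_comul₂ v w x y).symm⟩
  · choose S hS using fun z : G.Hat ⊗[ℂ] G.Hat => TensorProduct.exists_finset z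
    obtain ⟨e, he⟩ := h.local_unit ((s.biUnion S).image Prod.fst)
    obtain ⟨e', he'⟩ := h.local_unit ((s.biUnion S).image Prod.snd)
    refine ⟨e ⊗ₜ e', fun z hz => ?_⟩
    rw [hS z, Finset.mul_sum]
    refine Finset.sum_congr rfl fun i hi => ?_
    have hi' : i ∈ s.biUnion S := Finset.mem_biUnion.2 ⟨z, hz, hi⟩
    rw [Algebra.TensorProduct.tmul_mul_tmul, he _ (Finset.mem_image_of_mem _ hi'),
      he' _ (Finset.mem_image_of_mem _ hi')]

end AlgebraicQuantumGroup

end DualPairs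

/-! ### Functionals with slices in `A` -/

section Smooth

variable {A : Type*} [NonUnitalRing A] [Module ℂ A] [IsScalarTower ℂ A A] [SMulCommClass ℂ A A]

namespace AlgebraicQuantumGroup

variable (G : AlgebraicQuantumGroup A)

/-- For the functional `θ` of a multiplier `T`: `(ι ⊙ θ)Δ((ι ⊙ ω)Δ(x)) = (ι ⊙ Tω)Δ(x)`. -/
theorem rightSlice_functional (T : Mult G.Hat) (v : G.Hat) (x : A) :
    rightSlice G.comulₗ (G.isDualPair.functional T) (rightElt G.comulₗ v.1 x) =
      Mult.pair (emb A (rightElt G.comulₗ (T.lact v).1 x)) := by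
  have hv : G.isDualPair.functional T ∘ₗ rightElt G.comulₗ v.1 = (T.lact v).1 :=
    (G.isDualPair.implements_functional T v).1.symm
  obtain ⟨a, rfl⟩ := G.toHat_surjective v
  rw [rightElt_toHat_eq_rco] at hv ⊢
  refine Prod.ext (LinearMap.ext fun b => ?_)
    (MulOpposite.unop_injective (LinearMap.ext fun b => ?_))
  · change rslice (G.isDualPair.functional T) (G.can₁ (b ⊗ₜ rco G.can₄ G.haar a x)) = _ * b
    have h := G.toMultHopf.coassoc₁₄.lTensor_rco G.haar a (b ⊗ₜ x)
    rw [LinearMap.lTensor_tmul] at h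
    refine (congrArg (rslice (G.isDualPair.functional T)) h).trans ?_
    rw [rslice_lTensor]
    exact (congrArg (fun θ => rslice θ (G.can₁ (b ⊗ₜ x))) hv).trans (G.hat_can₁ _ _ _)
  · change rslice (G.isDualPair.functional T) (G.can₃ (b ⊗ₜ rco G.can₄ G.haar a x)) = b * _
    have h := G.toMultHopf.coassoc₃₄.lTensor_rco G.haar a (b ⊗ₜ x)
    rw [LinearMap.lTensor_tmul] at h
    refine (congrArg (rslice (G.isDualPair.functional T)) h).trans ?_
    rw [rslice_lTensor]
    exact (congrArg (fun θ => rslice θ (G.can₃ (b ⊗ₜ x))) hv).trans (G.hat_can₃ _ _ _)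

theorem leftSlice_functional (T : Mult G.Hat) (v : G.Hat) (x : A) :
    leftSlice G.comulₗ (G.isDualPair.functional T) (leftElt G.comulₗ v.1 x) =
      Mult.pair (emb A (leftElt G.comulₗ (T.ract v).1 x)) := by
  have hv : G.isDualPair.functional T ∘ₗ leftElt G.comulₗ v.1 = (T.ract v).1 :=
    (G.isDualPair.implements_functional T v).2.symm
  obtain ⟨a, rfl⟩ := G.toHat_surjective v
  rw [leftElt_toHat_eq_lco] at hv ⊢
  refine Prod.ext (LinearMap.ext fun b => ?_)
    (MulOpposite.unop_injective (LinearMap.ext fun b => ?_))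
  · change lslice (G.isDualPair.functional T) (G.can₂ (lco G.can₃ G.haar a x ⊗ₜ b)) = _ * b
    have h := G.toMultHopf.coassoc₃₂.rTensor_lco G.haar a (x ⊗ₜ b)
    rw [LinearMap.rTensor_tmul] at h
    refine (congrArg (lslice (G.isDualPair.functional T)) h).trans ?_
    rw [lslice_rTensor]
    exact (congrArg (fun θ => lslice θ (G.can₂ (x ⊗ₜ b))) hv).trans (G.hat_can₂ _ _ _)
  · change lslice (G.isDualPair.functional T) (G.can₄ (lco G.can₃ G.haar a x ⊗ₜ b)) = b * _
    have h := G.toMultHopf.coassoc₃₄.rTensor_lco G.haar a (x ⊗ₜ b)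
    rw [LinearMap.rTensor_tmul] at h
    refine (congrArg (lslice (G.isDualPair.functional T)) h).trans ?_
    rw [lslice_rTensor]
    exact (congrArg (fun θ => lslice θ (G.can₄ (x ⊗ₜ b))) hv).trans (G.hat_can₄ _ _ _)

theorem rightElt_functional (T : Mult G.Hat) (v : G.Hat) (x : A) :
    rightElt G.comulₗ (G.isDualPair.functional T) (rightElt G.comulₗ v.1 x) =
      rightElt G.comulₗ (T.lact v).1 x := by
  rw [rightElt, LinearMap.comp_apply, rightSlice_functional, unPair_emb G.regular.nondeg]

theorem functional_mem_smooth (T : Mult G.Hat) :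
    G.isDualPair.functional T ∈ smoothFunctionals G.comulₗ := by
  intro a
  constructor
  · have : Submodule.span ℂ {z | ∃ (v : G.Hat) (x : A), z = leftElt G.comulₗ v.1 x} ≤
        (LinearMap.range (Mult.pair ∘ₗ (emb A : A →ₗ[ℂ] Mult A))).comap
          (leftSlice G.comulₗ (G.isDualPair.functional T)) := by
      rw [Submodule.span_le]
      rintro _ ⟨v, x, rfl⟩
      exact ⟨_, (G.leftSlice_functional T v x).symm⟩
    obtain ⟨b, hb⟩ := this (G.span_leftElt ▸ Submodule.mem_top : a ∈ _)
    exact ⟨b, hb.symm⟩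
  · have : Submodule.span ℂ {z | ∃ (v : G.Hat) (x : A), z = rightElt G.comulₗ v.1 x} ≤
        (LinearMap.range (Mult.pair ∘ₗ (emb A : A →ₗ[ℂ] Mult A))).comap
          (rightSlice G.comulₗ (G.isDualPair.functional T)) := by
      rw [Submodule.span_le]
      rintro _ ⟨v, x, rfl⟩
      exact ⟨_, (G.rightSlice_functional T v x).symm⟩
    obtain ⟨b, hb⟩ := this (G.isDualPair.span_rightElt ▸ Submodule.mem_top : a ∈ _)
    exact ⟨b, hb.symm⟩

/-- A functional with all slices in `A` multiplies `Â` into itself: on one side by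
`MultHopf.exists_haar_of_smooth`, on the other side by the same result for the opposite
comultiplication and the right Haar functional `φ ∘ S`. -/
theorem exists_functional_eq {θ : Module.Dual ℂ A} (hθ : θ ∈ smoothFunctionals G.comulₗ) :
    ∃ T, G.isDualPair.functional T = θ := by
  have := G.nontrivial
  obtain ⟨ε, S, hε, hS⟩ := G.exists_hopf
  have hφ := G.isLeftHaar
  have hψ := hS.isLeftHaar_cop hε hφ
  suffices h : ∃ T, Implements G.comulₗ G.hat.subtype T θ by
    obtain ⟨T, hT⟩ := h
    exact ⟨T, ((G.isDualPair.implements_iff T θ).1 hT).symm⟩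
  refine G.isDualPair.exists_mult θ (fun v => ?_) (fun v => ?_)
  · obtain ⟨a, rfl⟩ := G.toHat_surjective v
    obtain ⟨c, hc⟩ := MultHopf.exists_haar_of_smooth hε hS hφ θ (fun x => by
      obtain ⟨z, hz⟩ := (hθ x).2
      exact ⟨z, fun d => (congrArg (fun T => (MulOpposite.unop T.2) d) hz).symm⟩) a
    refine ⟨G.toHat c, LinearMap.ext fun x => ?_⟩
    refine (hc x).symm.trans ?_
    rw [LinearMap.comp_apply]
    exact congrArg θ (G.rightElt_toHat a x).symm
  · obtain ⟨a, rfl⟩ := G.toHat_surjective v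
    obtain ⟨a', ha'⟩ := MultHopf.exists_haar_mul_left_eq hφ hψ a
    obtain ⟨c, hc⟩ := MultHopf.exists_haar_of_smooth hε.cop hS.cop hψ θ (fun x => by
      obtain ⟨z, hz⟩ := (hθ x).1
      refine ⟨z, fun d => ?_⟩
      simp only [MultHopf.cop, MultHopf.flipConj_tmul, rslice_comm]
      exact (congrArg (fun T => (MulOpposite.unop T.2) d) hz).symm) a'
    obtain ⟨c', hc'⟩ := MultHopf.exists_haar_mul_left_eq hψ hφ.cop_cop c
    refine ⟨G.toHat c', LinearMap.ext fun x => ?_⟩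
    have h1 := hc x
    simp only [MultHopf.cop, MultHopf.flipConj_tmul, rslice_comm] at h1
    refine (hc' x).symm.trans (h1.symm.trans (congrArg θ ?_))
    exact (G.toMultHopf.lslice_e₃_congr ha' x).symm.trans (G.leftElt_toHat a x).symm

theorem range_functional :
    Set.range G.isDualPair.functional = smoothFunctionals G.comulₗ :=
  Set.Subset.antisymm (by rintro _ ⟨T, rfl⟩; exact G.functional_mem_smooth T)
    fun _ hθ => G.exists_functional_eq hθ

/-! ### Other descriptions of the dual algebra -/

/-- The functionals `φ(· a)` belong to `Â`. -/
theorem exists_haar_right (a : A) : ∃ v : G.Hat, ∀ x, v.1 x = G.haar (x * a) := by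
  have := G.nontrivial
  obtain ⟨ε, S, hε, hS⟩ := G.exists_hopf
  have hφ := G.isLeftHaar
  have hψ := hS.isLeftHaar_cop hε hφ
  obtain ⟨b, hb⟩ := MultHopf.exists_haar_mul_left_eq hφ.op hψ.op a
  obtain ⟨c, hc⟩ := MultHopf.exists_haar_mul_right_eq hε.cop.op hS.cop.op hψ.op hφ.op.cop_cop b
  exact ⟨G.toHat c, fun x => ((hb x).trans (hc x)).symm⟩

/-- Every element of `Â` is of the form `φ(· a)`. -/
theorem exists_eq_haar_right (v : G.Hat) : ∃ a, ∀ x, v.1 x = G.haar (x * a) := by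
  have := G.nontrivial
  obtain ⟨ε, S, hε, hS⟩ := G.exists_hopf
  have hφ := G.isLeftHaar
  have hψ := hS.isLeftHaar_cop hε hφ
  obtain ⟨a, rfl⟩ := G.toHat_surjective v
  obtain ⟨b, hb⟩ := MultHopf.exists_haar_mul_right_eq hε hS hφ hψ a
  obtain ⟨c, hc⟩ := MultHopf.exists_haar_mul_left_eq hψ.op hφ.op.cop_cop b
  exact ⟨c, fun x => (hb x).trans (hc x)⟩

/-- For a right Haar functional `ψ`, the functionals `ψ(a ·)` belong to `Â`. -/
theorem exists_rightHaar_left {ψ : Module.Dual ℂ A} (hψ : G.toMultHopf.cop.IsLeftHaar ψ) (a : A) :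
    ∃ v : G.Hat, ∀ x, v.1 x = ψ (a * x) := by
  obtain ⟨b, hb⟩ := MultHopf.exists_haar_mul_left_eq hψ G.isLeftHaar.cop_cop a
  exact ⟨G.toHat b, fun x => (hb x).symm⟩

theorem exists_eq_rightHaar_left {ψ : Module.Dual ℂ A} (hψ : G.toMultHopf.cop.IsLeftHaar ψ)
    (v : G.Hat) : ∃ a, ∀ x, v.1 x = ψ (a * x) := by
  obtain ⟨a, rfl⟩ := G.toHat_surjective v
  exact MultHopf.exists_haar_mul_left_eq G.isLeftHaar hψ a

/-- For a right Haar functional `ψ`, the functionals `ψ(· a)` belong to `Â`. -/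
theorem exists_rightHaar_right {ψ : Module.Dual ℂ A} (hψ : G.toMultHopf.cop.IsLeftHaar ψ) (a : A) :
    ∃ v : G.Hat, ∀ x, v.1 x = ψ (x * a) := by
  obtain ⟨b, hb⟩ := MultHopf.exists_haar_mul_left_eq hψ.op G.isLeftHaar.op.cop_cop a
  obtain ⟨v, hv⟩ := G.exists_haar_right b
  exact ⟨v, fun x => (hv x).trans (hb x).symm⟩

theorem exists_eq_rightHaar_right {ψ : Module.Dual ℂ A} (hψ : G.toMultHopf.cop.IsLeftHaar ψ)
    (v : G.Hat) : ∃ a, ∀ x, v.1 x = ψ (x * a) := by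
  obtain ⟨a, ha⟩ := G.exists_eq_haar_right v
  obtain ⟨b, hb⟩ := MultHopf.exists_haar_mul_left_eq G.isLeftHaar.op hψ.op a
  exact ⟨b, fun x => (ha x).trans (hb x)⟩

/-- A linear family of functionals that belong to `Â`, as a linear map into `Â`. -/
def intoHat (f : A →ₗ[ℂ] Module.Dual ℂ A) (hf : ∀ a, ∃ v : G.Hat, ∀ x, v.1 x = f a x) :
    A →ₗ[ℂ] G.Hat :=
  f.codRestrict G.hat fun a => by
    obtain ⟨v, hv⟩ := hf a
    rw [← LinearMap.ext hv]
    exact v.2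

theorem intoHat_surjective (f : A →ₗ[ℂ] Module.Dual ℂ A) (hf)
    (h : ∀ v : G.Hat, ∃ a, ∀ x, v.1 x = f a x) : Function.Surjective (G.intoHat f hf) := fun v => by
  obtain ⟨a, ha⟩ := h v
  exact ⟨a, Subtype.ext (LinearMap.ext fun x => (ha x).symm)⟩

/-! ### The elements `Δ̂(ω₁)(1 ⊗ ω₂)` and `(ω₁ ⊗ 1)Δ̂(ω₂)` of `Â ⊙ Â` -/

/-- `z ∈ Â ⊙ Â` is the functional `x ⊗ y ↦ ω₁(x (ι ⊙ ω₂)Δ(y))`. -/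
def IsRightProd (ω₁ ω₂ : G.Hat) (z : G.Hat ⊗[ℂ] G.Hat) : Prop :=
  ∀ x y, G.hat₂ z (x ⊗ₜ y) = ω₁.1 (x * rightElt G.comulₗ ω₂.1 y)

/-- `z ∈ Â ⊙ Â` is the functional `x ⊗ y ↦ ω₂((ω₁ ⊙ ι)Δ(x) y)`. -/
def IsLeftProd (ω₁ ω₂ : G.Hat) (z : G.Hat ⊗[ℂ] G.Hat) : Prop :=
  ∀ x y, G.hat₂ z (x ⊗ₜ y) = ω₂.1 (leftElt G.comulₗ ω₁.1 x * y)

/-- With `ω₁ = φ(· S(p))` and `ω₂ = φ(b ·)`, the functional `x ⊗ y ↦ ω₁(x (ι ⊙ ω₂)Δ(y))` is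
`Σ φ(· S(kᵢ)) ⊙ φ(cᵢ ·)` with `Σ kᵢ ⊗ cᵢ = (p ⊗ 1)Δ(b)`. The elements `(p ⊗ 1)Δ(b)` span
`A ⊙ A`, hence these functionals span `Â ⊙ Â`. -/
theorem exists_isRightProd_and_span : (∀ ω₁ ω₂ : G.Hat, ∃ z, G.IsRightProd ω₁ ω₂ z) ∧
    Submodule.span ℂ {z | ∃ ω₁ ω₂, G.IsRightProd ω₁ ω₂ z} = ⊤ := by
  have := G.nontrivial
  obtain ⟨ε, S, hε, hS⟩ := G.exists_hopf
  have hφ := G.isLeftHaar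
  let α : A →ₗ[ℂ] G.Hat := G.intoHat ((G.hatMap.flip) ∘ₗ S.toLinearMap)
    fun a => G.exists_haar_right (S a)
  have hα : Function.Surjective α := G.intoHat_surjective _ _ fun v => by
    obtain ⟨a, ha⟩ := G.exists_eq_haar_right v
    exact ⟨S.symm a, fun x => by simpa using ha x⟩
  have hαa : ∀ k x, (α k).1 x = G.haar (x * S k) := fun _ _ => rfl
  have key : ∀ p b, G.IsRightProd (α p) (G.toHat b)
      (TensorProduct.map α G.toHat (G.can₃ (p ⊗ₜ b))) := by
    intro p b x y
    have h1 : ∀ w : A ⊗[ℂ] A, G.hat₂ (TensorProduct.map α G.toHat w) (x ⊗ₜ y) =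
        G.haar (x * S (rslice G.haar (((LinearMap.mul ℂ A).flip y).lTensor A w))) :=
      eqOn_of_tmul (f := LinearMap.applyₗ (x ⊗ₜ[ℂ] y) ∘ₗ G.hat₂ ∘ₗ TensorProduct.map α G.toHat)
        (g := G.haar ∘ₗ LinearMap.mulLeft ℂ x ∘ₗ S.toLinearMap ∘ₗ rslice G.haar ∘ₗ
          ((LinearMap.mul ℂ A).flip y).lTensor A) fun k c => by
          simp [hat₂_tmul, hαa, mul_comm (G.haar (x * S k))]
    have h2 := MultHopf.rslice_e₄_mul hε hS hφ (S p) b y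
    rw [S.symm_apply_apply] at h2
    rw [h1, hαa, rightElt_toHat, mul_assoc]
    exact congrArg (fun t => G.haar (x * t)) h2.symm
  refine ⟨fun ω₁ ω₂ => ?_, ?_⟩
  · obtain ⟨p, rfl⟩ := hα ω₁
    obtain ⟨b, rfl⟩ := G.toHat_surjective ω₂
    exact ⟨_, key p b⟩
  · rw [eq_top_iff]
    intro z _
    obtain ⟨w, rfl⟩ := TensorProduct.map_surjective hα G.toHat_surjective z
    obtain ⟨u, rfl⟩ := G.can₃.surjective w
    induction u with
    | zero => simp
    | add u v hu hv =>
      rw [map_add, map_add]; exact Submodule.add_mem _ (hu trivial) (hv trivial)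
    | tmul p b => exact Submodule.subset_span ⟨α p, G.toHat b, key p b⟩

theorem leftElt_of_rightHaar {ψ : Module.Dual ℂ A} {v : G.Hat} {b : A}
    (hv : ∀ x, v.1 x = ψ (x * b)) (x : A) :
    leftElt G.comulₗ v.1 x = lslice ψ (G.can₁ (b ⊗ₜ x)) := by
  rw [← sub_eq_zero]
  refine (G.regular.nondeg _).2 fun c => ?_
  rw [mul_sub, sub_eq_zero, ← hat_can₄]
  have h : v.1 = ψ ∘ₗ (LinearMap.mul ℂ A).flip b := LinearMap.ext hv
  change lslice v.1 _ = LinearMap.mul ℂ A c _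
  rw [h, ← lslice_rTensor, ← lslice_lTensor]
  exact congrArg (lslice ψ) (G.toMultHopf.e₁_e₄ x b c).symm

/-- The mirror image of `exists_isRightProd_and_span`, with the right Haar functional. -/
theorem exists_isLeftProd_and_span : (∀ ω₁ ω₂ : G.Hat, ∃ z, G.IsLeftProd ω₁ ω₂ z) ∧
    Submodule.span ℂ {z | ∃ ω₁ ω₂, G.IsLeftProd ω₁ ω₂ z} = ⊤ := by
  have := G.nontrivial
  obtain ⟨ε, S, hε, hS⟩ := G.exists_hopf
  have hψ := hS.isLeftHaar_cop hε G.isLeftHaar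
  set ψ := G.haar ∘ₗ S.toLinearMap with hψdef
  clear_value ψ
  let β : A →ₗ[ℂ] G.Hat := G.intoHat ((LinearMap.mul ℂ A).flip.compr₂ ψ)
    fun a => G.exists_rightHaar_right hψ a
  have hβ : Function.Surjective β := G.intoHat_surjective _ _ fun v =>
    G.exists_eq_rightHaar_right hψ v
  let α : A →ₗ[ℂ] G.Hat := G.intoHat ((LinearMap.mul ℂ A).compr₂ ψ ∘ₗ S.toLinearMap)
    fun a => G.exists_rightHaar_left hψ (S a)
  have hα : Function.Surjective α := G.intoHat_surjective _ _ fun v => by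
    obtain ⟨a, ha⟩ := G.exists_eq_rightHaar_left hψ v
    exact ⟨S.symm a, fun x => by simpa using ha x⟩
  have hαa : ∀ k x, (α k).1 x = ψ (S k * x) := fun _ _ => rfl
  have hβa : ∀ k x, (β k).1 x = ψ (x * k) := fun _ _ => rfl
  have key : ∀ b p, G.IsLeftProd (β b) (α p) (TensorProduct.map β α (G.can₂ (b ⊗ₜ p))) := by
    intro b p x y
    have h1 : ∀ w : A ⊗[ℂ] A, G.hat₂ (TensorProduct.map β α w) (x ⊗ₜ y) =
        ψ (S (lslice ψ ((LinearMap.mul ℂ A x).rTensor A w)) * y) :=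
      eqOn_of_tmul (f := LinearMap.applyₗ (x ⊗ₜ[ℂ] y) ∘ₗ G.hat₂ ∘ₗ TensorProduct.map β α)
        (g := ψ ∘ₗ LinearMap.mulRight ℂ y ∘ₗ S.toLinearMap ∘ₗ lslice ψ ∘ₗ
          (LinearMap.mul ℂ A x).rTensor A) fun k c => by
          simp [hat₂_tmul, hαa, hβa]
    have h2 := MultHopf.mul_lslice_e₁ hε hS hψ (S p) b x
    rw [S.symm_apply_apply] at h2
    rw [h1, hαa, G.leftElt_of_rightHaar (hβa b), ← mul_assoc]
    exact congrArg (fun t => ψ (t * y)) h2.symm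
  refine ⟨fun ω₁ ω₂ => ?_, ?_⟩
  · obtain ⟨b, rfl⟩ := hβ ω₁
    obtain ⟨p, rfl⟩ := hα ω₂
    exact ⟨_, key b p⟩
  · rw [eq_top_iff]
    intro z _
    obtain ⟨w, rfl⟩ := TensorProduct.map_surjective hβ hα z
    obtain ⟨u, rfl⟩ := G.can₂.surjective w
    induction u with
    | zero => simp
    | add u v hu hv =>
      rw [map_add, map_add]; exact Submodule.add_mem _ (hu trivial) (hv trivial)
    | tmul b p => exact Submodule.subset_span ⟨β b, α p, key b p⟩

end AlgebraicQuantumGroup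

end Smooth

/-! ### The dual comultiplication -/

section DualComultiplication

variable {A : Type*} [NonUnitalRing A] [Module ℂ A] [IsScalarTower ℂ A A] [SMulCommClass ℂ A A]

theorem rightElt_add {B : Type*} [NonUnitalRing B] [Module ℂ B] [IsScalarTower ℂ B B]
    [SMulCommClass ℂ B B] (Δ : B →ₗ[ℂ] Mult (B ⊗[ℂ] B)) (ω ω' : Module.Dual ℂ B) :
    rightElt Δ (ω + ω') = rightElt Δ ω + rightElt Δ ω' :=
  LinearMap.ext fun x => map_add (rightEltₗ Δ x) ω ω'

theorem leftElt_add {B : Type*} [NonUnitalRing B] [Module ℂ B] [IsScalarTower ℂ B B]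
    [SMulCommClass ℂ B B] (Δ : B →ₗ[ℂ] Mult (B ⊗[ℂ] B)) (ω ω' : Module.Dual ℂ B) :
    leftElt Δ (ω + ω') = leftElt Δ ω + leftElt Δ ω' :=
  LinearMap.ext fun x => map_add (leftEltₗ Δ x) ω ω'

theorem rightElt_zero {B : Type*} [NonUnitalRing B] [Module ℂ B] [IsScalarTower ℂ B B]
    [SMulCommClass ℂ B B] (Δ : B →ₗ[ℂ] Mult (B ⊗[ℂ] B)) : rightElt Δ 0 = 0 :=
  LinearMap.ext fun x => map_zero (rightEltₗ Δ x)

theorem leftElt_zero {B : Type*} [NonUnitalRing B] [Module ℂ B] [IsScalarTower ℂ B B]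
    [SMulCommClass ℂ B B] (Δ : B →ₗ[ℂ] Mult (B ⊗[ℂ] B)) : leftElt Δ 0 = 0 :=
  LinearMap.ext fun x => map_zero (leftEltₗ Δ x)

/-- Linear maps on a tensor product are equal if they agree on the products of two spanning sets. -/
theorem ext_on_tensor {C E W : Type*} [NonUnitalRing C] [Module ℂ C] [IsScalarTower ℂ C C]
    [SMulCommClass ℂ C C] [NonUnitalRing E] [Module ℂ E] [IsScalarTower ℂ E E]
    [SMulCommClass ℂ E E] [AddCommGroup W] [Module ℂ W] {S : Set C} {T : Set E}
    (hS : Submodule.span ℂ S = ⊤) (hT : Submodule.span ℂ T = ⊤) {f g : C ⊗[ℂ] E →ₗ[ℂ] W}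
    (h : ∀ s ∈ S, ∀ t ∈ T, f (s ⊗ₜ t) = g (s ⊗ₜ t)) : f = g :=
  LinearMap.eqLocus_eq_top.1 (span_tensor hS hT (LinearMap.eqLocus f g) h)

/-- The functional of an element of `V`, as a multiplier of `V`, is the element itself. -/
theorem IsDualPair.functional_emb {B V : Type*} [NonUnitalRing B] [Module ℂ B]
    [IsScalarTower ℂ B B] [SMulCommClass ℂ B B] [NonUnitalRing V] [Module ℂ V]
    [IsScalarTower ℂ V V] [SMulCommClass ℂ V V] {Δ : B →ₗ[ℂ] Mult (B ⊗[ℂ] B)}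
    {ev : V →ₗ[ℂ] Module.Dual ℂ B} (h : IsDualPair Δ ev) (v : V) :
    h.functional (emb V v) = ev v :=
  ((h.implements_iff (emb V v) (ev v)).1 fun w => ⟨LinearMap.ext fun x => h.ev_mul v w x,
    LinearMap.ext fun x => h.ev_mul' w v x⟩).symm

namespace AlgebraicQuantumGroup

variable (G : AlgebraicQuantumGroup A)

theorem hat₂_ract (v : G.Hat) (z : G.Hat ⊗[ℂ] G.Hat) (x y : A) :
    G.hat₂ ((tens (emb G.Hat v) 1).ract z) (x ⊗ₜ y) =
      G.hat₂ z (rightElt G.comulₗ v.1 x ⊗ₜ y) :=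
  eqOn_of_tmul (f := LinearMap.applyₗ (x ⊗ₜ[ℂ] y) ∘ₗ G.hat₂ ∘ₗ (tens (emb G.Hat v) 1).ract)
    (g := LinearMap.applyₗ (rightElt G.comulₗ v.1 x ⊗ₜ[ℂ] y) ∘ₗ G.hat₂) (fun _ _ => rfl) z

theorem hat₂_lact (v : G.Hat) (z : G.Hat ⊗[ℂ] G.Hat) (x y : A) :
    G.hat₂ ((tens 1 (emb G.Hat v)).lact z) (x ⊗ₜ y) =
      G.hat₂ z (x ⊗ₜ leftElt G.comulₗ v.1 y) :=
  eqOn_of_tmul (f := LinearMap.applyₗ (x ⊗ₜ[ℂ] y) ∘ₗ G.hat₂ ∘ₗ (tens 1 (emb G.Hat v)).lact)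
    (g := LinearMap.applyₗ (x ⊗ₜ[ℂ] leftElt G.comulₗ v.1 y) ∘ₗ G.hat₂)
    (fun w w' => congrArg (w.1 x * ·) (Hat.mul_apply' G v w' y)) z

variable {G}

theorem IsRightProd.hat₂_ract_eq {ω ω₂ : G.Hat} {z : G.Hat ⊗[ℂ] G.Hat} (hz : G.IsRightProd ω ω₂ z)
    (ω₁ : G.Hat) : G.hat₂ ((tens (emb G.Hat ω₁) 1).ract z) =
      (ω.1 ∘ₗ LinearMap.mul' ℂ A) ∘ₗ rightElt G.comul₂ (G.hat₂ (ω₁ ⊗ₜ ω₂)) :=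
  TensorProduct.ext' fun x y => by
    rw [hat₂_ract, hz, LinearMap.comp_apply, rightElt_comul₂, LinearMap.comp_apply,
      LinearMap.mul'_apply]

theorem IsLeftProd.hat₂_lact_eq {ω ω₁ : G.Hat} {z : G.Hat ⊗[ℂ] G.Hat} (hz : G.IsLeftProd ω₁ ω z)
    (ω₂ : G.Hat) : G.hat₂ ((tens 1 (emb G.Hat ω₂)).lact z) =
      (ω.1 ∘ₗ LinearMap.mul' ℂ A) ∘ₗ leftElt G.comul₂ (G.hat₂ (ω₁ ⊗ₜ ω₂)) :=
  TensorProduct.ext' fun x y => by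
    rw [hat₂_lact, hz, LinearMap.comp_apply, leftElt_comul₂, LinearMap.comp_apply,
      LinearMap.mul'_apply]

variable (G)

/-- The functional `x ⊗ y ↦ ω(xy)` belongs to `M(Â ⊙ Â)`. -/
theorem exists_implements_mul' (ω : G.Hat) :
    ∃ T, Implements G.comul₂ G.hat₂ T (ω.1 ∘ₗ LinearMap.mul' ℂ A) := by
  refine G.isDualPair₂.exists_mult _ (fun v => ?_) (fun v => ?_)
  · induction v with
    | zero => exact ⟨0, by rw [map_zero, rightElt_zero, LinearMap.comp_zero]⟩
    | add u v hu hv =>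
      obtain ⟨a, ha⟩ := hu
      obtain ⟨b, hb⟩ := hv
      exact ⟨a + b, by rw [map_add, map_add, rightElt_add, LinearMap.comp_add, ha, hb]⟩
    | tmul ω₁ ω₂ =>
      obtain ⟨z, hz⟩ := G.exists_isRightProd_and_span.1 ω ω₂
      exact ⟨_, hz.hat₂_ract_eq ω₁⟩
  · induction v with
    | zero => exact ⟨0, by rw [map_zero, leftElt_zero, LinearMap.comp_zero]⟩
    | add u v hu hv =>
      obtain ⟨a, ha⟩ := hu
      obtain ⟨b, hb⟩ := hv
      exact ⟨a + b, by rw [map_add, map_add, leftElt_add, LinearMap.comp_add, ha, hb]⟩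
    | tmul ω₁ ω₂ =>
      obtain ⟨z, hz⟩ := G.exists_isLeftProd_and_span.1 ω₁ ω
      exact ⟨_, hz.hat₂_lact_eq ω₂⟩

theorem functional_choose_mul' (ω : G.Hat) :
    G.isDualPair₂.functional (G.exists_implements_mul' ω).choose = ω.1 ∘ₗ LinearMap.mul' ℂ A :=
  ((G.isDualPair₂.implements_iff _ _).1 (G.exists_implements_mul' ω).choose_spec).symm

/-- The dual comultiplication as a linear map: `Δ̂(ω)` is the multiplier given by the functional
`x ⊗ y ↦ ω(xy)`. -/
def dualComulₗ : G.Hat →ₗ[ℂ] Mult (G.Hat ⊗[ℂ] G.Hat) where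
  toFun ω := (G.exists_implements_mul' ω).choose
  map_add' ω ω' := G.isDualPair₂.functional_injective (by
    rw [map_add, functional_choose_mul', functional_choose_mul', functional_choose_mul']
    rfl)
  map_smul' r ω := G.isDualPair₂.functional_injective (by
    rw [map_smul, functional_choose_mul', functional_choose_mul']
    rfl)

theorem functional_dualComulₗ (ω : G.Hat) :
    G.isDualPair₂.functional (G.dualComulₗ ω) = ω.1 ∘ₗ LinearMap.mul' ℂ A :=
  G.functional_choose_mul' ω

variable {G}

theorem IsRightProd.lact_dualComulₗ {ω ω₂ : G.Hat} {z : G.Hat ⊗[ℂ] G.Hat}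
    (hz : G.IsRightProd ω ω₂ z) (ω₁ : G.Hat) :
    (G.dualComulₗ ω).lact (ω₁ ⊗ₜ ω₂) = (tens (emb G.Hat ω₁) 1).ract z :=
  G.hat₂_injective (by
    rw [hz.hat₂_ract_eq, (G.isDualPair₂.implements_functional _ _).1, functional_dualComulₗ])

theorem IsLeftProd.ract_dualComulₗ {ω ω₁ : G.Hat} {z : G.Hat ⊗[ℂ] G.Hat}
    (hz : G.IsLeftProd ω₁ ω z) (ω₂ : G.Hat) :
    (G.dualComulₗ ω).ract (ω₁ ⊗ₜ ω₂) = (tens 1 (emb G.Hat ω₂)).lact z :=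
  G.hat₂_injective (by
    rw [hz.hat₂_lact_eq, (G.isDualPair₂.implements_functional _ _).2, functional_dualComulₗ])

theorem rightElt_comul₂_ract (v : G.Hat) (z : G.Hat ⊗[ℂ] G.Hat) (x y : A) :
    rightElt G.comul₂ (G.hat₂ ((tens (emb G.Hat v) 1).ract z)) (x ⊗ₜ y) =
      rightElt G.comul₂ (G.hat₂ z) (rightElt G.comulₗ v.1 x ⊗ₜ y) :=
  eqOn_of_tmul (f := rightEltₗ G.comul₂ (x ⊗ₜ[ℂ] y) ∘ₗ G.hat₂ ∘ₗ (tens (emb G.Hat v) 1).ract)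
    (g := rightEltₗ G.comul₂ (rightElt G.comulₗ v.1 x ⊗ₜ[ℂ] y) ∘ₗ G.hat₂) (fun w w' => by
      simp only [LinearMap.comp_apply, ract_tens_tmul, ract_emb, Mult.ract_one, rightEltₗ_apply,
        rightElt_comul₂]
      exact congrArg (· ⊗ₜ[ℂ] _) (G.isDualPair.rightElt_mul w v x)) z

/-- `Σ b (ι ⊙ ωᵢ)Δ(x) (ι ⊙ ωᵢ')Δ(y) c` for `z = Σ ωᵢ ⊗ ωᵢ'`, as a slice of
`(b ⊗ 1)Δ(x) ⊗ Δ(y)(c ⊗ 1)` that involves `z` only as a functional on `A ⊙ A`. -/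
theorem mul_mul'_rightElt_mul (z : G.Hat ⊗[ℂ] G.Hat) (b c x y : A) :
    b * LinearMap.mul' ℂ A (rightElt G.comul₂ (G.hat₂ z) (x ⊗ₜ y)) * c =
      rslice (G.hat₂ z) ((LinearMap.mul' ℂ A).rTensor (A ⊗[ℂ] A)
        (TensorProduct.tensorTensorTensorComm ℂ A A A A
          (G.can₃ (b ⊗ₜ x) ⊗ₜ G.can₁ (c ⊗ₜ y)))) := by
  rw [rslice_rTensor]
  induction z with
  | zero =>
    rw [map_zero, rightElt_zero]
    simp [rslice]
  | add u v hu hv =>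
    have h : ∀ (f g : Module.Dual ℂ (A ⊗[ℂ] A)) (t : (A ⊗[ℂ] A) ⊗[ℂ] (A ⊗[ℂ] A)),
        rslice (f + g) t = rslice f t + rslice g t := fun f g t => by simp [rslice]
    rw [map_add, rightElt_add, h, LinearMap.add_apply, map_add, map_add, mul_add, add_mul, hu, hv]
  | tmul v w =>
    refine Eq.trans ?_ (congrArg (LinearMap.mul' ℂ A) (sliceR_tensorTensorTensorComm v.1 w.1
      (G.can₃ (b ⊗ₜ x) ⊗ₜ G.can₁ (c ⊗ₜ y)))).symm
    rw [TensorProduct.map_tmul, hat_can₃, hat_can₁, rightElt_comul₂, LinearMap.mul'_apply,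
      LinearMap.mul'_apply]
    simp only [mul_assoc]

theorem rslice_mul_lTensor (ω : Module.Dual ℂ A) (r : A →ₗ[ℂ] A) (s t : A ⊗[ℂ] A) :
    rslice ((ω ∘ₗ LinearMap.mul' ℂ A) ∘ₗ r.lTensor A) ((LinearMap.mul' ℂ A).rTensor (A ⊗[ℂ] A)
      (TensorProduct.tensorTensorTensorComm ℂ A A A A (s ⊗ₜ t))) =
      rslice ω (s * r.lTensor A t) := by
  induction s with
  | zero => simp
  | add u v hu hv => simp only [TensorProduct.add_tmul, map_add, hu, hv, add_mul]
  | tmul p q =>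
    induction t with
    | zero => simp
    | add u v hu hv => simp only [TensorProduct.tmul_add, map_add, hu, hv, mul_add]
    | tmul p' q' => simp [Algebra.TensorProduct.tmul_mul_tmul]

/-- `Σ (ι ⊙ ωᵢ)Δ(x) (ι ⊙ ωᵢ')Δ(y) = (ι ⊙ ω)Δ(x (ι ⊙ ω₂)Δ(y))` when `Σ ωᵢ ⊗ ωᵢ'` is the functional
`x ⊗ y ↦ ω(x (ι ⊙ ω₂)Δ(y))`: this is coassociativity together with the multiplicativity of `Δ`. -/
theorem IsRightProd.mul'_rightElt {ω ω₂ : G.Hat} {z : G.Hat ⊗[ℂ] G.Hat}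
    (hz : G.IsRightProd ω ω₂ z) (x y : A) :
    LinearMap.mul' ℂ A (rightElt G.comul₂ (G.hat₂ z) (x ⊗ₜ y)) =
      rightElt G.comulₗ ω.1 (x * rightElt G.comulₗ ω₂.1 y) := by
  have hz' : G.hat₂ z = (ω.1 ∘ₗ LinearMap.mul' ℂ A) ∘ₗ (rightElt G.comulₗ ω₂.1).lTensor A :=
    TensorProduct.ext' fun x y => hz x y
  have hcan : ∀ c, (rightElt G.comulₗ ω₂.1).lTensor A (G.can₁ (c ⊗ₜ y)) =
      G.can₁ (c ⊗ₜ rightElt G.comulₗ ω₂.1 y) := fun c => by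
    obtain ⟨a, rfl⟩ := G.toHat_surjective ω₂
    rw [rightElt_toHat_eq_rco]
    have h := G.toMultHopf.coassoc₁₄.lTensor_rco G.haar a (c ⊗ₜ y)
    rw [LinearMap.lTensor_tmul] at h
    exact h.symm
  have hmul : ∀ b c u, G.can₃ (b ⊗ₜ x) * G.can₁ (c ⊗ₜ u) =
      (LinearMap.mul ℂ A b).rTensor A (G.can₁ (c ⊗ₜ (x * u))) := fun b c u => by
    apply emb_injective G.nondeg₂
    rw [map_mul, rTensor_mulLeft, ← mul_emb, emb_can₃, emb_can₁, emb_can₁, comulₗ_mul]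
    simp only [mul_assoc]
  rw [← sub_eq_zero]
  refine (G.regular.nondeg _).2 fun b => (G.regular.nondeg _).1 fun c => ?_
  rw [mul_sub, sub_mul, sub_eq_zero, mul_mul'_rightElt_mul, hz', rslice_mul_lTensor, hcan, hmul,
    rslice_rTensor, mul_assoc]
  exact congrArg (b * ·) (G.hat_can₁ ω c _)

/-- The action of `Δ̂(ω)` on `Â ⊙ Â` is seen through the multiplication of `A` as the action of
`ω`. -/
theorem mul'_rightElt_dualComulₗ (ω : G.Hat) (v : G.Hat ⊗[ℂ] G.Hat) (t : A ⊗[ℂ] A) :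
    LinearMap.mul' ℂ A (rightElt G.comul₂ (G.hat₂ ((G.dualComulₗ ω).lact v)) t) =
      rightElt G.comulₗ ω.1 (LinearMap.mul' ℂ A (rightElt G.comul₂ (G.hat₂ v) t)) := by
  induction v with
  | zero => simp [rightElt_zero]
  | add u v hu hv => simp only [map_add, rightElt_add, LinearMap.add_apply, hu, hv]
  | tmul ω₁ ω₂ =>
    obtain ⟨z, hz⟩ := G.exists_isRightProd_and_span.1 ω ω₂
    induction t with
    | zero => simp
    | add s t hs ht => simp only [map_add, hs, ht]
    | tmul x y =>
      rw [hz.lact_dualComulₗ, rightElt_comul₂_ract, hz.mul'_rightElt, rightElt_comul₂,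
        LinearMap.mul'_apply]

variable (G)

/-- The dual comultiplication. It is multiplicative because the action of `Δ̂(ω)` corresponds to
that of `ω`, by `mul'_rightElt_dualComulₗ`. -/
def dualComul : G.Hat →ₙₐ[ℂ] Mult (G.Hat ⊗[ℂ] G.Hat) where
  toFun := G.dualComulₗ
  map_smul' := map_smul G.dualComulₗ
  map_zero' := map_zero G.dualComulₗ
  map_add' := map_add G.dualComulₗ
  map_mul' ω ω' := G.isDualPair₂.functional_injective
    (G.isDualPair₂.ext_functional fun v t => by
      rw [G.isDualPair₂.functional_mul_rightElt, functional_dualComulₗ, functional_dualComulₗ,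
        LinearMap.comp_apply, LinearMap.comp_apply, mul'_rightElt_dualComulₗ, Hat.mul_apply])

theorem nondegHom_dualComul :
    NondegHom (G.dualComul : G.Hat →ₗ[ℂ] Mult (G.Hat ⊗[ℂ] G.Hat)) := by
  constructor
  · refine span_tensor G.span_hat_mul Submodule.span_univ _ ?_
    rintro _ ⟨v, w, rfl⟩ u -
    have h : Submodule.span ℂ {z | ∃ ω₁ ω₂, G.IsRightProd ω₁ ω₂ z} ≤
        (Submodule.span ℂ {z | ∃ a b, z = (G.dualComulₗ a).lact b}).comap
          (tens (emb G.Hat w) 1).ract := by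
      rw [Submodule.span_le]
      rintro z ⟨ω, ω₂, hz⟩
      exact Submodule.subset_span ⟨ω, w ⊗ₜ ω₂, (hz.lact_dualComulₗ w).symm⟩
    exact h (G.exists_isRightProd_and_span.2 ▸ Submodule.mem_top : v ⊗ₜ u ∈ _)
  · refine span_tensor Submodule.span_univ G.span_hat_mul _ ?_
    rintro u - _ ⟨v, w, rfl⟩
    have h : Submodule.span ℂ {z | ∃ ω₁ ω₂, G.IsLeftProd ω₁ ω₂ z} ≤
        (Submodule.span ℂ {z | ∃ a b, z = (G.dualComulₗ a).ract b}).comap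
          (tens 1 (emb G.Hat v)).lact := by
      rw [Submodule.span_le]
      rintro z ⟨ω₁, ω, hz⟩
      exact Submodule.subset_span ⟨ω, ω₁ ⊗ₜ v, (hz.ract_dualComulₗ v).symm⟩
    exact h (G.exists_isLeftProd_and_span.2 ▸ Submodule.mem_top : u ⊗ₜ w ∈ _)

theorem hat₂_toAlg_right (ω₁ ω₂ : G.Hat) (x y : A) :
    G.hat₂ (ω₁ ⊗ₜ ω₂) (toAlg (tens (emb A x) 1 * G.comulₗ y)) =
      ω₁.1 (x * rightElt G.comulₗ ω₂.1 y) := by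
  rw [← emb_can₃, toAlg_emb G.nondeg₂, hat₂_tmul_apply]
  exact congrArg ω₁.1 (G.hat_can₃ ω₂ x y)

theorem hat₂_toAlg_left (ω₁ ω₂ : G.Hat) (x y : A) :
    G.hat₂ (ω₁ ⊗ₜ ω₂) (toAlg (G.comulₗ x * tens 1 (emb A y))) =
      ω₂.1 (leftElt G.comulₗ ω₁.1 x * y) := by
  rw [← emb_can₂, toAlg_emb G.nondeg₂, hat₂_tmul_apply, apply_rslice]
  exact congrArg ω₂.1 (G.hat_can₂ ω₁ y x)

variable {G} in
theorem IsRightProd.dualComulₗ_mul {ω₁ ω₂ : G.Hat} {z : G.Hat ⊗[ℂ] G.Hat}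
    (hz : G.IsRightProd ω₁ ω₂ z) :
    G.dualComulₗ ω₁ * tens 1 (emb G.Hat ω₂) = emb (G.Hat ⊗[ℂ] G.Hat) z := by
  refine G.isDualPair₂.functional_injective
    (ext_on_tensor G.isDualPair.span_rightElt G.isDualPair.span_rightElt ?_)
  rintro _ ⟨v, x, rfl⟩ _ ⟨w, y, rfl⟩
  rw [IsDualPair.functional_emb]
  refine Eq.trans ?_ (hz _ _).symm
  refine (congrArg _ (G.rightElt_comul₂ v w x y).symm).trans ?_
  rw [G.isDualPair₂.functional_mul_rightElt, lact_tens_tmul, Mult.lact_one, lact_emb,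
    functional_dualComulₗ, rightElt_comul₂, LinearMap.comp_apply, LinearMap.mul'_apply]
  exact congrArg (fun t => ω₁.1 (_ * t)) (G.isDualPair.rightElt_mul ω₂ w y)

variable {G} in
theorem IsLeftProd.mul_dualComulₗ {ω₁ ω₂ : G.Hat} {z : G.Hat ⊗[ℂ] G.Hat}
    (hz : G.IsLeftProd ω₁ ω₂ z) :
    tens (emb G.Hat ω₁) 1 * G.dualComulₗ ω₂ = emb (G.Hat ⊗[ℂ] G.Hat) z := by
  refine G.isDualPair₂.functional_injective
    (ext_on_tensor G.span_leftElt G.span_leftElt ?_)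
  rintro _ ⟨v, x, rfl⟩ _ ⟨w, y, rfl⟩
  rw [IsDualPair.functional_emb, hz, ← leftElt_comul₂, G.isDualPair₂.functional_leftElt,
    Mult.ract_mul, ract_tens_tmul, ract_emb, Mult.ract_one, ← G.isDualPair₂.functional_leftElt,
    functional_dualComulₗ, leftElt_comul₂, LinearMap.comp_apply, LinearMap.mul'_apply]
  exact congrArg (fun t => ω₂.1 (t * _)) (G.isDualPair.leftElt_mul v ω₁ x)

theorem isDualComul_dualComul : G.IsDualComul G.dualComul where
  nondegHom := G.nondegHom_dualComul
  mul_right ω₁ ω₂ := by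
    obtain ⟨z, hz⟩ := G.exists_isRightProd_and_span.1 ω₁ ω₂
    exact ⟨z, hz.dualComulₗ_mul, fun x y => by rw [hat₂_toAlg_right, hz]⟩
  mul_left ω₁ ω₂ := by
    obtain ⟨z, hz⟩ := G.exists_isLeftProd_and_span.1 ω₁ ω₂
    exact ⟨z, hz.mul_dualComulₗ, fun x y => by rw [hat₂_toAlg_left, hz]⟩

variable {G} in
theorem IsDualComul.eq {D : G.Hat →ₙₐ[ℂ] Mult (G.Hat ⊗[ℂ] G.Hat)} (hD : G.IsDualComul D) :
    D = G.dualComul := by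
  refine DFunLike.ext _ _ fun ω => ?_
  have hl : (D ω).lact = (G.dualComulₗ ω).lact := by
    refine ext_on_tensor Submodule.span_univ G.span_hat_mul ?_
    rintro u - _ ⟨v, w, rfl⟩
    obtain ⟨z, hz, hz'⟩ := hD.mul_right ω v
    have h : G.IsRightProd ω v z := fun x y => by rw [hz', hat₂_toAlg_right]
    exact congrArg (fun T => Mult.lact T (u ⊗ₜ w)) (hz.trans h.dualComulₗ_mul.symm)
  have hr : (D ω).ract = (G.dualComulₗ ω).ract := by
    refine ext_on_tensor G.span_hat_mul Submodule.span_univ ?_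
    rintro _ ⟨v, w, rfl⟩ u -
    obtain ⟨z, hz, hz'⟩ := hD.mul_left w ω
    have h : G.IsLeftProd w ω z := fun x y => by rw [hz', hat₂_toAlg_left]
    exact congrArg (fun T => Mult.ract T (v ⊗ₜ u)) (hz.trans h.mul_dualComulₗ.symm)
  exact Mult.ext' (DFunLike.congr_fun hl) (DFunLike.congr_fun hr)

/-- `Δ̂(T)(x ⊗ y) = T(xy)` for `T ∈ M(Â)`: as `Δ̂(T)Δ̂(ω) = Δ̂(Tω)`, both sides agree on the
elements `(ι ⊙ Δ̂(ω)v)Δ(t)`, which span `A ⊙ A`. -/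
theorem functional_extend (T : Mult G.Hat) :
    G.isDualPair₂.functional
        (extend (G.dualComul : G.Hat →ₗ[ℂ] Mult (G.Hat ⊗[ℂ] G.Hat)) T) =
      G.isDualPair.functional T ∘ₗ LinearMap.mul' ℂ A := by
  have hE : ∀ ω, extend (G.dualComul : G.Hat →ₗ[ℂ] Mult (G.Hat ⊗[ℂ] G.Hat)) T * G.dualComulₗ ω =
      G.dualComulₗ (T.lact ω) := fun ω =>
    (extend_spec (G.nondegAlg_hat.tensor G.nondegAlg_hat) G.nondegHom_dualComul T ω).1
  refine G.isDualPair₂.ext_functional fun z t => ?_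
  have hspan : Submodule.span ℂ {z | ∃ a b, z = (G.dualComulₗ a).lact b} = ⊤ :=
    G.nondegHom_dualComul.1
  refine LinearMap.eqOn_span
    (f := G.isDualPair₂.functional (extend (G.dualComul : G.Hat →ₗ[ℂ] Mult (G.Hat ⊗[ℂ] G.Hat)) T)
      ∘ₗ rightEltₗ G.comul₂ t ∘ₗ G.hat₂)
    (g := (G.isDualPair.functional T ∘ₗ LinearMap.mul' ℂ A) ∘ₗ rightEltₗ G.comul₂ t ∘ₗ G.hat₂)
    ?_ (hspan ▸ Submodule.mem_top : z ∈ _)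
  rintro _ ⟨ω, v, rfl⟩
  simp only [LinearMap.comp_apply, rightEltₗ_apply]
  rw [← G.isDualPair₂.functional_mul_rightElt, hE, functional_dualComulₗ, mul'_rightElt_dualComulₗ,
    LinearMap.comp_apply]
  exact (G.isDualPair.functional_rightElt T ω _).symm

/-- `[S(T₁ ⊗ T₂)](x ⊗ y) = S((ι ⊙ T₁)Δ(x) ⊗ (ι ⊙ T₂)Δ(y))` for `S ∈ M(Â ⊙ Â)`. -/
theorem functional_mul_tens (S : Mult (G.Hat ⊗[ℂ] G.Hat)) (T₁ T₂ : Mult G.Hat) (x y : A) :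
    G.isDualPair₂.functional (S * tens T₁ T₂) (x ⊗ₜ y) =
      G.isDualPair₂.functional S (rightElt G.comulₗ (G.isDualPair.functional T₁) x ⊗ₜ
        rightElt G.comulₗ (G.isDualPair.functional T₂) y) := by
  refine DFunLike.congr_fun (ext_on_tensor G.isDualPair.span_rightElt G.isDualPair.span_rightElt
    (f := G.isDualPair₂.functional (S * tens T₁ T₂))
    (g := G.isDualPair₂.functional S ∘ₗ
      TensorProduct.map (rightElt G.comulₗ (G.isDualPair.functional T₁))
        (rightElt G.comulₗ (G.isDualPair.functional T₂))) ?_) (x ⊗ₜ y)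
  rintro _ ⟨v, x, rfl⟩ _ ⟨w, y, rfl⟩
  refine (congrArg _ (G.rightElt_comul₂ v w x y).symm).trans ?_
  rw [G.isDualPair₂.functional_mul_rightElt, lact_tens_tmul, rightElt_comul₂, LinearMap.comp_apply,
    TensorProduct.map_tmul, ← rightElt_functional, ← rightElt_functional]
  rfl

end AlgebraicQuantumGroup

end DualComultiplication

end AQG

end

theorem mainTheorem2 {A : Type*} [NonUnitalRing A] [Module ℂ A] [IsScalarTower ℂ A A]
    [SMulCommClass ℂ A A] (G : AQG.AlgebraicQuantumGroup A) :
    ∃ (F : AQG.Mult G.Hat →ₗ[ℂ] Module.Dual ℂ A)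
      (F₂ : AQG.Mult (G.Hat ⊗[ℂ] G.Hat) →ₗ[ℂ] Module.Dual ℂ (A ⊗[ℂ] A))
      (D : G.Hat →ₙₐ[ℂ] AQG.Mult (G.Hat ⊗[ℂ] G.Hat)),
      -- the identification of `M(Â)` with a space of functionals on `A`
      (∀ T ω, AQG.Implements G.comulₗ G.hat.subtype T ω ↔ ω = F T) ∧
      Function.Injective F ∧
      Set.range F = AQG.smoothFunctionals G.comulₗ ∧
      -- the embedding of `M(Â ⊙ Â)` into the functionals on `A ⊙ A`
      (∀ T θ, AQG.Implements G.comul₂ G.hat₂ T θ ↔ θ = F₂ T) ∧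
      Function.Injective F₂ ∧
      -- `D` is the dual comultiplication, determined by its defining properties
      (∀ D', G.IsDualComul D' ↔ D' = D) ∧
      -- `Δ̂(ω)(a ⊗ b) = ω(ab)` for `ω ∈ M(Â)`
      (∀ (T : AQG.Mult G.Hat) (a b : A),
        F₂ (AQG.extend (D : G.Hat →ₗ[ℂ] AQG.Mult (G.Hat ⊗[ℂ] G.Hat)) T) (a ⊗ₜ b) =
          F T (a * b)) ∧
      -- `[Δ̂(ω)(ω₁ ⊗ ω₂)](x ⊗ y) = ω((ι ⊙ ω₁)Δ(x) (ι ⊙ ω₂)Δ(y))` for `ω, ω₁, ω₂ ∈ M(Â)`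
      (∀ (T T₁ T₂ : AQG.Mult G.Hat) (x y : A),
        F₂ (AQG.extend (D : G.Hat →ₗ[ℂ] AQG.Mult (G.Hat ⊗[ℂ] G.Hat)) T * AQG.tens T₁ T₂)
            (x ⊗ₜ y) =
          F T (AQG.rightElt G.comulₗ (F T₁) x * AQG.rightElt G.comulₗ (F T₂) y)) := by
  refine ⟨G.isDualPair.functional, G.isDualPair₂.functional, G.dualComul,
    G.isDualPair.implements_iff, G.isDualPair.functional_injective, G.range_functional,
    G.isDualPair₂.implements_iff, G.isDualPair₂.functional_injective,
    fun D' => ⟨fun h => h.eq, fun h => h ▸ G.isDualComul_dualComul⟩, fun T a b => ?_,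
    fun T T₁ T₂ x y => ?_⟩
  · rw [G.functional_extend, LinearMap.comp_apply, LinearMap.mul'_apply]
  · rw [G.functional_mul_tens, G.functional_extend, LinearMap.comp_apply, LinearMap.mul'_apply]
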